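/- Let $d\ge 2$, let $\Omega\subset\mathbb{R}^d$ be a bounded open set with Lipschitz boundary $\Gamma=\partial\Omega$, equipped with the $(d-1)$-dimensional Hausdorff measure $\sigma$, and let $\beta\in L^\infty(\Gamma)$ be complex-valued. For $u\in H^1(\Omega)$ let $u_\Gamma\in L^2(\Gamma)$ denote its trace, i.e. the $L^2(\Gamma)$-limit of $u_n|_\Gamma$ for any functions $u_n\in C(\overline\Omega)\cap H^1(\Omega)$ with $u_n\to u$ in $H^1(\Omega)$ for which $u_n|_\Gamma$ converges in $L^2(\Gamma)$. For $\lambda\in\mathbb{R}$ and $u,v\in H^1(\Omega)$ put \[ \mathfrak a_\lambda(u,v)=\int_\Omega\nabla u\cdot\overline{\nabla v}+\int_\Gamma\beta u_\Gamma\overline{v_\Gamma}\,d\sigma+\lambda\Bigl(\int_\Omega u\overline v+\int_\Gamma u_\Gamma\overline{v_\Gamma}\,d\sigma\Bigr). \] Let $\omega_0\ge 0$ be such that $\mathfrak a_{\omega_0}$ is coercive, i.e. there is $\alpha>0$ with $\operatorname{Re}\mathfrak a_{\omega_0}(v,v)\ge\alpha\|v\|_{H^1(\Omega)}^2$ for all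 $v\in H^1(\Omega)$. Let $p,q\in(0,\infty]$ with $p>\frac d2$ and $q>d-1$, and let $\lambda\ge\omega_0$. Then for all $f\in L^p(\Omega)$ and $g\in L^q(\Gamma)$ the Robin problem \[ \lambda u-\Delta u=f \text{ in }\Omega,\qquad \partial_\nu u+(\lambda+\beta)u_\Gamma=g\text{ on }\Gamma \] has a unique weak solution $u\in H^1(\Omega)$, that is, a unique $u\in H^1(\Omega)$ with $\mathfrak a_\lambda(u,v)=\int_\Omega f\overline v+\int_\Gamma g\overline{v_\Gamma}\,d\sigma$ for all $v\in H^1(\Omega)$. Moreover $u\in L^\infty(\Omega)$, and there is a constant $c>0$, independent of $f$ and $g$, such that \[ \|u\|_{L^\infty(\Omega)}\le c\bigl(\|f\|_{L^p(\Omega)}+\|g\|_{L^q(\Gamma)}\bigr). \] -/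

import Mathlib

open MeasureTheory Filter Topology Set
open scoped ENNReal NNReal ContDiff ComplexConjugate

noncomputable section

namespace RobinProblem

/-- The set `Ω` has Lipschitz boundary: near each boundary point `z`, in orthogonal coordinates
with one axis spanned by a unit vector `ν`, the set `Ω` is the strict subgraph of a Lipschitz
function `h` of the remaining variables.  (The point `x - ⟪ν, x⟫ ν` is the orthogonal projection
of `x` onto the hyperplane `ν^⊥`, so only the restriction of `h` to this hyperplane matters.) -/
def HasLipschitzBoundary {d : ℕ} (Ω : Set (EuclideanSpace ℝ (Fin d))) : Prop :=
  ∀ z ∈ frontier Ω, ∃ U : Set (EuclideanSpace ℝ (Fin d)), IsOpen U ∧ z ∈ U ∧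
    ∃ ν : EuclideanSpace ℝ (Fin d), ‖ν‖ = 1 ∧
      ∃ (K : ℝ≥0) (h : EuclideanSpace ℝ (Fin d) → ℝ), LipschitzWith K h ∧
        ∀ x ∈ U, x ∈ Ω ↔ inner ℝ ν x < h (x - inner ℝ ν x • ν)

/-- The `(d-1)`-dimensional Hausdorff measure (normalised to agree with Lebesgue measure on
hyperplanes) on the boundary `Γ = ∂Ω`. -/
def surfaceMeasure {d : ℕ} (Ω : Set (EuclideanSpace ℝ (Fin d))) :
    Measure (EuclideanSpace ℝ (Fin d)) :=
  (Measure.euclideanHausdorffMeasure (d - 1)).restrict (frontier Ω)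

/-- `u ∈ H¹(Ω)` (complex-valued) with weak gradient `Du`. -/
structure IsH1 {d : ℕ} (Ω : Set (EuclideanSpace ℝ (Fin d)))
    (u : EuclideanSpace ℝ (Fin d) → ℂ)
    (Du : EuclideanSpace ℝ (Fin d) → EuclideanSpace ℂ (Fin d)) : Prop where
  memLp : MemLp u 2 (volume.restrict Ω)
  memLp_grad : MemLp Du 2 (volume.restrict Ω)
  weak_grad : ∀ η : EuclideanSpace ℝ (Fin d) → ℝ, ContDiff ℝ ∞ η → HasCompactSupport η →
    tsupport η ⊆ Ω → ∀ i : Fin d,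
      ∫ x in Ω, u x * ((fderiv ℝ η x (EuclideanSpace.single i 1) : ℝ) : ℂ) =
        - ∫ x in Ω, Du x i * ((η x : ℝ) : ℂ)

/-- `u ∈ H¹(Ω)` with weak gradient `Du`, and `φ ∈ L²(Γ)` is a trace of `u`: there are
`uₙ ∈ C(closure Ω) ∩ H¹(Ω)` with `uₙ → u` in `H¹(Ω)` and `uₙ|Γ → φ` in `L²(Γ)`. -/
structure HasTrace {d : ℕ} (Ω : Set (EuclideanSpace ℝ (Fin d)))
    (u : EuclideanSpace ℝ (Fin d) → ℂ)
    (Du : EuclideanSpace ℝ (Fin d) → EuclideanSpace ℂ (Fin d))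
    (φ : EuclideanSpace ℝ (Fin d) → ℂ) : Prop where
  isH1 : IsH1 Ω u Du
  memLp_trace : MemLp φ 2 (surfaceMeasure Ω)
  exists_approx : ∃ (U : ℕ → EuclideanSpace ℝ (Fin d) → ℂ)
    (DU : ℕ → EuclideanSpace ℝ (Fin d) → EuclideanSpace ℂ (Fin d)),
    (∀ n, ContinuousOn (U n) (closure Ω) ∧ IsH1 Ω (U n) (DU n)) ∧
    Tendsto (fun n => eLpNorm (U n - u) 2 (volume.restrict Ω)) atTop (𝓝 0) ∧
    Tendsto (fun n => eLpNorm (DU n - Du) 2 (volume.restrict Ω)) atTop (𝓝 0) ∧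
    Tendsto (fun n => eLpNorm (U n - φ) 2 (surfaceMeasure Ω)) atTop (𝓝 0)

/-- The sesquilinear form `𝔞_λ(u, v) = ∫_Ω ∇u · conj ∇v + ∫_Γ β u_Γ conj v_Γ
+ λ (∫_Ω u conj v + ∫_Γ u_Γ conj v_Γ)`, where `Du, Dv` are the gradients and `φ, ψ` the traces
of `u, v`. -/
def form {d : ℕ} (Ω : Set (EuclideanSpace ℝ (Fin d))) (β : EuclideanSpace ℝ (Fin d) → ℂ) (lam : ℝ)
    (u : EuclideanSpace ℝ (Fin d) → ℂ)
    (Du : EuclideanSpace ℝ (Fin d) → EuclideanSpace ℂ (Fin d))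
    (φ : EuclideanSpace ℝ (Fin d) → ℂ)
    (v : EuclideanSpace ℝ (Fin d) → ℂ)
    (Dv : EuclideanSpace ℝ (Fin d) → EuclideanSpace ℂ (Fin d))
    (ψ : EuclideanSpace ℝ (Fin d) → ℂ) : ℂ :=
  (∫ x in Ω, ∑ i, Du x i * conj (Dv x i))
    + (∫ z, β z * φ z * conj (ψ z) ∂(surfaceMeasure Ω))
    + (lam : ℂ) * ((∫ x in Ω, u x * conj (v x)) + ∫ z, φ z * conj (ψ z) ∂(surfaceMeasure Ω))

/-- The form `𝔞_λ` is coercive on `H¹(Ω)`. -/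
def FormCoercive {d : ℕ} (Ω : Set (EuclideanSpace ℝ (Fin d)))
    (β : EuclideanSpace ℝ (Fin d) → ℂ) (lam : ℝ) : Prop :=
  ∃ α : ℝ, 0 < α ∧ ∀ v Dv ψ, HasTrace Ω v Dv ψ →
    α * ((∫ x in Ω, ‖v x‖ ^ 2) + ∫ x in Ω, ‖Dv x‖ ^ 2) ≤ (form Ω β lam v Dv ψ v Dv ψ).re

/-- `u ∈ H¹(Ω)` is a weak solution of `λ u - Δ u = f` in `Ω`, `∂_ν u + (λ + β) u_Γ = g` on `Γ`:
`𝔞_λ(u, v) = ∫_Ω f conj v + ∫_Γ g conj v_Γ` for all `v ∈ H¹(Ω)`. -/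
def IsWeakSolution {d : ℕ} (Ω : Set (EuclideanSpace ℝ (Fin d)))
    (β : EuclideanSpace ℝ (Fin d) → ℂ) (lam : ℝ)
    (f g u : EuclideanSpace ℝ (Fin d) → ℂ) : Prop :=
  ∃ Du φ, HasTrace Ω u Du φ ∧ ∀ v Dv ψ, HasTrace Ω v Dv ψ →
    form Ω β lam u Du φ v Dv ψ =
      (∫ x in Ω, f x * conj (v x)) + ∫ z, g z * conj (ψ z) ∂(surfaceMeasure Ω)

end RobinProblem

end

noncomputable section

/-! Existence and uniqueness are Lax–Milgram; the bound is a De Giorgi iteration on the superlevel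
sets of |u| in Ω and of |u_Γ| on Γ simultaneously. Both rest on one analytic input: the H¹ norm
controls the L^r(Ω) norm of u and the L^s(Γ) norm of its trace for all finite exponents r, s ≥ 2
strictly below the critical ones, r(d-2) < 2d and s(d-2) < 2(d-1).

The Sobolev and trace inequalities are proved together. A Lipschitz domain has the cone property up
to its boundary. Averaging a continuous H¹ function over the cone at x at scale τ, differentiating
in τ and integrating by parts bounds |u(x)| by a mean of |u| plus an integral over τ of scaled
averages of |∇u| (`exists_nhds_enorm_le`). This operator maps L² to L^r(μ) for every measure μ with
μ(B(y,ρ)) ≲ ρ^n and r(d-2) < 2n (`exists_lintegral_average_rpow_le`); Lebesgue measure (n = d) and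
surface measure (n = d-1) are the two instances (`exists_eLpNorm_le_of_hasTrace`).

For existence, the triples (u, ∇u, u_Γ) form a closed subspace of a product of L² spaces. The trace
inequality makes the form coercive in the norm of that product, and the data define a bounded
functional by Hölder and Sobolev.

For the bound, the equation is tested with T(u), where T is a C¹ radial truncation that vanishes for
|z| ≤ k. The gradient inequality |DT ζ|² ≤ Re(DT ζ · conj ζ) and coercivity give an energy estimate
(`truncated_energy_le`). Since β is complex, the truncation does not respect the boundary term, but
the error is at most ‖β‖_∞ h ∫|T(u_Γ)|, which acts like an additional bounded boundary datum of size
h. The strict inequalities p > d/2 and q > d-1 leave room to choose r, s so that the level-set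
quantity satisfies a superlinear recursion (`exists_level_set_estimate`), and
`exists_deGiorgi_bound` makes it vanish at a level proportional to the data. -/

namespace RobinProblem

/-! ### Geometry of Lipschitz domains: cones at the boundary and growth of the surface measure. -/

/-- The local uniform cone condition of `Ω` at `z`: for points `x ∈ closure Ω` near `z`, the
truncated cone with vertex `x` spanned by a small ball around `-ν` lies in `Ω`. -/
def ConeConditionAt {d : ℕ} (Ω : Set (EuclideanSpace ℝ (Fin d)))
    (z : EuclideanSpace ℝ (Fin d)) : Prop :=
  ∃ W ∈ 𝓝 z, ∃ (ν : EuclideanSpace ℝ (Fin d)) (c t₀ : ℝ), ‖ν‖ ≤ 1 ∧ 0 < c ∧ c ≤ 1 ∧ 0 < t₀ ∧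
    ∀ x ∈ W ∩ closure Ω, ∀ τ, 0 < τ → τ ≤ t₀ → ∀ ξ ∈ Metric.closedBall ν c, x - τ • ξ ∈ Ω

theorem le_graph_of_mem_closure {d : ℕ} {Ω U : Set (EuclideanSpace ℝ (Fin d))}
    (hU : IsOpen U) {ν : EuclideanSpace ℝ (Fin d)} {K : ℝ≥0}
    {h : EuclideanSpace ℝ (Fin d) → ℝ} (hh : LipschitzWith K h)
    (hUΩ : ∀ x ∈ U, x ∈ Ω ↔ inner ℝ ν x < h (x - inner ℝ ν x • ν))
    {x : EuclideanSpace ℝ (Fin d)} (hx : x ∈ closure Ω) (hxU : x ∈ U) :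
    inner ℝ ν x ≤ h (x - inner ℝ ν x • ν) := by
  have hx' : x ∈ closure (U ∩ Ω) := by
    rw [mem_closure_iff_nhds] at hx ⊢
    intro t ht
    obtain ⟨y, hy1, hy2⟩ := hx (t ∩ U) (inter_mem ht (hU.mem_nhds hxU))
    exact ⟨y, hy1.1, hy1.2, hy2⟩
  have hcl : IsClosed {y : EuclideanSpace ℝ (Fin d) |
      inner ℝ ν y ≤ h (y - inner ℝ ν y • ν)} := by
    apply isClosed_le (by fun_prop)
    exact hh.continuous.comp (by fun_prop)
  exact hcl.closure_subset_iff.mpr (fun y hy => ((hUΩ y hy.1).1 hy.2).le) hx'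

theorem norm_sub_inner_smul_le {d : ℕ} {ν : EuclideanSpace ℝ (Fin d)} (hν : ‖ν‖ = 1)
    (b : EuclideanSpace ℝ (Fin d)) : ‖b - inner ℝ ν b • ν‖ ≤ ‖b‖ := by
  have hνν : inner ℝ ν ν = (1 : ℝ) := by rw [real_inner_self_eq_norm_sq, hν]; norm_num
  have : ‖b - inner ℝ ν b • ν‖ ^ 2 ≤ ‖b‖ ^ 2 := by
    rw [← real_inner_self_eq_norm_sq, ← real_inner_self_eq_norm_sq, inner_sub_left,
      inner_sub_right, inner_sub_right, inner_smul_left, inner_smul_left, inner_smul_right,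
      inner_smul_right, hνν, real_inner_comm b ν]
    simp only [conj_trivial]
    nlinarith [sq_nonneg (inner ℝ ν b : ℝ)]
  exact le_of_sq_le_sq this (norm_nonneg _)

/-- Moving by -τ(ν + b) lowers the height ⟪ν, x⟫ by at least τ(1 - c), while the graph over the
moved point descends by at most Kτc. A small c makes the first effect win strictly, so a point of
the closure is pushed into Ω. -/
theorem coneConditionAt_of_mem_closure {d : ℕ} {Ω : Set (EuclideanSpace ℝ (Fin d))}
    (hΩ : IsOpen Ω) (hlip : HasLipschitzBoundary Ω) {z : EuclideanSpace ℝ (Fin d)}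
    (hz : z ∈ closure Ω) : ConeConditionAt Ω z := by
  by_cases hzΩ : z ∈ Ω
  · obtain ⟨ε, hε, hball⟩ := Metric.isOpen_iff.1 hΩ z hzΩ
    -- At an interior point the axis is 0, so the cone degenerates to a ball around x.
    refine ⟨Metric.ball z (ε / 2), Metric.ball_mem_nhds _ (by positivity), 0, 1, ε / 2,
      by simp, one_pos, le_rfl, by positivity, ?_⟩
    rintro x ⟨hx, -⟩ τ hτ hτ' ξ hξ
    apply hball
    rw [mem_ball_iff_norm] at hx ⊢
    have h1 : ‖ξ‖ ≤ 1 := by simpa using hξ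
    calc ‖x - τ • ξ - z‖ = ‖(x - z) - τ • ξ‖ := by congr 1; abel
      _ ≤ ‖x - z‖ + ‖τ • ξ‖ := norm_sub_le _ _
      _ = ‖x - z‖ + τ * ‖ξ‖ := by rw [norm_smul, Real.norm_of_nonneg hτ.le]
      _ < ε := by nlinarith
  · have hzf : z ∈ frontier Ω := by
      rw [frontier, hΩ.interior_eq]; exact ⟨hz, hzΩ⟩
    obtain ⟨U, hU, hzU, ν, hν, K, h, hh, hUΩ⟩ := hlip z hzf
    obtain ⟨ε, hε, hball⟩ := Metric.isOpen_iff.1 hU z hzU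
    have hK : (0 : ℝ) ≤ K := K.coe_nonneg
    -- The requirement is (1 + K)c < 1; this choice of c makes the product 1/2.
    have hc : (0 : ℝ) < 1 / (2 * (1 + K)) := by positivity
    have hc1 : 1 / (2 * (1 + (K : ℝ))) ≤ 1 := by
      rw [div_le_one (by positivity)]; linarith
    have hcK : (1 + (K : ℝ)) * (1 / (2 * (1 + K))) = 1 / 2 := by field_simp
    set c : ℝ := 1 / (2 * (1 + (K : ℝ))) with hcdef
    refine ⟨Metric.ball z (ε / 2), Metric.ball_mem_nhds _ (by positivity), ν, c, ε / 4,
      hν.le, hc, hc1, by positivity, ?_⟩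
    rintro x ⟨hx, hxcl⟩ τ hτ hτ' ξ hξ
    obtain ⟨b, rfl⟩ : ∃ b, ξ = ν + b := ⟨ξ - ν, by abel⟩
    have hb : ‖b‖ ≤ c := by simpa using hξ
    have hxU : x ∈ U := hball (Metric.ball_subset_ball (by linarith) hx)
    have hyU : x - τ • (ν + b) ∈ U := by
      apply hball
      rw [mem_ball_iff_norm] at hx ⊢
      have h2 : ‖ν + b‖ ≤ 2 := (norm_add_le _ _).trans (by linarith)
      calc ‖x - τ • (ν + b) - z‖ = ‖(x - z) - τ • (ν + b)‖ := by congr 1; abel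
        _ ≤ ‖x - z‖ + ‖τ • (ν + b)‖ := norm_sub_le _ _
        _ = ‖x - z‖ + τ * ‖ν + b‖ := by rw [norm_smul, Real.norm_of_nonneg hτ.le]
        _ < ε := by nlinarith
    rw [hUΩ _ hyU]
    have hle := le_graph_of_mem_closure hU hh hUΩ hxcl hxU
    have hνν : inner ℝ ν ν = (1 : ℝ) := by rw [real_inner_self_eq_norm_sq, hν]; norm_num
    have hin : inner ℝ ν (x - τ • (ν + b)) = inner ℝ ν x - τ * (1 + inner ℝ ν b) := by
      rw [inner_sub_right, inner_smul_right, inner_add_right, hνν]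
    have hproj : x - τ • (ν + b) - inner ℝ ν (x - τ • (ν + b)) • ν
        - (x - inner ℝ ν x • ν) = -(τ • (b - inner ℝ ν b • ν)) := by
      rw [hin]; module
    have hPb := norm_sub_inner_smul_le hν b
    have hdist := hh.dist_le_mul (x - τ • (ν + b) - inner ℝ ν (x - τ • (ν + b)) • ν)
      (x - inner ℝ ν x • ν)
    rw [dist_eq_norm (x - τ • (ν + b) - _), hproj, norm_neg, norm_smul,
      Real.norm_of_nonneg hτ.le] at hdist
    have habs := (abs_le.1 (Real.dist_eq _ _ ▸ hdist)).1
    have hνb : -c ≤ inner ℝ ν b := by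
      have := abs_real_inner_le_norm ν b
      rw [hν, one_mul] at this
      linarith [(abs_le.1 this).1]
    have h3 : (K : ℝ) * (τ * ‖b - inner ℝ ν b • ν‖) ≤ K * (τ * c) := by
      gcongr; exact hPb.trans hb
    have h4 : τ * -c ≤ τ * inner ℝ ν b := mul_le_mul_of_nonneg_left hνb hτ.le
    have h5 : τ * ((1 + K) * c) = τ * (1 / 2) := by rw [hcK]
    refine lt_of_eq_of_lt hin ?_
    linarith

/-- Normalised Hausdorff measure on the hyperplane is a Haar measure there, so it scales like
r^(d-1) on balls centred in the hyperplane. -/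
theorem exists_hausdorffMeasure_hyperplane_ball_le {d : ℕ} (hd : 2 ≤ d)
    {ν : EuclideanSpace ℝ (Fin d)} (hν : ν ≠ 0) :
    ∃ C : ℝ≥0, ∀ (y : EuclideanSpace ℝ (Fin d)) (r : ℝ), 0 ≤ r →
      (Measure.euclideanHausdorffMeasure (d - 1) : Measure (EuclideanSpace ℝ (Fin d)))
        ({w | inner ℝ ν w = 0} ∩ Metric.closedBall y r) ≤ C * ENNReal.ofReal r ^ (d - 1) := by
  let S : Submodule ℝ (EuclideanSpace ℝ (Fin d)) := (ℝ ∙ ν)ᗮ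
  have hfr : Module.finrank ℝ S = d - 1 := by
    have : Fact (Module.finrank ℝ (EuclideanSpace ℝ (Fin d)) = (d - 1) + 1) :=
      ⟨by rw [finrank_euclideanSpace_fin]; omega⟩
    exact Submodule.finrank_orthogonal_span_singleton hν
  have hHaar : (Measure.euclideanHausdorffMeasure (d - 1) : Measure S).IsAddHaarMeasure := by
    rw [← hfr]; infer_instance
  have hfin : (Measure.euclideanHausdorffMeasure (d - 1) : Measure S) (Metric.ball 0 1) ≠ ⊤ :=
    (measure_ball_lt_top).ne
  lift (Measure.euclideanHausdorffMeasure (d - 1) : Measure S) (Metric.ball 0 1) to ℝ≥0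
    using hfin with C₀ hC₀
  refine ⟨2 ^ (d - 1) * C₀, fun y r hr => ?_⟩
  by_cases hne : ({w | inner ℝ ν w = 0} ∩ Metric.closedBall y r).Nonempty
  · obtain ⟨w₀, hw₀, hw₀y⟩ := hne
    have memS : ∀ w, inner ℝ ν w = (0 : ℝ) → w ∈ S := fun w hw =>
      Submodule.mem_orthogonal_singleton_iff_inner_right.2 hw
    -- The centre y may lie off the hyperplane; any point of the intersection serves as a new centre
    -- at the cost of doubling the radius.
    have hsub : {w | inner ℝ ν w = 0} ∩ Metric.closedBall y r ⊆
        ((↑) : S → EuclideanSpace ℝ (Fin d)) '' Metric.closedBall ⟨w₀, memS _ hw₀⟩ (2 * r) := by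
      rintro w ⟨hw, hwy⟩
      refine ⟨⟨w, memS _ hw⟩, ?_, rfl⟩
      rw [Metric.mem_closedBall, Subtype.dist_eq]
      calc dist w w₀ ≤ dist w y + dist w₀ y := dist_triangle_right _ _ _
        _ ≤ 2 * r := by
          have := Metric.mem_closedBall.1 hwy
          have := Metric.mem_closedBall.1 hw₀y
          linarith
    refine (measure_mono hsub).trans ?_
    rw [Isometry.euclideanHausdorffMeasure_image isometry_subtype_coe,
      Measure.addHaar_closedBall _ _ (by positivity), hfr, ← hC₀]
    rw [ENNReal.ofReal_pow (by positivity), ENNReal.ofReal_mul (by norm_num), mul_pow]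
    simp only [ENNReal.ofReal_ofNat, ENNReal.coe_mul, ENNReal.coe_pow, ENNReal.coe_ofNat]
    apply le_of_eq; ring
  · rw [not_nonempty_iff_eq_empty.1 hne]; simp

/-- Near z the frontier lies on the image of the hyperplane under the (1+K)-Lipschitz graph map w ↦
w + h(w)ν. Orthogonal projection does not increase distances, so a ball of radius r on the frontier
comes from a hyperplane ball of the same radius. -/
theorem exists_nhds_surfaceMeasure_le {d : ℕ} (hd : 2 ≤ d) {Ω : Set (EuclideanSpace ℝ (Fin d))}
    (hΩ : IsOpen Ω) (hlip : HasLipschitzBoundary Ω) {z : EuclideanSpace ℝ (Fin d)}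
    (hz : z ∈ frontier Ω) :
    ∃ U ∈ 𝓝 z, ∃ C : ℝ≥0, ∀ (y : EuclideanSpace ℝ (Fin d)) (r : ℝ), 0 ≤ r →
      surfaceMeasure Ω (U ∩ Metric.closedBall y r) ≤ C * ENNReal.ofReal r ^ (d - 1) := by
  obtain ⟨U, hU, hzU, ν, hν, K, h, hh, hUΩ⟩ := hlip z hz
  have hν0 : ν ≠ 0 := by rintro rfl; simp at hν
  obtain ⟨C, hC⟩ := exists_hausdorffMeasure_hyperplane_ball_le hd hν0
  refine ⟨U, hU.mem_nhds hzU, (1 + K) ^ (d - 1) * C, fun y r hr => ?_⟩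
  have hνν : inner ℝ ν ν = (1 : ℝ) := by rw [real_inner_self_eq_norm_sq, hν]; norm_num
  let G : EuclideanSpace ℝ (Fin d) → EuclideanSpace ℝ (Fin d) := fun w => w + h w • ν
  have hG : LipschitzWith (1 + K) G := by
    refine LipschitzWith.id.add (LipschitzWith.of_dist_le_mul fun a b => ?_)
    rw [dist_eq_norm, ← sub_smul, norm_smul, hν, mul_one, ← dist_eq_norm]
    exact hh.dist_le_mul a b
  rw [surfaceMeasure, Measure.restrict_apply₀' (isClosed_frontier.measurableSet.nullMeasurableSet)]
  have hsub : U ∩ Metric.closedBall y r ∩ frontier Ω ⊆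
      G '' ({w | inner ℝ ν w = 0} ∩ Metric.closedBall (y - inner ℝ ν y • ν) r) := by
    rintro x ⟨⟨hxU, hxy⟩, hxf⟩
    refine ⟨x - inner ℝ ν x • ν, ⟨?_, ?_⟩, ?_⟩
    · simp only [mem_ofPred_eq]
      rw [inner_sub_right, inner_smul_right, hνν]; ring
    · rw [mem_closedBall_iff_norm] at hxy ⊢
      refine le_trans ?_ ((norm_sub_inner_smul_le hν (x - y)).trans hxy)
      rw [inner_sub_right]
      apply le_of_eq; congr 1; module
    · have h1 := le_graph_of_mem_closure hU hh hUΩ (frontier_subset_closure hxf) hxU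
      have h2 : ¬ inner ℝ ν x < h (x - inner ℝ ν x • ν) := fun hlt => by
        have : x ∈ Ω := (hUΩ x hxU).2 hlt
        rw [hΩ.frontier_eq] at hxf
        exact hxf.2 this
      have h3 := le_antisymm h1 (not_lt.1 h2)
      simp only [G, ← h3]
      abel
  refine (measure_mono hsub).trans ?_
  have h4 : (Measure.euclideanHausdorffMeasure (d - 1) : Measure (EuclideanSpace ℝ (Fin d)))
      (G '' ({w | inner ℝ ν w = 0} ∩ Metric.closedBall (y - inner ℝ ν y • ν) r)) ≤
      ((1 + K : ℝ≥0) : ℝ≥0∞) ^ (d - 1) *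
      (Measure.euclideanHausdorffMeasure (d - 1) : Measure (EuclideanSpace ℝ (Fin d)))
        ({w | inner ℝ ν w = 0} ∩ Metric.closedBall (y - inner ℝ ν y • ν) r) := by
    simp only [Measure.euclideanHausdorffMeasure_def, Measure.smul_apply]
    have := hG.hausdorffMeasure_image_le (d := ((d - 1 : ℕ) : ℝ)) (by positivity)
      ({w | inner ℝ ν w = 0} ∩ Metric.closedBall (y - inner ℝ ν y • ν) r)
    rw [ENNReal.rpow_natCast] at this
    simp only [ENNReal.smul_def, smul_eq_mul]
    rw [mul_left_comm]
    gcongr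
  refine h4.trans ?_
  rw [ENNReal.coe_mul, ENNReal.coe_pow, mul_assoc]
  gcongr
  exact hC _ r hr

/-- The surface measure of a bounded Lipschitz domain is upper Ahlfors regular. -/
theorem exists_surfaceMeasure_closedBall_le {d : ℕ} (hd : 2 ≤ d)
    {Ω : Set (EuclideanSpace ℝ (Fin d))} (hΩ : IsOpen Ω) (hbdd : Bornology.IsBounded Ω)
    (hlip : HasLipschitzBoundary Ω) :
    ∃ C : ℝ≥0, ∀ (y : EuclideanSpace ℝ (Fin d)) (r : ℝ), 0 ≤ r →
      surfaceMeasure Ω (Metric.closedBall y r) ≤ C * ENNReal.ofReal r ^ (d - 1) := by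
  have hcomp : IsCompact (frontier Ω) :=
    Metric.isCompact_of_isClosed_isBounded isClosed_frontier
      (hbdd.closure.subset frontier_subset_closure)
  choose! U hU C hC using fun z (hz : z ∈ frontier Ω) =>
    exists_nhds_surfaceMeasure_le hd hΩ hlip hz
  obtain ⟨t, htΓ, ht⟩ := hcomp.elim_nhds_subcover U hU
  refine ⟨∑ z ∈ t, C z, fun y r hr => ?_⟩
  have h1 : surfaceMeasure Ω (Metric.closedBall y r) =
      surfaceMeasure Ω (Metric.closedBall y r ∩ frontier Ω) := by
    rw [surfaceMeasure, Measure.restrict_apply₀' (isClosed_frontier.measurableSet.nullMeasurableSet),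
      Measure.restrict_apply₀' (isClosed_frontier.measurableSet.nullMeasurableSet), inter_assoc,
      inter_self]
  have h2 : Metric.closedBall y r ∩ frontier Ω ⊆ ⋃ z ∈ t, U z ∩ Metric.closedBall y r := by
    rintro x ⟨hx, hxf⟩
    obtain ⟨z, hz, hxz⟩ := mem_iUnion₂.1 (ht hxf)
    exact mem_iUnion₂.2 ⟨z, hz, hxz, hx⟩
  rw [h1]
  calc _ ≤ surfaceMeasure Ω (⋃ z ∈ t, U z ∩ Metric.closedBall y r) := measure_mono h2
    _ ≤ ∑ z ∈ t, surfaceMeasure Ω (U z ∩ Metric.closedBall y r) := measure_biUnion_finset_le _ _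
    _ ≤ ∑ z ∈ t, C z * ENNReal.ofReal r ^ (d - 1) :=
        Finset.sum_le_sum fun z hz => hC z (htΓ z hz) y r hr
    _ = _ := by rw [← Finset.sum_mul]; push_cast; rfl

theorem isFiniteMeasure_surfaceMeasure {d : ℕ} (hd : 2 ≤ d)
    {Ω : Set (EuclideanSpace ℝ (Fin d))} (hΩ : IsOpen Ω) (hbdd : Bornology.IsBounded Ω)
    (hlip : HasLipschitzBoundary Ω) : IsFiniteMeasure (surfaceMeasure Ω) := by
  obtain ⟨C, hC⟩ := exists_surfaceMeasure_closedBall_le hd hΩ hbdd hlip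
  obtain ⟨R, hR0, hR⟩ := (hbdd.closure.subset frontier_subset_closure).subset_closedBall_lt 0 0
  refine ⟨?_⟩
  have : surfaceMeasure Ω univ ≤ surfaceMeasure Ω (Metric.closedBall 0 R) := by
    rw [surfaceMeasure, Measure.restrict_apply_univ,
      Measure.restrict_apply₀' (isClosed_frontier.measurableSet.nullMeasurableSet)]
    exact measure_mono fun x hx => ⟨hR hx, hx⟩
  refine this.trans_lt ((hC 0 R hR0.le).trans_lt ?_)
  exact ENNReal.mul_lt_top ENNReal.coe_lt_top (ENNReal.pow_lt_top ENNReal.ofReal_lt_top)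

/-! ### Averages of an H¹ function over cones, and the pointwise bound by its gradient. -/

/-- The `L¹`-normalised dilation `τ^{-d} η(τ⁻¹ z)` of a function `η`. -/
def dilate {d : ℕ} (η : EuclideanSpace ℝ (Fin d) → ℝ) (τ : ℝ) (z : EuclideanSpace ℝ (Fin d)) : ℝ :=
  (τ ^ d)⁻¹ * η (τ⁻¹ • z)

/-- The divergence of the vector field `ξ ↦ η(ξ) ξ`. -/
def radialDiv {d : ℕ} (η : EuclideanSpace ℝ (Fin d) → ℝ) (ξ : EuclideanSpace ℝ (Fin d)) : ℝ :=
  d * η ξ + fderiv ℝ η ξ ξ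

theorem hasDerivAt_dilate {d : ℕ} {η : EuclideanSpace ℝ (Fin d) → ℝ} (hη : ContDiff ℝ ∞ η)
    (z : EuclideanSpace ℝ (Fin d)) {τ : ℝ} (hτ : 0 < τ) :
    HasDerivAt (fun t => dilate η t z) (-((τ ^ (d + 1))⁻¹ * radialDiv η (τ⁻¹ • z))) τ := by
  have h1 : HasDerivAt (fun t : ℝ => (t ^ d)⁻¹) (-(d * τ ^ (d - 1)) / (τ ^ d) ^ 2) τ :=
    (hasDerivAt_pow d τ).inv (by positivity)
  have h2 : HasDerivAt (fun t : ℝ => t⁻¹ • z) ((-(τ ^ 2)⁻¹) • z) τ :=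
    (hasDerivAt_inv hτ.ne').smul_const z
  have h3 : HasDerivAt (fun t : ℝ => η (t⁻¹ • z)) (fderiv ℝ η (τ⁻¹ • z) ((-(τ ^ 2)⁻¹) • z)) τ :=
    ((hη.differentiable (by simp)) _).hasFDerivAt.comp_hasDerivAt τ h2
  refine (h1.mul h3).congr_deriv ?_
  rw [radialDiv, map_smul, map_smul, smul_eq_mul, smul_eq_mul]
  rcases d with _ | d
  · simp; field_simp
  · simp only [Nat.add_sub_cancel]
    field_simp
    ring

theorem fderiv_dilate_coord {d : ℕ} {η : EuclideanSpace ℝ (Fin d) → ℝ} (hη : ContDiff ℝ ∞ η)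
    (x y : EuclideanSpace ℝ (Fin d)) {τ : ℝ} (hτ : 0 < τ) (i : Fin d) :
    fderiv ℝ (fun y => dilate (fun ξ => η ξ * ξ i) τ (x - y)) y (EuclideanSpace.single i 1) =
      -((τ ^ (d + 1))⁻¹ * (η (τ⁻¹ • (x - y)) + (τ⁻¹ • (x - y)) i *
        fderiv ℝ η (τ⁻¹ • (x - y)) (EuclideanSpace.single i 1))) := by
  have h1 : HasFDerivAt (fun y : EuclideanSpace ℝ (Fin d) => τ⁻¹ • (x - y))
      (τ⁻¹ • (-ContinuousLinearMap.id ℝ _)) y :=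
    ((hasFDerivAt_id y).const_sub x).const_smul τ⁻¹
  have h2 : HasFDerivAt (fun ξ : EuclideanSpace ℝ (Fin d) => ξ i)
      (EuclideanSpace.proj i : EuclideanSpace ℝ (Fin d) →L[ℝ] ℝ) (τ⁻¹ • (x - y)) :=
    (EuclideanSpace.proj i : EuclideanSpace ℝ (Fin d) →L[ℝ] ℝ).hasFDerivAt
  have h3 := (((hη.differentiable (by simp)) (τ⁻¹ • (x - y))).hasFDerivAt.mul h2)
  have h4 := ((h3.comp y h1).const_mul ((τ ^ d)⁻¹))
  have h5 : (fun y => dilate (fun ξ => η ξ * ξ i) τ (x - y)) =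
      fun y => (τ ^ d)⁻¹ * ((fun ξ : EuclideanSpace ℝ (Fin d) => η ξ * ξ i) ∘
        fun y => τ⁻¹ • (x - y)) y := rfl
  rw [h5]
  erw [h4.fderiv]
  simp
  field_simp
  ring

/-- The right side is also the τ-derivative of `dilate η τ (x - y)` found in `hasDerivAt_dilate`. So
differentiating the average in τ amounts to testing with the divergence in y of a smooth vector
field, which the weak gradient can absorb. -/
theorem sum_fderiv_dilate_coord {d : ℕ} {η : EuclideanSpace ℝ (Fin d) → ℝ} (hη : ContDiff ℝ ∞ η)
    (x y : EuclideanSpace ℝ (Fin d)) {τ : ℝ} (hτ : 0 < τ) :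
    ∑ i, fderiv ℝ (fun y => dilate (fun ξ => η ξ * ξ i) τ (x - y)) y (EuclideanSpace.single i 1) =
      -((τ ^ (d + 1))⁻¹ * radialDiv η (τ⁻¹ • (x - y))) := by
  simp_rw [fderiv_dilate_coord hη x y hτ]
  rw [Finset.sum_neg_distrib, ← Finset.mul_sum, Finset.sum_add_distrib, radialDiv]
  congr 3
  · simp
  · set ξ := τ⁻¹ • (x - y)
    have hξ : ξ = ∑ i, ξ i • (EuclideanSpace.single i (1 : ℝ) : EuclideanSpace ℝ (Fin d)) := by
      have := (EuclideanSpace.basisFun (Fin d) ℝ).sum_repr ξ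
      simpa using this.symm
    conv_rhs => rw [hξ, map_sum]
    rw [← hξ]
    simp

theorem continuous_radialDiv {d : ℕ} {η : EuclideanSpace ℝ (Fin d) → ℝ} (hη : ContDiff ℝ ∞ η) :
    Continuous (radialDiv η) := by
  have h1 : Continuous (fderiv ℝ η) := hη.continuous_fderiv (by simp)
  exact (continuous_const.mul hη.continuous).add (h1.clm_apply continuous_id)

theorem hasCompactSupport_radialDiv {d : ℕ} {η : EuclideanSpace ℝ (Fin d) → ℝ}
    (hη : HasCompactSupport η) : HasCompactSupport (radialDiv η) := by
  refine HasCompactSupport.intro hη (fun ξ hξ => ?_)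
  rw [radialDiv, image_eq_zero_of_notMem_tsupport hξ,
    fderiv_of_notMem_tsupport ℝ hξ]
  simp

theorem hasDerivAt_integral_dilate {d : ℕ} {Ω : Set (EuclideanSpace ℝ (Fin d))}
    {η : EuclideanSpace ℝ (Fin d) → ℝ} (hη : ContDiff ℝ ∞ η) (hηc : HasCompactSupport η)
    {U : EuclideanSpace ℝ (Fin d) → ℂ} (hU : Integrable U (volume.restrict Ω))
    (x : EuclideanSpace ℝ (Fin d)) {τ : ℝ} (hτ : 0 < τ) :
    HasDerivAt (fun t => ∫ y in Ω, U y * (dilate η t (x - y) : ℂ))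
      (∫ y in Ω, U y * ((-((τ ^ (d + 1))⁻¹ * radialDiv η (τ⁻¹ • (x - y))) : ℝ) : ℂ)) τ := by
  obtain ⟨M, hM⟩ := (continuous_radialDiv hη).bounded_above_of_compact_support
    (hasCompactSupport_radialDiv hηc)
  obtain ⟨M', hM'⟩ := hη.continuous.bounded_above_of_compact_support hηc
  have hcont : ∀ t, Continuous fun y => dilate η t (x - y) := fun t => by
    unfold dilate
    have := hη.continuous
    fun_prop
  have hcont' : Continuous fun y => (-((τ ^ (d + 1))⁻¹ * radialDiv η (τ⁻¹ • (x - y)))) := by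
    have := continuous_radialDiv hη
    fun_prop
  -- Restricting to scales above τ/2 keeps the factor t^(-(d+1)) bounded, which provides the
  -- dominating function.
  refine (hasDerivAt_integral_of_dominated_loc_of_deriv_le (μ := volume.restrict Ω)
    (F := fun t y => U y * (dilate η t (x - y) : ℂ))
    (F' := fun t y => U y * ((-((t ^ (d + 1))⁻¹ * radialDiv η (t⁻¹ • (x - y))) : ℝ) : ℂ))
    (x₀ := τ) (s := Ioi (τ / 2)) (bound := fun y => ‖U y‖ * (((τ / 2) ^ (d + 1))⁻¹ * M))
    (Ioi_mem_nhds (by linarith)) (Eventually.of_forall fun t => ?_) ?_ ?_ ?_ ?_ ?_).2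
  · exact hU.aestronglyMeasurable.mul
      (Complex.continuous_ofReal.comp (hcont t)).aestronglyMeasurable
  · refine hU.mul_bdd (c := (τ ^ d)⁻¹ * M')
      (Complex.continuous_ofReal.comp (hcont τ)).aestronglyMeasurable
      (Eventually.of_forall fun y => ?_)
    rw [Complex.norm_real, dilate, norm_mul, Real.norm_of_nonneg (by positivity)]
    gcongr
    exact hM' _
  · exact hU.aestronglyMeasurable.mul
      (Complex.continuous_ofReal.comp hcont').aestronglyMeasurable
  · refine Eventually.of_forall fun y t ht => ?_
    have ht' : τ / 2 < t := ht
    have ht0 : 0 < t := by linarith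
    rw [norm_mul, Complex.norm_real, norm_neg, norm_mul, Real.norm_of_nonneg (by positivity)]
    gcongr
    exact hM _
  · exact hU.norm.mul_const _
  · refine Eventually.of_forall fun y t ht => ?_
    have ht0 : 0 < t := by have : τ / 2 < t := ht; linarith
    exact ((hasDerivAt_dilate hη (x - y) ht0).ofReal_comp).const_mul (U y)

theorem norm_sub_le_of_mem_closedBall {d : ℕ} {ν x y : EuclideanSpace ℝ (Fin d)} {c τ : ℝ}
    (hν : ‖ν‖ ≤ 1) (hc : c ≤ 1) (hτ : 0 < τ) (h : τ⁻¹ • (x - y) ∈ Metric.closedBall ν c) :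
    ‖x - y‖ ≤ 2 * τ := by
  have h1 : ‖τ⁻¹ • (x - y)‖ ≤ 2 := by
    have := norm_le_of_mem_closedBall h
    linarith
  rw [norm_smul, norm_inv, Real.norm_of_nonneg hτ.le, inv_mul_le_iff₀ hτ] at h1
  linarith

/-- The derivative in `τ` of the average of an `H¹` function over the cone with vertex `x`, in
terms of the weak gradient. -/
theorem norm_integral_radialDiv_le {d : ℕ} {Ω : Set (EuclideanSpace ℝ (Fin d))}
    [IsFiniteMeasure (volume.restrict Ω)]
    {η : EuclideanSpace ℝ (Fin d) → ℝ} (hη : ContDiff ℝ ∞ η)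
    {ν : EuclideanSpace ℝ (Fin d)} {c : ℝ} (hν : ‖ν‖ ≤ 1) (hc : c ≤ 1)
    (hηs : tsupport η ⊆ Metric.closedBall ν c) {M : ℝ} (hM : ∀ ξ, ‖η ξ‖ ≤ M)
    {U : EuclideanSpace ℝ (Fin d) → ℂ}
    {DU : EuclideanSpace ℝ (Fin d) → EuclideanSpace ℂ (Fin d)} (hU : IsH1 Ω U DU)
    {x : EuclideanSpace ℝ (Fin d)} {τ : ℝ} (hτ : 0 < τ)
    (hx : ∀ ξ ∈ Metric.closedBall ν c, x - τ • ξ ∈ Ω) :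
    ‖∫ y in Ω, U y * ((-((τ ^ (d + 1))⁻¹ * radialDiv η (τ⁻¹ • (x - y))) : ℝ) : ℂ)‖ ≤
      d * (2 * M) * ((τ ^ d)⁻¹ * ∫ y in Ω ∩ Metric.closedBall x (2 * τ), ‖DU y‖) := by
  have hUi : Integrable U (volume.restrict Ω) := hU.memLp.integrable (by norm_num)
  have hDUi : Integrable DU (volume.restrict Ω) := hU.memLp_grad.integrable (by norm_num)
  have hηc : HasCompactSupport η :=
    HasCompactSupport.of_support_subset_isCompact (isCompact_closedBall ν c)
      ((subset_tsupport η).trans hηs)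
  have hM0 : 0 ≤ M := (norm_nonneg _).trans (hM 0)
  have hηi : ∀ i : Fin d, ContDiff ℝ ∞ fun ξ : EuclideanSpace ℝ (Fin d) => η ξ * ξ i :=
    fun i => hη.mul (EuclideanSpace.proj i : EuclideanSpace ℝ (Fin d) →L[ℝ] ℝ).contDiff
  let T : Fin d → EuclideanSpace ℝ (Fin d) → ℝ :=
    fun i y => dilate (fun ξ => η ξ * ξ i) τ (x - y)
  have hTzero : ∀ i y, τ⁻¹ • (x - y) ∉ Metric.closedBall ν c → T i y = 0 := by
    intro i y hy
    have : η (τ⁻¹ • (x - y)) = 0 := image_eq_zero_of_notMem_tsupport fun h => hy (hηs h)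
    simp only [T, dilate, this, zero_mul, mul_zero]
  have hclosed : IsClosed {y : EuclideanSpace ℝ (Fin d) | τ⁻¹ • (x - y) ∈ Metric.closedBall ν c} :=
    Metric.isClosed_closedBall.preimage (by fun_prop)
  have hTsupp : ∀ i, tsupport (T i) ⊆ {y | τ⁻¹ • (x - y) ∈ Metric.closedBall ν c} := by
    intro i
    refine closure_minimal (fun y hy => ?_) hclosed
    by_contra hy'
    exact hy (hTzero i y hy')
  -- Here the cone condition enters: the components of the vector field are compactly supported
  -- inside Ω even if x is a boundary point, so they are admissible test functions.
  have hTΩ : ∀ i, tsupport (T i) ⊆ Ω := by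
    intro i y hy
    have := hx _ (hTsupp i hy)
    rwa [smul_inv_smul₀ hτ.ne', sub_sub_cancel] at this
  have hTc : ∀ i, HasCompactSupport (T i) := by
    intro i
    refine HasCompactSupport.of_support_subset_isCompact (isCompact_closedBall x (2 * τ)) ?_
    intro y hy
    rw [mem_closedBall_iff_norm, norm_sub_rev]
    exact norm_sub_le_of_mem_closedBall hν hc hτ (hTsupp i (subset_tsupport _ hy))
  have hTsmooth : ∀ i, ContDiff ℝ ∞ (T i) := by
    intro i
    refine contDiff_const.mul ((hηi i).comp ?_)
    exact (contDiff_const.sub contDiff_id).const_smul τ⁻¹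
  have hTder : ∀ i, Continuous fun y => fderiv ℝ (T i) y (EuclideanSpace.single i 1) := fun i =>
    (ContDiff.continuous_fderiv (hTsmooth i) (by simp)).clm_apply continuous_const
  have hsum : ∫ y in Ω, U y * ((-((τ ^ (d + 1))⁻¹ * radialDiv η (τ⁻¹ • (x - y))) : ℝ) : ℂ) =
      - ∑ i, ∫ y in Ω, DU y i * (T i y : ℂ) := by
    rw [← Finset.sum_neg_distrib]
    simp_rw [← hU.weak_grad (T _) (hTsmooth _) (hTc _) (hTΩ _)]
    rw [← integral_finsetSum]
    · refine integral_congr_ae (Eventually.of_forall fun y => ?_)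
      simp only
      rw [← sum_fderiv_dilate_coord hη x y hτ, ← Finset.mul_sum]
      push_cast
      rfl
    · intro i _
      obtain ⟨M₁, hM₁⟩ := (hTder i).bounded_above_of_compact_support
        ((hTc i).fderiv_apply (𝕜 := ℝ) (EuclideanSpace.single i 1))
      refine hUi.mul_bdd (c := M₁)
        (Complex.continuous_ofReal.comp (hTder i)).aestronglyMeasurable
        (Eventually.of_forall fun y => ?_)
      rw [Complex.norm_real]; exact hM₁ y
  have hTbd : ∀ i y, ‖DU y i * (T i y : ℂ)‖ ≤
      (Metric.closedBall x (2 * τ)).indicator (fun y => (2 * M) * (τ ^ d)⁻¹ * ‖DU y‖) y := by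
    intro i y
    by_cases hy : τ⁻¹ • (x - y) ∈ Metric.closedBall ν c
    · have hyb : y ∈ Metric.closedBall x (2 * τ) := by
        rw [mem_closedBall_iff_norm, norm_sub_rev]
        exact norm_sub_le_of_mem_closedBall hν hc hτ hy
      rw [indicator_of_mem hyb, norm_mul, Complex.norm_real]
      have h1 : ‖DU y i‖ ≤ ‖DU y‖ := PiLp.norm_apply_le _ i
      -- The bound 2 comes from ‖ν‖ ≤ 1 and c ≤ 1.
      have h2 : ‖(τ⁻¹ • (x - y)) i‖ ≤ 2 := by
        refine (PiLp.norm_apply_le _ i).trans ?_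
        have := norm_le_of_mem_closedBall hy
        linarith
      have h3 : ‖T i y‖ ≤ (τ ^ d)⁻¹ * (M * 2) := by
        simp only [T, dilate]
        rw [norm_mul, norm_mul, Real.norm_of_nonneg (by positivity : 0 ≤ (τ ^ d)⁻¹)]
        gcongr
        exact hM _
      calc ‖DU y i‖ * ‖T i y‖ ≤ ‖DU y‖ * ((τ ^ d)⁻¹ * (M * 2)) := by gcongr
        _ = _ := by ring
    · rw [hTzero i y hy]
      simp only [Complex.ofReal_zero, mul_zero, norm_zero]
      exact indicator_nonneg (fun y _ => by positivity) y
  rw [hsum, norm_neg]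
  have hint : ∫ y in Ω, (Metric.closedBall x (2 * τ)).indicator
      (fun y => (2 * M) * (τ ^ d)⁻¹ * ‖DU y‖) y =
      (2 * M) * (τ ^ d)⁻¹ * ∫ y in Ω ∩ Metric.closedBall x (2 * τ), ‖DU y‖ := by
    rw [setIntegral_indicator Metric.isClosed_closedBall.measurableSet, integral_const_mul]
  calc ‖∑ i, ∫ y in Ω, DU y i * (T i y : ℂ)‖
      ≤ ∑ i, ‖∫ y in Ω, DU y i * (T i y : ℂ)‖ := norm_sum_le _ _
    _ ≤ ∑ _i : Fin d, (2 * M) * (τ ^ d)⁻¹ * ∫ y in Ω ∩ Metric.closedBall x (2 * τ), ‖DU y‖ := by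
        refine Finset.sum_le_sum fun i _ => ?_
        rw [← hint]
        refine norm_integral_le_of_norm_le ?_ (Eventually.of_forall fun y => hTbd i y)
        exact (hDUi.norm.const_mul _).indicator Metric.isClosed_closedBall.measurableSet
    _ = _ := by simp; ring

theorem integral_dilate_sub {d : ℕ} (η : EuclideanSpace ℝ (Fin d) → ℝ)
    (x : EuclideanSpace ℝ (Fin d)) {τ : ℝ} (hτ : 0 < τ) :
    ∫ y, dilate η τ (x - y) = ∫ ξ, η ξ := by
  rw [integral_sub_left_eq_self (fun z => dilate η τ z) volume x]
  simp only [dilate]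
  rw [integral_const_mul, Measure.integral_comp_inv_smul volume η τ, finrank_euclideanSpace_fin,
    abs_of_pos (by positivity), smul_eq_mul, inv_mul_cancel_left₀ (by positivity)]

/-- This is an approximate identity supported to one side: the kernels live in x minus small
multiples of the ball around ν, which stays in Ω. No mass is lost through the boundary, and the
limit holds at every point of the closure. -/
theorem tendsto_integral_dilate {d : ℕ} {Ω : Set (EuclideanSpace ℝ (Fin d))}
    [IsFiniteMeasure (volume.restrict Ω)] (hΩ : MeasurableSet Ω)
    {η : EuclideanSpace ℝ (Fin d) → ℝ} (hη : ContDiff ℝ ∞ η) (hη0 : ∀ ξ, 0 ≤ η ξ)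
    (hη1 : ∫ ξ, η ξ = 1)
    {ν : EuclideanSpace ℝ (Fin d)} {c : ℝ} (hν : ‖ν‖ ≤ 1) (hc : c ≤ 1)
    (hηs : tsupport η ⊆ Metric.closedBall ν c)
    {U : EuclideanSpace ℝ (Fin d) → ℂ} (hUc : ContinuousOn U (closure Ω))
    (hU : Integrable U (volume.restrict Ω))
    {x : EuclideanSpace ℝ (Fin d)} {t₀ : ℝ} (ht₀ : 0 < t₀) (hxΩ : x ∈ closure Ω)
    (hx : ∀ τ, 0 < τ → τ ≤ t₀ → ∀ ξ ∈ Metric.closedBall ν c, x - τ • ξ ∈ Ω) :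
    Tendsto (fun τ => ∫ y in Ω, U y * (dilate η τ (x - y) : ℂ)) (𝓝[>] 0) (𝓝 (U x)) := by
  have hηc : HasCompactSupport η :=
    HasCompactSupport.of_support_subset_isCompact (isCompact_closedBall ν c)
      ((subset_tsupport η).trans hηs)
  obtain ⟨M, hM⟩ := hη.continuous.bounded_above_of_compact_support hηc
  rw [Metric.tendsto_nhds]
  intro ε hε
  obtain ⟨δ, hδ, hUδ⟩ := Metric.continuousOn_iff.1 hUc x hxΩ (ε / 2) (by positivity)
  have hmem : Ioo 0 (min t₀ (δ / 2)) ∈ 𝓝[>] (0 : ℝ) :=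
    Ioo_mem_nhdsGT (lt_min ht₀ (by positivity))
  filter_upwards [hmem] with τ hτ
  have hτ0 : 0 < τ := hτ.1
  have hτt : τ ≤ t₀ := (hτ.2.trans_le (min_le_left _ _)).le
  have hτδ : 2 * τ < δ := by have := hτ.2.trans_le (min_le_right _ _); linarith
  have hcont : Continuous fun y => dilate η τ (x - y) := by
    unfold dilate
    have := hη.continuous
    fun_prop
  have hzero : ∀ y, τ⁻¹ • (x - y) ∉ Metric.closedBall ν c → dilate η τ (x - y) = 0 := by
    intro y hy
    rw [dilate, image_eq_zero_of_notMem_tsupport fun h => hy (hηs h), mul_zero]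
  have hcs : HasCompactSupport fun y => dilate η τ (x - y) := by
    refine HasCompactSupport.of_support_subset_isCompact (isCompact_closedBall x (2 * τ)) ?_
    intro y hy
    rw [mem_closedBall_iff_norm, norm_sub_rev]
    by_contra h
    exact hy (hzero y fun h' => h (norm_sub_le_of_mem_closedBall hν hc hτ0 h'))
  have hki : Integrable fun y => dilate η τ (x - y) := hcont.integrable_of_hasCompactSupport hcs
  have hnn : ∀ y, 0 ≤ dilate η τ (x - y) := fun y => by
    unfold dilate; have := hη0 (τ⁻¹ • (x - y)); positivity
  have hone : ∫ y in Ω, dilate η τ (x - y) = 1 := by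
    rw [setIntegral_eq_integral_of_forall_compl_eq_zero, integral_dilate_sub η x hτ0, hη1]
    intro y hy
    refine hzero y fun h => hy ?_
    have := hx τ hτ0 hτt _ h
    rwa [smul_inv_smul₀ hτ0.ne', sub_sub_cancel] at this
  have hUk : Integrable (fun y => U y * (dilate η τ (x - y) : ℂ)) (volume.restrict Ω) := by
    refine hU.mul_bdd (c := (τ ^ d)⁻¹ * M)
      (Complex.continuous_ofReal.comp hcont).aestronglyMeasurable
      (Eventually.of_forall fun y => ?_)
    rw [Complex.norm_real, dilate, norm_mul, Real.norm_of_nonneg (by positivity)]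
    gcongr
    exact hM _
  have hconst : U x = ∫ y in Ω, U x * (dilate η τ (x - y) : ℂ) := by
    rw [integral_const_mul, integral_complex_ofReal, hone]; simp
  rw [dist_eq_norm]
  conv_lhs => rw [hconst]
  have hki' : Integrable (fun y => U x * (dilate η τ (x - y) : ℂ)) (volume.restrict Ω) :=
    (hki.restrict.ofReal (𝕜 := ℂ)).const_mul (U x)
  rw [← integral_sub hUk hki']
  have hle : ‖∫ y in Ω, (U y * (dilate η τ (x - y) : ℂ) - U x * (dilate η τ (x - y) : ℂ))‖ ≤
      ∫ y in Ω, (ε / 2) * dilate η τ (x - y) := by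
    refine norm_integral_le_of_norm_le (hki.restrict.const_mul _) ?_
    refine (ae_restrict_iff' hΩ).2 (Eventually.of_forall fun y hy => ?_)
    rw [← sub_mul, norm_mul, Complex.norm_real, Real.norm_of_nonneg (hnn y)]
    by_cases hyb : τ⁻¹ • (x - y) ∈ Metric.closedBall ν c
    · have h1 : dist y x < δ := by
        rw [dist_eq_norm, norm_sub_rev]
        exact (norm_sub_le_of_mem_closedBall hν hc hτ0 hyb).trans_lt hτδ
      have h2 := hUδ y (subset_closure hy) h1
      rw [dist_eq_norm] at h2
      exact mul_le_mul_of_nonneg_right h2.le (hnn y)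
    · rw [hzero y hyb]; simp
  refine hle.trans_lt ?_
  rw [integral_const_mul, hone]
  linarith

/-- Pointwise bound of a continuous `H¹` function by averages of its gradient, near a point where
the cone condition holds. -/
theorem exists_nhds_enorm_le {d : ℕ} {Ω : Set (EuclideanSpace ℝ (Fin d))}
    (hΩ : MeasurableSet Ω) [IsFiniteMeasure (volume.restrict Ω)]
    {z : EuclideanSpace ℝ (Fin d)} (hz : ConeConditionAt Ω z) :
    ∃ W ∈ 𝓝 z, ∃ (C : ℝ≥0) (t₀ : ℝ), 0 < t₀ ∧
      ∀ (U : EuclideanSpace ℝ (Fin d) → ℂ)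
        (DU : EuclideanSpace ℝ (Fin d) → EuclideanSpace ℂ (Fin d)),
        ContinuousOn U (closure Ω) → IsH1 Ω U DU → ∀ x ∈ W ∩ closure Ω,
          ‖U x‖ₑ ≤ C * (∫⁻ y in Ω, ‖U y‖ₑ) +
            C * ∫⁻ τ in Ioc 0 t₀, (ENNReal.ofReal τ ^ d)⁻¹ *
              ∫⁻ y in Ω ∩ Metric.closedBall x (2 * τ), ‖DU y‖ₑ := by
  obtain ⟨W, hW, ν, c, t₀, hν, hc0, hc, ht₀, hcone⟩ := hz
  let b : ContDiffBump ν := ⟨c / 2, c, by positivity, by linarith⟩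
  let η : EuclideanSpace ℝ (Fin d) → ℝ := b.normed volume
  have hη : ContDiff ℝ ∞ η := b.contDiff_normed
  have hη0 : ∀ ξ, 0 ≤ η ξ := b.nonneg_normed
  have hη1 : ∫ ξ, η ξ = 1 := b.integral_normed
  have hηs : tsupport η ⊆ Metric.closedBall ν c := (b.tsupport_normed_eq).le
  have hηc : HasCompactSupport η := b.hasCompactSupport_normed
  obtain ⟨M, hM⟩ := hη.continuous.bounded_above_of_compact_support hηc
  obtain ⟨M', hM'⟩ := (continuous_radialDiv hη).bounded_above_of_compact_support
    (hasCompactSupport_radialDiv hηc)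
  have hM0 : 0 ≤ M := (norm_nonneg _).trans (hM 0)
  have hM'0 : 0 ≤ M' := (norm_nonneg _).trans (hM' 0)
  -- The first entry bounds the kernel at scale t₀, the second is the constant in
  -- `norm_integral_radialDiv_le`.
  let C : ℝ := max ((t₀ ^ d)⁻¹ * M) (d * (2 * M))
  have hC0 : 0 ≤ C := le_max_of_le_right (by positivity)
  refine ⟨W, hW, C.toNNReal, t₀, ht₀, fun U DU hUc hU x hx => ?_⟩
  have hUi : Integrable U (volume.restrict Ω) := hU.memLp.integrable (by norm_num)
  have hDUi : Integrable DU (volume.restrict Ω) := hU.memLp_grad.integrable (by norm_num)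
  have hxcone := hcone x hx
  let J : ℝ → ℂ := fun t => ∫ y in Ω, U y * (dilate η t (x - y) : ℂ)
  let J' : ℝ → ℂ := fun τ =>
    ∫ y in Ω, U y * ((-((τ ^ (d + 1))⁻¹ * radialDiv η (τ⁻¹ • (x - y))) : ℝ) : ℂ)
  have hJ : ∀ τ, 0 < τ → HasDerivAt J (J' τ) τ := fun τ hτ =>
    hasDerivAt_integral_dilate hη hηc hUi x hτ
  have hCe : ∀ a : ℝ, a ≤ C → ENNReal.ofReal a ≤ C.toNNReal := fun a ha =>
    ENNReal.ofReal_le_ofReal ha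
  have hJt₀ : ‖J t₀‖ₑ ≤ C.toNNReal * ∫⁻ y in Ω, ‖U y‖ₑ := by
    refine (enorm_integral_le_lintegral_enorm _).trans ?_
    rw [← lintegral_const_mul' _ _ ENNReal.coe_ne_top]
    refine lintegral_mono fun y => ?_
    rw [enorm_mul, mul_comm]
    gcongr
    rw [← ofReal_norm, Complex.norm_real, dilate, norm_mul,
      Real.norm_of_nonneg (by positivity)]
    refine hCe _ (le_trans ?_ (le_max_left _ _))
    gcongr
    exact hM _
  have hJ'le : ∀ τ, 0 < τ → τ ≤ t₀ → ‖J' τ‖ₑ ≤ C.toNNReal * ((ENNReal.ofReal τ ^ d)⁻¹ *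
      ∫⁻ y in Ω ∩ Metric.closedBall x (2 * τ), ‖DU y‖ₑ) := by
    intro τ hτ hτt
    have h1 := norm_integral_radialDiv_le hη hν hc hηs hM hU hτ (hxcone τ hτ hτt)
    rw [← ofReal_norm]
    refine (ENNReal.ofReal_le_ofReal h1).trans ?_
    rw [ENNReal.ofReal_mul (by positivity), ENNReal.ofReal_mul (p := (τ ^ d)⁻¹) (by positivity),
      ENNReal.ofReal_inv_of_pos (by positivity), ENNReal.ofReal_pow hτ.le,
      ofReal_integral_norm_eq_lintegral_enorm (hDUi.mono_measure (Measure.restrict_mono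
        inter_subset_left le_rfl))]
    gcongr
    exact hCe _ (le_max_right _ _)
  have hJ'int : ∀ ε, 0 < ε → ε ≤ t₀ → IntervalIntegrable J' volume ε t₀ := by
    intro ε hε hεt
    rw [intervalIntegrable_iff_integrableOn_Ioc_of_le hεt]
    have hmeas : AEStronglyMeasurable J' (volume.restrict (Ioc ε t₀)) := by
      -- Measurability of J' in τ comes for free because it agrees with the derivative of J.
      refine (stronglyMeasurable_deriv J).aestronglyMeasurable.congr ?_
      refine (ae_restrict_iff' measurableSet_Ioc).2 (Eventually.of_forall fun τ hτ => ?_)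
      exact (hJ τ (hε.trans hτ.1)).deriv
    refine Integrable.of_bound hmeas (∫ y in Ω, ‖U y‖ * ((ε ^ (d + 1))⁻¹ * M')) ?_
    refine (ae_restrict_iff' measurableSet_Ioc).2 (Eventually.of_forall fun τ hτ => ?_)
    have hτ0 := hε.trans hτ.1
    refine norm_integral_le_of_norm_le (hUi.norm.mul_const _) (Eventually.of_forall fun y => ?_)
    rw [norm_mul, Complex.norm_real, norm_neg, norm_mul, Real.norm_of_nonneg (by positivity)]
    gcongr
    · exact hτ.1.le
    · exact hM' _
  have hbound : ∀ ε, 0 < ε → ε ≤ t₀ → ‖J ε‖ₑ ≤ C.toNNReal * (∫⁻ y in Ω, ‖U y‖ₑ) +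
      C.toNNReal * ∫⁻ τ in Ioc 0 t₀, (ENNReal.ofReal τ ^ d)⁻¹ *
        ∫⁻ y in Ω ∩ Metric.closedBall x (2 * τ), ‖DU y‖ₑ := by
    intro ε hε hεt
    -- The fundamental theorem of calculus is applied on [ε, t₀] only, with a bound independent of
    -- ε; letting ε → 0 at the end turns J(ε) into U(x).
    have hftc : ∫ τ in ε..t₀, J' τ = J t₀ - J ε := by
      refine intervalIntegral.integral_eq_sub_of_hasDerivAt (fun τ hτ => ?_) (hJ'int ε hε hεt)
      rw [uIcc_of_le hεt] at hτ
      exact hJ τ (hε.trans_le hτ.1)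
    have hJε : J ε = J t₀ - ∫ τ in ε..t₀, J' τ := by rw [hftc]; ring
    rw [hJε]
    refine enorm_sub_le.trans (add_le_add hJt₀ ?_)
    rw [intervalIntegral.integral_of_le hεt]
    refine (enorm_integral_le_lintegral_enorm _).trans ?_
    rw [← lintegral_const_mul' _ _ ENNReal.coe_ne_top]
    refine (lintegral_mono_set (Ioc_subset_Ioc_left hε.le)).trans ?_
    refine setLIntegral_mono' measurableSet_Ioc fun τ hτ => hJ'le τ hτ.1 hτ.2
  have hlim : Tendsto J (𝓝[>] 0) (𝓝 (U x)) :=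
    tendsto_integral_dilate hΩ hη hη0 hη1 hν hc hηs hUc hUi ht₀ hx.2 hxcone
  refine le_of_tendsto (hlim.enorm) ?_
  filter_upwards [Ioc_mem_nhdsGT ht₀] with ε hε
  exact hbound ε hε.1 hε.2

/-! ### A fractional-integral estimate, and subcritical Sobolev and trace inequalities. -/

theorem lintegral_Ioc_rpow_lt_top {s t₀ : ℝ} (hs : -1 < s) (ht₀ : 0 < t₀) :
    ∫⁻ τ in Ioc 0 t₀, ENNReal.ofReal τ ^ s < ⊤ := by
  have h1 : IntegrableOn (fun τ : ℝ => τ ^ s) (Ioc 0 t₀) volume :=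
    (intervalIntegrable_iff_integrableOn_Ioc_of_le ht₀.le).1
      (intervalIntegral.intervalIntegrable_rpow' hs)
  have h2 := h1.lintegral_lt_top
  refine lt_of_le_of_lt (le_of_eq ?_) h2
  refine setLIntegral_congr_fun measurableSet_Ioc fun τ hτ => ?_
  exact ENNReal.ofReal_rpow_of_pos hτ.1

/-- Hölder's inequality with exponents r/(r-1) and r after inserting w^((r-1)/r) · w^(-(r-1)/r) = 1.
The weight will be a power of τ, so that the singularity at τ = 0 can be shared between the two
factors. -/
theorem lintegral_rpow_le_weighted {s : Set ℝ} {g w : ℝ → ℝ≥0∞}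
    (hg : Measurable g) (hw : Measurable w) (hw0 : ∀ τ, τ ∈ s → w τ ≠ 0)
    (hwt : ∀ τ, τ ∈ s → w τ ≠ ⊤) (hs : MeasurableSet s) {r : ℝ} (hr : 1 < r) :
    (∫⁻ τ in s, g τ) ^ r ≤
      (∫⁻ τ in s, w τ) ^ (r - 1) * ∫⁻ τ in s, w τ ^ (1 - r) * g τ ^ r := by
  have hr0 : 0 < r := by linarith
  have hr1 : 0 < r - 1 := by linarith
  have hconj : (r / (r - 1)).HolderConjugate r := by
    rw [Real.holderConjugate_iff]
    refine ⟨by rw [lt_div_iff₀ hr1]; linarith, by field_simp; ring⟩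
  have h1 : ∫⁻ τ in s, g τ =
      ∫⁻ τ in s, ((fun τ => w τ ^ ((r - 1) / r)) * fun τ => w τ ^ (-((r - 1) / r)) * g τ) τ := by
    refine setLIntegral_congr_fun hs fun τ hτ => ?_
    simp only [Pi.mul_apply]
    rw [← mul_assoc, ← ENNReal.rpow_add _ _ (hw0 τ hτ) (hwt τ hτ), add_neg_cancel,
      ENNReal.rpow_zero, one_mul]
  have h2 := ENNReal.lintegral_mul_le_Lp_mul_Lq (volume.restrict s) hconj
    (f := fun τ => w τ ^ ((r - 1) / r)) (g := fun τ => w τ ^ (-((r - 1) / r)) * g τ)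
    (hw.pow_const _).aemeasurable ((hw.pow_const _).mul hg).aemeasurable
  rw [← h1] at h2
  calc (∫⁻ τ in s, g τ) ^ r
      ≤ ((∫⁻ τ in s, (w τ ^ ((r - 1) / r)) ^ (r / (r - 1))) ^ (1 / (r / (r - 1))) *
        (∫⁻ τ in s, (w τ ^ (-((r - 1) / r)) * g τ) ^ r) ^ (1 / r)) ^ r := by gcongr
    _ = _ := by
      rw [ENNReal.mul_rpow_of_nonneg _ _ hr0.le, ← ENNReal.rpow_mul, ← ENNReal.rpow_mul,
        one_div_mul_cancel hr0.ne', ENNReal.rpow_one]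
      congr 1
      · rw [show 1 / (r / (r - 1)) * r = r - 1 by field_simp]
        congr 1
        refine lintegral_congr fun τ => ?_
        rw [← ENNReal.rpow_mul, show (r - 1) / r * (r / (r - 1)) = 1 by field_simp,
          ENNReal.rpow_one]
      · refine lintegral_congr fun τ => ?_
        rw [ENNReal.mul_rpow_of_nonneg _ _ hr0.le, ← ENNReal.rpow_mul,
          show -((r - 1) / r) * r = 1 - r by field_simp; ring]

theorem sq_lintegral_le {α : Type*} [MeasurableSpace α] (μ : Measure α) {h : α → ℝ≥0∞}
    (hh : Measurable h) : (∫⁻ y, h y ∂μ) ^ (2 : ℝ) ≤ μ univ * ∫⁻ y, h y ^ (2 : ℝ) ∂μ := by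
  have h2 := ENNReal.lintegral_mul_le_Lp_mul_Lq μ Real.HolderConjugate.two_two
    (f := fun _ => 1) (g := h) aemeasurable_const hh.aemeasurable
  simp only [Pi.mul_apply, one_mul, ENNReal.one_rpow, lintegral_const] at h2
  calc (∫⁻ y, h y ∂μ) ^ (2 : ℝ)
      ≤ (μ univ ^ (1 / (2 : ℝ)) * (∫⁻ y, h y ^ (2 : ℝ) ∂μ) ^ (1 / (2 : ℝ))) ^ (2 : ℝ) := by
        gcongr
    _ = _ := by
      rw [ENNReal.mul_rpow_of_nonneg _ _ (by norm_num), ← ENNReal.rpow_mul, ← ENNReal.rpow_mul]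
      norm_num

theorem volume_closedBall_two_mul_le (d : ℕ) : ∃ C : ℝ≥0, ∀ (x : EuclideanSpace ℝ (Fin d)) (τ : ℝ),
    0 < τ → volume (Metric.closedBall x (2 * τ)) ≤ C * ENNReal.ofReal τ ^ (d : ℝ) := by
  have hfin : volume (Metric.ball (0 : EuclideanSpace ℝ (Fin d)) 1) ≠ ⊤ := measure_ball_lt_top.ne
  lift volume (Metric.ball (0 : EuclideanSpace ℝ (Fin d)) 1) to ℝ≥0 using hfin with C₀ hC₀
  refine ⟨2 ^ d * C₀, fun x τ hτ => ?_⟩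
  rw [Measure.addHaar_closedBall _ _ (by positivity), finrank_euclideanSpace_fin, ← hC₀,
    ENNReal.rpow_natCast, ENNReal.ofReal_pow (by positivity), ENNReal.ofReal_mul (by norm_num),
    mul_pow]
  simp only [ENNReal.ofReal_ofNat, ENNReal.coe_mul, ENNReal.coe_pow, ENNReal.coe_ofNat]
  apply le_of_eq; ring

theorem measurable_setLIntegral_closedBall {d : ℕ} {h : EuclideanSpace ℝ (Fin d) → ℝ≥0∞}
    (hh : Measurable h) :
    Measurable fun p : EuclideanSpace ℝ (Fin d) × ℝ =>
      ∫⁻ y in Metric.closedBall p.1 (2 * p.2), h y := by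
  have h1 : (fun p : EuclideanSpace ℝ (Fin d) × ℝ =>
      ∫⁻ y in Metric.closedBall p.1 (2 * p.2), h y) = fun p =>
      ∫⁻ y, {q : (EuclideanSpace ℝ (Fin d) × ℝ) × EuclideanSpace ℝ (Fin d) |
        dist q.2 q.1.1 ≤ 2 * q.1.2}.indicator (fun q => h q.2) (p, y) := by
    funext p
    rw [← lintegral_indicator Metric.isClosed_closedBall.measurableSet]
    refine lintegral_congr fun y => ?_
    by_cases hy : dist y p.1 ≤ 2 * p.2
    · rw [indicator_of_mem (Metric.mem_closedBall.2 hy), indicator_of_mem (by exact hy)]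
    · rw [indicator_of_notMem (fun h' => hy (Metric.mem_closedBall.1 h')),
        indicator_of_notMem (by exact hy)]
  rw [h1]
  refine Measurable.lintegral_prod_right' ?_
  refine (hh.comp measurable_snd).indicator ?_
  exact measurableSet_le (measurable_snd.dist (measurable_fst.comp measurable_fst))
    (measurable_const.mul (measurable_snd.comp measurable_fst))

set_option maxHeartbeats 400000 in
/-- A subcritical `L²`-to-`Lʳ(μ)` bound for the fractional-integral-type operator
`h ↦ ∫₀^{t₀} τ^{-d} ∫_{B(x, 2τ)} h dy dτ`, where `μ` has growth of order `n`. -/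
theorem exists_lintegral_average_rpow_le {d n : ℕ} {μ : Measure (EuclideanSpace ℝ (Fin d))}
    [SFinite μ] {Cμ : ℝ≥0}
    (hμ : ∀ (y : EuclideanSpace ℝ (Fin d)) (r : ℝ), 0 ≤ r →
      μ (Metric.closedBall y r) ≤ Cμ * ENNReal.ofReal r ^ n)
    {r : ℝ} (hr : 2 ≤ r) (hrn : r * ((d : ℝ) - 2) < 2 * n) {t₀ : ℝ} (ht₀ : 0 < t₀) :
    ∃ C : ℝ≥0, ∀ h : EuclideanSpace ℝ (Fin d) → ℝ≥0∞, Measurable h →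
      ∫⁻ x, (∫⁻ τ in Ioc 0 t₀, (ENNReal.ofReal τ ^ d)⁻¹ *
        ∫⁻ y in Metric.closedBall x (2 * τ), h y) ^ r ∂μ ≤
          C * (∫⁻ y, h y ^ (2 : ℝ)) ^ (r / 2) := by
  obtain ⟨Cv, hCv⟩ := volume_closedBall_two_mul_le d
  have hr1 : 0 < r - 1 := by linarith
  have hr2 : 0 ≤ r / 2 - 1 := by linarith
  -- With weight τ^(-a), the bound a < 1 makes ∫ τ^(-a) converge at 0, and the lower bound makes the
  -- remaining exponent a(r-1) + n - dr/2 exceed -1. Such an a exists precisely when r(d-2) < 2n.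
  obtain ⟨a, ha1, ha2⟩ : ∃ a, (d * r / 2 - n - 1) / (r - 1) < a ∧ a < 1 := by
    refine exists_between ?_
    rw [div_lt_one hr1]; linarith
  rw [div_lt_iff₀ hr1] at ha1
  let w : ℝ → ℝ≥0∞ := fun τ => ENNReal.ofReal τ ^ (-a)
  have hw : Measurable w := ENNReal.measurable_ofReal.pow_const _
  have hpos : ∀ τ, τ ∈ Ioc 0 t₀ → ENNReal.ofReal τ ≠ 0 := fun τ hτ => by
    simpa using hτ.1
  let I₁ : ℝ≥0∞ := ∫⁻ τ in Ioc 0 t₀, w τ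
  have hI₁ : I₁ ≠ ⊤ := (lintegral_Ioc_rpow_lt_top (by linarith) ht₀).ne
  let I₂ : ℝ≥0∞ := ∫⁻ τ in Ioc 0 t₀, ENNReal.ofReal τ ^ (a * (r - 1) + (n - d * r / 2))
  have hI₂ : I₂ ≠ ⊤ := (lintegral_Ioc_rpow_lt_top (by linarith) ht₀).ne
  let K : ℝ≥0∞ := I₁ ^ (r - 1) * ((Cv : ℝ≥0∞) ^ (r / 2) * (Cμ * 2 ^ n) * I₂)
  have hK : K ≠ ⊤ := by
    refine ENNReal.mul_ne_top (ENNReal.rpow_ne_top_of_nonneg hr1.le hI₁)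
      (ENNReal.mul_ne_top (ENNReal.mul_ne_top
        (ENNReal.rpow_ne_top_of_nonneg (by linarith) ENNReal.coe_ne_top) ?_) hI₂)
    exact ENNReal.mul_ne_top ENNReal.coe_ne_top (by simp)
  refine ⟨K.toNNReal, fun h hh => ?_⟩
  rw [ENNReal.coe_toNNReal hK]
  let H : ℝ≥0∞ := ∫⁻ y, h y ^ (2 : ℝ)
  let A : EuclideanSpace ℝ (Fin d) → ℝ → ℝ≥0∞ := fun x τ =>
    (ENNReal.ofReal τ ^ d)⁻¹ * ∫⁻ y in Metric.closedBall x (2 * τ), h y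
  let B : EuclideanSpace ℝ (Fin d) → ℝ → ℝ≥0∞ := fun x τ =>
    ∫⁻ y in Metric.closedBall x (2 * τ), h y ^ (2 : ℝ)
  have hAm : Measurable fun p : EuclideanSpace ℝ (Fin d) × ℝ => A p.1 p.2 :=
    (((ENNReal.measurable_ofReal.comp measurable_snd).pow_const d).inv).mul
      (measurable_setLIntegral_closedBall hh)
  have hBm : Measurable fun p : EuclideanSpace ℝ (Fin d) × ℝ => B p.1 p.2 :=
    measurable_setLIntegral_closedBall (hh.pow_const 2)
  -- Cauchy–Schwarz on the ball gives A² ≲ τ^(-d) B. Raising to the power r/2 ≥ 1 and using B ≤ H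
  -- for all but one factor leaves B linearly, so that it can be integrated in x.
  have hAB : ∀ x τ, τ ∈ Ioc 0 t₀ → A x τ ^ r ≤
      (Cv : ℝ≥0∞) ^ (r / 2) * ENNReal.ofReal τ ^ (-(d * r / 2)) * (H ^ (r / 2 - 1) * B x τ) := by
    intro x τ hτ
    have hT0 := hpos τ hτ
    have hTt : ENNReal.ofReal τ ≠ ⊤ := ENNReal.ofReal_ne_top
    set T := ENNReal.ofReal τ with hT
    have h1 : A x τ ^ (2 : ℝ) ≤ Cv * T ^ (-(d : ℝ)) * B x τ := by
      simp only [A, B]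
      rw [ENNReal.mul_rpow_of_nonneg _ _ (by norm_num)]
      have h2 := sq_lintegral_le (volume.restrict (Metric.closedBall x (2 * τ))) hh
      rw [Measure.restrict_apply_univ] at h2
      calc ((T ^ d)⁻¹) ^ (2 : ℝ) * (∫⁻ y in Metric.closedBall x (2 * τ), h y) ^ (2 : ℝ)
          ≤ ((T ^ d)⁻¹) ^ (2 : ℝ) * (Cv * T ^ (d : ℝ) *
            ∫⁻ y in Metric.closedBall x (2 * τ), h y ^ (2 : ℝ)) := by
              gcongr
              refine h2.trans ?_
              gcongr
              exact hCv x τ hτ.1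
        _ = Cv * (((T ^ d)⁻¹) ^ (2 : ℝ) * T ^ (d : ℝ)) *
            ∫⁻ y in Metric.closedBall x (2 * τ), h y ^ (2 : ℝ) := by ring
        _ = _ := by
            rw [← ENNReal.rpow_natCast, ← ENNReal.rpow_neg, ← ENNReal.rpow_mul,
              ← ENNReal.rpow_add _ _ hT0 hTt]
            congr 3; ring
    have hBH : B x τ ≤ H := setLIntegral_le_lintegral _ _
    calc A x τ ^ r = (A x τ ^ (2 : ℝ)) ^ (r / 2) := by
          rw [← ENNReal.rpow_mul]; congr 1; ring
      _ ≤ (Cv * T ^ (-(d : ℝ)) * B x τ) ^ (r / 2) := by gcongr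
      _ = (Cv : ℝ≥0∞) ^ (r / 2) * T ^ (-(d * r / 2)) * B x τ ^ (r / 2) := by
          rw [ENNReal.mul_rpow_of_nonneg _ _ (by linarith),
            ENNReal.mul_rpow_of_nonneg _ _ (by linarith), ← ENNReal.rpow_mul]
          congr 3; ring
      _ = (Cv : ℝ≥0∞) ^ (r / 2) * T ^ (-(d * r / 2)) * (B x τ ^ (r / 2 - 1) * B x τ) := by
          congr 1
          nth_rewrite 3 [← ENNReal.rpow_one (B x τ)]
          rw [← ENNReal.rpow_add_of_nonneg _ _ hr2 zero_le_one]
          congr 1; ring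
      _ ≤ _ := by gcongr
  -- By Tonelli the integration in x falls on the ball around y, where the growth of μ applies; this
  -- is the only use of `hμ`.
  have hBint : ∀ τ, τ ∈ Ioc 0 t₀ → ∫⁻ x, B x τ ∂μ ≤ Cμ * 2 ^ n * ENNReal.ofReal τ ^ (n : ℝ) * H := by
    intro τ hτ
    have hτ0 := hτ.1
    let F : EuclideanSpace ℝ (Fin d) → EuclideanSpace ℝ (Fin d) → ℝ≥0∞ := fun x y =>
      {q : EuclideanSpace ℝ (Fin d) × EuclideanSpace ℝ (Fin d) |
        dist q.2 q.1 ≤ 2 * τ}.indicator (fun q => h q.2 ^ (2 : ℝ)) (x, y)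
    have hF1 : ∀ x, B x τ = ∫⁻ y, F x y := by
      intro x
      simp only [B]
      rw [← lintegral_indicator Metric.isClosed_closedBall.measurableSet]
      refine lintegral_congr fun y => ?_
      simp only [F]
      by_cases hy : dist y x ≤ 2 * τ
      · rw [indicator_of_mem (Metric.mem_closedBall.2 hy), indicator_of_mem (by exact hy)]
      · rw [indicator_of_notMem (fun h' => hy (Metric.mem_closedBall.1 h')),
          indicator_of_notMem (by exact hy)]
    have hF2 : ∀ y, ∫⁻ x, F x y ∂μ = μ (Metric.closedBall y (2 * τ)) * h y ^ (2 : ℝ) := by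
      intro y
      have : (fun x => F x y) =
          (Metric.closedBall y (2 * τ)).indicator (fun _ => h y ^ (2 : ℝ)) := by
        funext x
        simp only [F]
        by_cases hy : dist y x ≤ 2 * τ
        · rw [indicator_of_mem (by exact hy),
            indicator_of_mem (Metric.mem_closedBall.2 (by rwa [dist_comm]))]
        · rw [indicator_of_notMem (by exact hy),
            indicator_of_notMem fun h' => hy (by rw [dist_comm]; exact Metric.mem_closedBall.1 h')]
      rw [this, lintegral_indicator_const Metric.isClosed_closedBall.measurableSet, mul_comm]
    have hFm : Measurable (Function.uncurry F) :=
      ((hh.comp measurable_snd).pow_const 2).indicator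
        (measurableSet_le (measurable_snd.dist measurable_fst) measurable_const)
    simp_rw [hF1]
    rw [lintegral_lintegral_swap hFm.aemeasurable]
    simp_rw [hF2]
    simp only [H]
    rw [← lintegral_const_mul _ (hh.pow_const 2)]
    refine lintegral_mono fun y => ?_
    gcongr
    refine (hμ y (2 * τ) (by positivity)).trans (le_of_eq ?_)
    rw [ENNReal.ofReal_mul (by norm_num), mul_pow, ENNReal.rpow_natCast, ENNReal.ofReal_ofNat,
      mul_assoc]
  have hAint : ∀ τ, τ ∈ Ioc 0 t₀ → ∫⁻ x, w τ ^ (1 - r) * A x τ ^ r ∂μ ≤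
      (Cv : ℝ≥0∞) ^ (r / 2) * (Cμ * 2 ^ n) * H ^ (r / 2) *
        ENNReal.ofReal τ ^ (a * (r - 1) + (n - d * r / 2)) := by
    intro τ hτ
    have hT0 := hpos τ hτ
    have hTt : ENNReal.ofReal τ ≠ ⊤ := ENNReal.ofReal_ne_top
    have hB' : Measurable fun x => B x τ := Measurable.of_uncurry_right (f := B) (y := τ) hBm
    have hA' : Measurable fun x => A x τ := Measurable.of_uncurry_right (f := A) (y := τ) hAm
    rw [lintegral_const_mul _ (hA'.pow_const r)]
    calc w τ ^ (1 - r) * ∫⁻ x, A x τ ^ r ∂μ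
        ≤ w τ ^ (1 - r) * ∫⁻ x, (Cv : ℝ≥0∞) ^ (r / 2) * ENNReal.ofReal τ ^ (-(d * r / 2)) *
          (H ^ (r / 2 - 1) * B x τ) ∂μ := by
            gcongr with x
            exact hAB x τ hτ
      _ = w τ ^ (1 - r) * ((Cv : ℝ≥0∞) ^ (r / 2) * ENNReal.ofReal τ ^ (-(d * r / 2)) *
          (H ^ (r / 2 - 1) * ∫⁻ x, B x τ ∂μ)) := by
            rw [lintegral_const_mul _ (hB'.const_mul _), lintegral_const_mul _ hB']
      _ ≤ w τ ^ (1 - r) * ((Cv : ℝ≥0∞) ^ (r / 2) * ENNReal.ofReal τ ^ (-(d * r / 2)) *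
          (H ^ (r / 2 - 1) * (Cμ * 2 ^ n * ENNReal.ofReal τ ^ (n : ℝ) * H))) := by
            gcongr
            exact hBint τ hτ
      _ = (Cv : ℝ≥0∞) ^ (r / 2) * (Cμ * 2 ^ n) * (H ^ (r / 2 - 1) * H) *
          (w τ ^ (1 - r) * ENNReal.ofReal τ ^ (-(d * r / 2)) * ENNReal.ofReal τ ^ (n : ℝ)) := by
            ring
      _ = _ := by
            simp only [w]
            congr 1
            · congr 1
              nth_rewrite 2 [← ENNReal.rpow_one H]
              rw [← ENNReal.rpow_add_of_nonneg _ _ hr2 zero_le_one]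
              congr 1; ring
            · rw [← ENNReal.rpow_mul, ← ENNReal.rpow_add _ _ hT0 hTt,
                ← ENNReal.rpow_add _ _ hT0 hTt]
              congr 1; ring
  calc ∫⁻ x, (∫⁻ τ in Ioc 0 t₀, A x τ) ^ r ∂μ
      ≤ ∫⁻ x, I₁ ^ (r - 1) * (∫⁻ τ in Ioc 0 t₀, w τ ^ (1 - r) * A x τ ^ r) ∂μ := by
        refine lintegral_mono fun x => ?_
        refine lintegral_rpow_le_weighted (Measurable.of_uncurry_left (f := A) (x := x) hAm) hw
          (fun τ hτ => ?_) (fun τ hτ => ?_) measurableSet_Ioc (by linarith)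
        · exact (ENNReal.rpow_pos (pos_iff_ne_zero.2 (hpos τ hτ)) ENNReal.ofReal_ne_top).ne'
        · exact ENNReal.rpow_ne_top_of_ne_zero (hpos τ hτ) ENNReal.ofReal_ne_top
    _ = I₁ ^ (r - 1) * ∫⁻ τ in Ioc 0 t₀, ∫⁻ x, w τ ^ (1 - r) * A x τ ^ r ∂μ := by
        have hm : Measurable fun p : EuclideanSpace ℝ (Fin d) × ℝ =>
            w p.2 ^ (1 - r) * A p.1 p.2 ^ r :=
          ((hw.comp measurable_snd).pow_const _).mul (hAm.pow_const r)
        rw [lintegral_const_mul _ (Measurable.lintegral_prod_right' hm),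
          lintegral_lintegral_swap hm.aemeasurable]
    _ ≤ I₁ ^ (r - 1) * ∫⁻ τ in Ioc 0 t₀, (Cv : ℝ≥0∞) ^ (r / 2) * (Cμ * 2 ^ n) * H ^ (r / 2) *
        ENNReal.ofReal τ ^ (a * (r - 1) + (n - d * r / 2)) := by
        refine mul_le_mul_right ?_ _
        exact setLIntegral_mono' measurableSet_Ioc fun τ hτ => hAint τ hτ
    _ = K * H ^ (r / 2) := by
        rw [lintegral_const_mul _ (ENNReal.measurable_ofReal.pow_const _)]
        simp only [K, I₂]
        ring

/-- Raise the local pointwise bound to the power r, integrate it against μ, and sum over a finite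
cover of the compact closure. Keeping μ general gives the interior and boundary inequalities at
once. -/
theorem exists_eLpNorm_le_of_continuousOn {d n : ℕ} {Ω : Set (EuclideanSpace ℝ (Fin d))}
    (hΩ : IsOpen Ω) (hbdd : Bornology.IsBounded Ω) (hlip : HasLipschitzBoundary Ω)
    {μ : Measure (EuclideanSpace ℝ (Fin d))} [IsFiniteMeasure μ] (hμΩ : μ (closure Ω)ᶜ = 0)
    {Cμ : ℝ≥0} (hμ : ∀ (y : EuclideanSpace ℝ (Fin d)) (r : ℝ), 0 ≤ r →
      μ (Metric.closedBall y r) ≤ Cμ * ENNReal.ofReal r ^ n)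
    {r : ℝ} (hr : 2 ≤ r) (hrn : r * ((d : ℝ) - 2) < 2 * n) :
    ∃ C : ℝ≥0, ∀ (U : EuclideanSpace ℝ (Fin d) → ℂ)
      (DU : EuclideanSpace ℝ (Fin d) → EuclideanSpace ℂ (Fin d)),
      ContinuousOn U (closure Ω) → IsH1 Ω U DU →
        eLpNorm U (ENNReal.ofReal r) μ ≤
          C * (eLpNorm U 2 (volume.restrict Ω) + eLpNorm DU 2 (volume.restrict Ω)) := by
  have hr0 : 0 < r := by linarith
  have hcomp : IsCompact (closure Ω) :=
    Metric.isCompact_of_isClosed_isBounded isClosed_closure hbdd.closure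
  have : IsFiniteMeasure (volume.restrict Ω) := ⟨by
    rw [Measure.restrict_apply_univ]; exact hbdd.measure_lt_top⟩
  have key : ∀ z ∈ closure Ω, ∃ W ∈ 𝓝 z, ∃ K : ℝ≥0, ∀ (U : EuclideanSpace ℝ (Fin d) → ℂ)
      (DU : EuclideanSpace ℝ (Fin d) → EuclideanSpace ℂ (Fin d)),
      ContinuousOn U (closure Ω) → IsH1 Ω U DU →
        ∫⁻ x in W, ‖U x‖ₑ ^ r ∂μ ≤
          K * (eLpNorm U 2 (volume.restrict Ω) + eLpNorm DU 2 (volume.restrict Ω)) ^ r := by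
    intro z hz
    obtain ⟨W₀, hW₀, C, t₀, ht₀, hC⟩ :=
      exists_nhds_enorm_le hΩ.measurableSet (coneConditionAt_of_mem_closure hΩ hlip hz)
    obtain ⟨W, hWW₀, hWo, hzW⟩ := mem_nhds_iff.1 hW₀
    obtain ⟨C', hC'⟩ := exists_lintegral_average_rpow_le hμ hr hrn ht₀
    -- The factor 2^(r-1) is from (x + y)^r ≤ 2^(r-1)(x^r + y^r); the two summands are the mean of
    -- |U| and the averages of the gradient.
    let K : ℝ≥0∞ := 2 ^ (r - 1) * ((C * volume Ω ^ (1 / 2 : ℝ)) ^ r * μ univ + C ^ r * C')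
    have hK : K ≠ ⊤ := by
      refine ENNReal.mul_ne_top (ENNReal.rpow_ne_top_of_nonneg (by linarith) (by simp))
        (ENNReal.add_ne_top.2 ⟨ENNReal.mul_ne_top (ENNReal.rpow_ne_top_of_nonneg hr0.le
          (ENNReal.mul_ne_top ENNReal.coe_ne_top
            (ENNReal.rpow_ne_top_of_nonneg (by norm_num) hbdd.measure_lt_top.ne)))
          (measure_ne_top μ _), ENNReal.mul_ne_top
            (ENNReal.rpow_ne_top_of_nonneg hr0.le ENNReal.coe_ne_top) ENNReal.coe_ne_top⟩)
    refine ⟨W, hWo.mem_nhds hzW, K.toNNReal, fun U DU hUc hU => ?_⟩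
    rw [ENNReal.coe_toNNReal hK]
    set X := eLpNorm U 2 (volume.restrict Ω) with hX
    set Y := eLpNorm DU 2 (volume.restrict Ω) with hY
    -- The gradient is only a.e. measurable on Ω, so its norm is replaced by a measurable function
    -- extended by zero.
    obtain ⟨g, hg, hgDU⟩ := hU.memLp_grad.1.aemeasurable.enorm
    let h : EuclideanSpace ℝ (Fin d) → ℝ≥0∞ := Ω.indicator g
    have hh : Measurable h := hg.indicator hΩ.measurableSet
    have hDUh : ∀ s : Set (EuclideanSpace ℝ (Fin d)), MeasurableSet s →
        ∫⁻ y in Ω ∩ s, ‖DU y‖ₑ = ∫⁻ y in s, h y := by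
      intro s hs
      rw [setLIntegral_indicator hΩ.measurableSet]
      exact lintegral_congr_ae (ae_restrict_of_ae_restrict_of_subset inter_subset_left hgDU)
    have hY2 : (∫⁻ y, h y ^ (2 : ℝ)) ^ (r / 2) = Y ^ r := by
      have h1 : ∫⁻ y, h y ^ (2 : ℝ) = ∫⁻ y in Ω, ‖DU y‖ₑ ^ (2 : ℝ) := by
        rw [← lintegral_indicator hΩ.measurableSet]
        have h2 : ∫⁻ y, Ω.indicator (fun y => ‖DU y‖ₑ ^ (2 : ℝ)) y =
            ∫⁻ y, Ω.indicator (fun y => g y ^ (2 : ℝ)) y := by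
          rw [lintegral_indicator hΩ.measurableSet, lintegral_indicator hΩ.measurableSet]
          refine lintegral_congr_ae ?_
          filter_upwards [hgDU] with y hy
          rw [hy]
        rw [h2]
        refine lintegral_congr fun y => ?_
        by_cases hy : y ∈ Ω
        · simp [h, hy]
        · simp [h, hy]
      rw [h1, hY, eLpNorm_eq_lintegral_rpow_enorm_toReal (by norm_num) (by norm_num),
        ← ENNReal.rpow_mul]
      simp only [ENNReal.toReal_ofNat]
      congr 1; ring
    have hX1 : ∫⁻ y in Ω, ‖U y‖ₑ ≤ volume Ω ^ (1 / 2 : ℝ) * X := by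
      have := eLpNorm_le_eLpNorm_mul_rpow_measure_univ (μ := volume.restrict Ω) (p := 1) (q := 2)
        (f := U) (by norm_num) hU.memLp.1
      rw [eLpNorm_one_eq_lintegral_enorm, Measure.restrict_apply_univ] at this
      refine this.trans (le_of_eq ?_)
      rw [mul_comm]
      congr 2
      norm_num
    have hpt : ∀ x ∈ W ∩ closure Ω, ‖U x‖ₑ ≤ C * (volume Ω ^ (1 / 2 : ℝ) * X) +
        C * ∫⁻ τ in Ioc 0 t₀, (ENNReal.ofReal τ ^ d)⁻¹ *
          ∫⁻ y in Metric.closedBall x (2 * τ), h y := by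
      intro x hx
      refine (hC U DU hUc hU x ⟨hWW₀ hx.1, hx.2⟩).trans ?_
      simp_rw [hDUh _ Metric.isClosed_closedBall.measurableSet]
      gcongr
    let G : EuclideanSpace ℝ (Fin d) → ℝ≥0∞ := fun x =>
      2 ^ (r - 1) * ((C * (volume Ω ^ (1 / 2 : ℝ) * X)) ^ r +
        C ^ r * (∫⁻ τ in Ioc 0 t₀, (ENNReal.ofReal τ ^ d)⁻¹ *
          ∫⁻ y in Metric.closedBall x (2 * τ), h y) ^ r)
    have hGm : Measurable fun x => (∫⁻ τ in Ioc 0 t₀, (ENNReal.ofReal τ ^ d)⁻¹ *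
          ∫⁻ y in Metric.closedBall x (2 * τ), h y) ^ r := by
      refine Measurable.pow_const (Measurable.lintegral_prod_right'
        (f := fun p : EuclideanSpace ℝ (Fin d) × ℝ => (ENNReal.ofReal p.2 ^ d)⁻¹ *
          ∫⁻ y in Metric.closedBall p.1 (2 * p.2), h y) ?_) r
      exact (((ENNReal.measurable_ofReal.comp measurable_snd).pow_const d).inv).mul
        (measurable_setLIntegral_closedBall hh)
    have hle : ∀ᵐ x ∂μ, x ∈ W → ‖U x‖ₑ ^ r ≤ G x := by
      filter_upwards [compl_mem_ae_iff.2 hμΩ] with x hx hxW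
      refine (ENNReal.rpow_le_rpow (hpt x ⟨hxW, not_not.1 hx⟩) hr0.le).trans ?_
      refine (ENNReal.rpow_add_le_mul_rpow_add_rpow _ _ (by linarith)).trans ?_
      simp only [G]
      rw [ENNReal.mul_rpow_of_nonneg C (∫⁻ τ in Ioc 0 t₀, _) hr0.le]
    have hle' : ∫⁻ x in W, ‖U x‖ₑ ^ r ∂μ ≤ ∫⁻ x, G x ∂μ :=
      (setLIntegral_mono_ae' hWo.measurableSet hle).trans (setLIntegral_le_lintegral _ _)
    refine hle'.trans ?_
    simp only [G]
    rw [lintegral_const_mul' _ _ (ENNReal.rpow_ne_top_of_nonneg (by linarith) (by simp)),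
      lintegral_add_left measurable_const, lintegral_const, lintegral_const_mul _ hGm]
    simp only [K]
    rw [mul_assoc]
    refine mul_le_mul_right ?_ _
    rw [add_mul]
    refine add_le_add ?_ ?_
    · rw [← mul_assoc (C : ℝ≥0∞), ENNReal.mul_rpow_of_nonneg _ X hr0.le]
      calc _ = (C * volume Ω ^ (1 / 2 : ℝ)) ^ r * μ univ * X ^ r := by ring
        _ ≤ _ := by gcongr; exact le_self_add
    · rw [mul_assoc]
      refine mul_le_mul_right ((hC' h hh).trans ?_) _
      rw [hY2]
      gcongr
      exact le_add_self
  choose! W hW K hK using key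
  obtain ⟨t, htΩ, ht⟩ := hcomp.elim_nhds_subcover W hW
  refine ⟨(∑ z ∈ t, K z) ^ (1 / r), fun U DU hUc hU => ?_⟩
  set XY := eLpNorm U 2 (volume.restrict Ω) + eLpNorm DU 2 (volume.restrict Ω)
  rw [eLpNorm_eq_lintegral_rpow_enorm_toReal (by simpa using hr0) ENNReal.ofReal_ne_top,
    ENNReal.toReal_ofReal hr0.le]
  have h1 : ∫⁻ x, ‖U x‖ₑ ^ r ∂μ ≤ (∑ z ∈ t, (K z : ℝ≥0∞)) * XY ^ r := by
    have h2 : ∫⁻ x, ‖U x‖ₑ ^ r ∂μ = ∫⁻ x in closure Ω, ‖U x‖ₑ ^ r ∂μ := by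
      rw [Measure.restrict_eq_self_of_ae_mem]
      filter_upwards [compl_mem_ae_iff.2 hμΩ] with x hx
      exact not_not.1 hx
    rw [h2]
    calc ∫⁻ x in closure Ω, ‖U x‖ₑ ^ r ∂μ ≤ ∫⁻ x in ⋃ z : t, W z, ‖U x‖ₑ ^ r ∂μ := by
          refine lintegral_mono_set (ht.trans ?_)
          rw [iUnion_subtype]
      _ ≤ ∑' z : t, ∫⁻ x in W z, ‖U x‖ₑ ^ r ∂μ := lintegral_iUnion_le _ _
      _ = ∑ z ∈ t, ∫⁻ x in W z, ‖U x‖ₑ ^ r ∂μ := by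
          rw [tsum_fintype, Finset.univ_eq_attach]
          exact Finset.sum_attach t fun z => ∫⁻ x in W z, ‖U x‖ₑ ^ r ∂μ
      _ ≤ ∑ z ∈ t, K z * XY ^ r := Finset.sum_le_sum fun z hz => hK z (htΩ z hz) U DU hUc hU
      _ = _ := by rw [Finset.sum_mul]
  calc (∫⁻ x, ‖U x‖ₑ ^ r ∂μ) ^ (1 / r) ≤ ((∑ z ∈ t, (K z : ℝ≥0∞)) * XY ^ r) ^ (1 / r) := by
        gcongr
    _ = _ := by
        rw [ENNReal.mul_rpow_of_nonneg _ _ (by positivity), ← ENNReal.rpow_mul,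
          mul_one_div_cancel hr0.ne', ENNReal.rpow_one, ENNReal.coe_rpow_of_nonneg _ (by positivity)]
        push_cast
        rfl

/-- Fatou's lemma along an a.e. convergent subsequence. It carries L^r bounds from the continuous
approximants to their L² limits without assuming convergence in L^r. -/
theorem eLpNorm_le_of_tendsto_eLpNorm_sub {α F : Type*} [MeasurableSpace α] {μ : Measure α}
    [NormedAddCommGroup F] {f : ℕ → α → F} {g : α → F} {p : ℝ≥0∞} {a : ℕ → ℝ≥0∞} {b : ℝ≥0∞}
    (hf : ∀ n, AEStronglyMeasurable (f n) μ) (hg : AEStronglyMeasurable g μ)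
    (hfg : Tendsto (fun n => eLpNorm (f n - g) 2 μ) atTop (𝓝 0))
    (ha : ∀ n, eLpNorm (f n) p μ ≤ a n) (hab : Tendsto a atTop (𝓝 b)) :
    eLpNorm g p μ ≤ b := by
  obtain ⟨ns, hns, hae⟩ :=
    (tendstoInMeasure_of_tendsto_eLpNorm (by norm_num) hf hg hfg).exists_seq_tendsto_ae
  refine (Lp.eLpNorm_lim_le_liminf_eLpNorm (fun n => hf (ns n)) g hae).trans ?_
  have h2 : Tendsto (a ∘ ns) atTop (𝓝 b) := hab.comp hns.tendsto_atTop
  rw [← h2.liminf_eq]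
  exact liminf_le_liminf (Eventually.of_forall fun n => ha (ns n))

theorem aestronglyMeasurable_surfaceMeasure {d : ℕ} {Ω : Set (EuclideanSpace ℝ (Fin d))}
    {U : EuclideanSpace ℝ (Fin d) → ℂ} (hU : ContinuousOn U (closure Ω)) :
    AEStronglyMeasurable U (surfaceMeasure Ω) :=
  (hU.mono frontier_subset_closure).aestronglyMeasurable isClosed_frontier.measurableSet

/-- Subcritical Sobolev embedding and trace inequality on a bounded Lipschitz domain. -/
theorem exists_eLpNorm_le_of_hasTrace {d : ℕ} (hd : 2 ≤ d) {Ω : Set (EuclideanSpace ℝ (Fin d))}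
    (hΩ : IsOpen Ω) (hbdd : Bornology.IsBounded Ω) (hlip : HasLipschitzBoundary Ω)
    {r s : ℝ} (hr : 2 ≤ r) (hrd : r * ((d : ℝ) - 2) < 2 * d)
    (hs : 2 ≤ s) (hsd : s * ((d : ℝ) - 2) < 2 * ((d : ℝ) - 1)) :
    ∃ C : ℝ≥0, ∀ u Du φ, HasTrace Ω u Du φ →
      eLpNorm u (ENNReal.ofReal r) (volume.restrict Ω) ≤
        C * (eLpNorm u 2 (volume.restrict Ω) + eLpNorm Du 2 (volume.restrict Ω)) ∧
      eLpNorm φ (ENNReal.ofReal s) (surfaceMeasure Ω) ≤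
        C * (eLpNorm u 2 (volume.restrict Ω) + eLpNorm Du 2 (volume.restrict Ω)) := by
  have : IsFiniteMeasure (volume.restrict Ω) := ⟨by
    rw [Measure.restrict_apply_univ]; exact hbdd.measure_lt_top⟩
  have := isFiniteMeasure_surfaceMeasure hd hΩ hbdd hlip
  obtain ⟨Cσ, hCσ⟩ := exists_surfaceMeasure_closedBall_le hd hΩ hbdd hlip
  have hvol : ∀ (y : EuclideanSpace ℝ (Fin d)) (r : ℝ), 0 ≤ r →
      volume.restrict Ω (Metric.closedBall y r) ≤
        (volume (Metric.ball (0 : EuclideanSpace ℝ (Fin d)) 1)).toNNReal *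
          ENNReal.ofReal r ^ d := by
    intro y r hr
    refine (Measure.restrict_apply_le _ _).trans (le_of_eq ?_)
    rw [Measure.addHaar_closedBall _ _ hr, finrank_euclideanSpace_fin, ENNReal.ofReal_pow hr,
      ENNReal.coe_toNNReal measure_ball_lt_top.ne, mul_comm]
  obtain ⟨C₁, hC₁⟩ := exists_eLpNorm_le_of_continuousOn hΩ hbdd hlip (μ := volume.restrict Ω)
    (by rw [Measure.restrict_apply isClosed_closure.measurableSet.compl]
        rw [disjoint_iff_inter_eq_empty.1 (disjoint_compl_left.mono_right subset_closure),
          measure_empty])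
    hvol hr hrd
  obtain ⟨C₂, hC₂⟩ := exists_eLpNorm_le_of_continuousOn hΩ hbdd hlip (μ := surfaceMeasure Ω)
    (by rw [surfaceMeasure, Measure.restrict_apply isClosed_closure.measurableSet.compl]
        rw [disjoint_iff_inter_eq_empty.1
          (disjoint_compl_left.mono_right frontier_subset_closure), measure_empty])
    hCσ hs (by rw [Nat.cast_sub (by omega)]; exact_mod_cast hsd)
  refine ⟨max C₁ C₂, fun u Du φ hu => ?_⟩
  obtain ⟨U, DU, hU, hUu, hDU, hUφ⟩ := hu.exists_approx
  set a : ℕ → ℝ≥0∞ := fun n => (max C₁ C₂ : ℝ≥0) *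
    ((eLpNorm (U n - u) 2 (volume.restrict Ω) + eLpNorm u 2 (volume.restrict Ω)) +
      (eLpNorm (DU n - Du) 2 (volume.restrict Ω) + eLpNorm Du 2 (volume.restrict Ω)))
  have ha : Tendsto a atTop (𝓝 ((max C₁ C₂ : ℝ≥0) *
      (eLpNorm u 2 (volume.restrict Ω) + eLpNorm Du 2 (volume.restrict Ω)))) := by
    refine ENNReal.Tendsto.const_mul ?_ (Or.inr ENNReal.coe_ne_top)
    simpa using (hUu.add_const (eLpNorm u 2 (volume.restrict Ω))).add
      (hDU.add_const (eLpNorm Du 2 (volume.restrict Ω)))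
  have hle : ∀ n, eLpNorm (U n) 2 (volume.restrict Ω) + eLpNorm (DU n) 2 (volume.restrict Ω) ≤
      (eLpNorm (U n - u) 2 (volume.restrict Ω) + eLpNorm u 2 (volume.restrict Ω)) +
      (eLpNorm (DU n - Du) 2 (volume.restrict Ω) + eLpNorm Du 2 (volume.restrict Ω)) := by
    intro n
    refine add_le_add ?_ ?_
    · have := eLpNorm_add_le (p := 2) ((hU n).2.memLp.1.sub hu.isH1.memLp.1) hu.isH1.memLp.1
        (by norm_num)
      rwa [sub_add_cancel] at this
    · have := eLpNorm_add_le (p := 2) ((hU n).2.memLp_grad.1.sub hu.isH1.memLp_grad.1)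
        hu.isH1.memLp_grad.1 (by norm_num)
      rwa [sub_add_cancel] at this
  constructor
  · refine eLpNorm_le_of_tendsto_eLpNorm_sub (fun n => (hU n).2.memLp.1) hu.isH1.memLp.1 hUu
      (fun n => (hC₁ (U n) (DU n) (hU n).1 (hU n).2).trans ?_) ha
    exact mul_le_mul' (by exact_mod_cast le_max_left _ _) (hle n)
  · refine eLpNorm_le_of_tendsto_eLpNorm_sub
      (fun n => aestronglyMeasurable_surfaceMeasure (hU n).1) hu.memLp_trace.1 hUφ
      (fun n => (hC₂ (U n) (DU n) (hU n).1 (hU n).2).trans ?_) ha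
    exact mul_le_mul' (by exact_mod_cast le_max_right _ _) (hle n)

/-! ### Mollification and the chain rule for C¹ Lipschitz functions of H¹ functions. -/

open scoped Convolution

theorem integral_norm_convolution_normed_le {d : ℕ}
    (φ : ContDiffBump (0 : EuclideanSpace ℝ (Fin d))) {f : EuclideanSpace ℝ (Fin d) → ℂ}
    (hf : Integrable f) :
    ∫ x, ‖(φ.normed volume ⋆[ContinuousLinearMap.lsmul ℝ ℝ, volume] f) x‖ ≤ ∫ x, ‖f x‖ := by
  have hρ : Integrable (φ.normed volume) volume := φ.integrable_normed
  have h1 : ∫ x, (φ.normed volume ⋆[ContinuousLinearMap.lsmul ℝ ℝ, volume] fun y => ‖f y‖) x =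
      ∫ x, ‖f x‖ := by
    rw [integral_convolution _ hρ hf.norm, φ.integral_normed]
    simp
  rw [← h1]
  refine integral_mono (Integrable.integrable_convolution _ hρ hf).norm
    (Integrable.integrable_convolution _ hρ hf.norm) fun x => ?_
  simp only [convolution_def]
  refine (norm_integral_le_integral_norm _).trans (le_of_eq ?_)
  refine integral_congr_ae (Eventually.of_forall fun t => ?_)
  simp [abs_of_nonneg (φ.nonneg_normed t)]

/-- Mollification contracts L¹, so f may be replaced by a continuous compactly supported g with
small L¹ error, twice. For g, uniform continuity gives an error δ, confined to a fixed compact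
neighbourhood of the support once the mollifier radius is below 1. -/
theorem tendsto_integral_norm_convolution_sub {d : ℕ}
    {φ : ℕ → ContDiffBump (0 : EuclideanSpace ℝ (Fin d))}
    (hφ : Tendsto (fun n => (φ n).rOut) atTop (𝓝 0)) {f : EuclideanSpace ℝ (Fin d) → ℂ}
    (hf : Integrable f) :
    Tendsto (fun n => ∫ x, ‖((φ n).normed volume ⋆[ContinuousLinearMap.lsmul ℝ ℝ, volume] f) x -
      f x‖) atTop (𝓝 0) := by
  rw [Metric.tendsto_atTop]
  intro ε hε
  obtain ⟨g, hgc, hfg, hg, hgi⟩ := hf.exists_hasCompactSupport_integral_sub_le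
    (ε := ε / 4) (by positivity)
  let S : Set (EuclideanSpace ℝ (Fin d)) := Metric.cthickening 1 (tsupport g)
  have hS : IsCompact S := IsCompact.cthickening hgc
  obtain ⟨δ, hδ, hgδ⟩ : ∃ δ > 0, δ * volume.real S < ε / 4 := by
    refine ⟨ε / 4 / (volume.real S + 1), by positivity, ?_⟩
    rw [div_mul_eq_mul_div, div_lt_iff₀ (by positivity)]
    nlinarith [measureReal_nonneg (μ := volume) (s := S)]
  have hguc : UniformContinuous g := hgc.uniformContinuous_of_continuous hg
  obtain ⟨τ, hτ, hgτ⟩ := Metric.uniformContinuous_iff.1 hguc δ hδ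
  obtain ⟨N, hN⟩ := Metric.tendsto_atTop.1 hφ (min τ 1) (by positivity)
  refine ⟨N, fun n hn => ?_⟩
  have hrn : (φ n).rOut < min τ 1 := by
    have := hN n hn
    rwa [Real.dist_eq, sub_zero, abs_of_pos (φ n).rOut_pos] at this
  set ρ := (φ n).normed volume
  set L := ContinuousLinearMap.lsmul ℝ ℝ (E := ℂ)
  have hρ : Integrable ρ volume := (φ n).integrable_normed
  have hci : Integrable (ρ ⋆[L, volume] f) := Integrable.integrable_convolution L hρ hf
  have hcfg : Integrable (ρ ⋆[L, volume] (f - g)) :=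
    Integrable.integrable_convolution L hρ (hf.sub hgi)
  have hcg : Integrable (ρ ⋆[L, volume] g) := Integrable.integrable_convolution L hρ hgi
  have hsmall : ∀ x, ‖(ρ ⋆[L, volume] g) x - g x‖ ≤ S.indicator (fun _ => δ) x := by
    intro x
    by_cases hx : x ∈ S
    · rw [indicator_of_mem hx, ← dist_eq_norm]
      refine ContDiffBump.dist_normed_convolution_le hg.aestronglyMeasurable fun y hy => ?_
      exact (hgτ (lt_of_lt_of_le (Metric.mem_ball.1 hy) (hrn.le.trans (min_le_left _ _)))).le
    · rw [indicator_of_notMem hx, ← dist_eq_norm]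
      have h0 : ∀ y ∈ Metric.ball x (φ n).rOut, g y = g x := by
        intro y hy
        have hgx : g x = 0 := image_eq_zero_of_notMem_tsupport fun h =>
          hx (Metric.self_subset_cthickening _ h)
        rw [hgx]
        refine image_eq_zero_of_notMem_tsupport fun h => hx ?_
        refine Metric.mem_cthickening_of_dist_le x y 1 _ h ?_
        rw [dist_comm]
        exact (Metric.mem_ball.1 hy).le.trans (hrn.le.trans (min_le_right _ _))
      rw [ContDiffBump.normed_convolution_eq_right h0, dist_self]
  have hpt : ∀ᵐ x, ‖(ρ ⋆[L, volume] f) x - f x‖ ≤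
      ‖(ρ ⋆[L, volume] (f - g)) x‖ + S.indicator (fun _ => δ) x + ‖f x - g x‖ := by
    filter_upwards [hρ.ae_convolution_exists L (hf.sub hgi), hρ.ae_convolution_exists L hgi]
      with x hx1 hx2
    have h3 : (ρ ⋆[L, volume] f) x = (ρ ⋆[L, volume] (f - g)) x + (ρ ⋆[L, volume] g) x := by
      have := ConvolutionExistsAt.distrib_add hx1 hx2
      rw [← this, sub_add_cancel]
    rw [h3]
    calc ‖(ρ ⋆[L, volume] (f - g)) x + (ρ ⋆[L, volume] g) x - f x‖
        = ‖(ρ ⋆[L, volume] (f - g)) x + ((ρ ⋆[L, volume] g) x - g x) + -(f x - g x)‖ := by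
          congr 1; ring
      _ ≤ ‖(ρ ⋆[L, volume] (f - g)) x‖ + ‖(ρ ⋆[L, volume] g) x - g x‖ + ‖-(f x - g x)‖ :=
          norm_add₃_le
      _ ≤ _ := by
          rw [norm_neg]
          gcongr
          exact hsmall x
  have hind : Integrable (S.indicator fun _ => δ) (volume : Measure (EuclideanSpace ℝ (Fin d))) :=
    (integrable_indicator_iff hS.measurableSet).2 (integrableOn_const hS.measure_lt_top.ne)
  rw [Real.dist_eq, sub_zero, abs_of_nonneg (integral_nonneg fun x => norm_nonneg _)]
  calc ∫ x, ‖(ρ ⋆[L, volume] f) x - f x‖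
      ≤ ∫ x, (‖(ρ ⋆[L, volume] (f - g)) x‖ + S.indicator (fun _ => δ) x + ‖f x - g x‖) :=
        integral_mono_ae (hci.sub hf).norm ((hcfg.norm.add hind).add (hf.sub hgi).norm) hpt
    _ = (∫ x, ‖(ρ ⋆[L, volume] (f - g)) x‖) + (∫ x, S.indicator (fun _ => δ) x) +
        ∫ x, ‖f x - g x‖ := by
        have h4 := integral_add (hcfg.norm.add hind) (hf.sub hgi).norm
        have h5 := integral_add hcfg.norm hind
        simp only [Pi.add_apply, Pi.sub_apply] at h4 h5
        rw [h4, h5]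
    _ ≤ ε / 4 + ε / 4 + ε / 4 := by
        gcongr
        · exact (integral_norm_convolution_normed_le (φ n) (hf.sub hgi)).trans hfg
        · rw [integral_indicator_const _ hS.measurableSet, smul_eq_mul, mul_comm]
          exact hgδ.le
    _ < ε := by linarith

/-- On points at distance more than `φ.rOut` from the complement of `Ω`, the gradient of the
mollification is the mollification of the weak gradient. -/
theorem fderiv_convolution_indicator {d : ℕ} {Ω : Set (EuclideanSpace ℝ (Fin d))}
    (hΩ : MeasurableSet Ω) [IsFiniteMeasure (volume.restrict Ω)]
    {U : EuclideanSpace ℝ (Fin d) → ℂ}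
    {DU : EuclideanSpace ℝ (Fin d) → EuclideanSpace ℂ (Fin d)} (hU : IsH1 Ω U DU)
    (φ : ContDiffBump (0 : EuclideanSpace ℝ (Fin d))) {x : EuclideanSpace ℝ (Fin d)}
    (hx : Metric.closedBall x φ.rOut ⊆ Ω) (i : Fin d) :
    fderiv ℝ (φ.normed volume ⋆[ContinuousLinearMap.lsmul ℝ ℝ, volume] Ω.indicator U) x
      (EuclideanSpace.single i 1) =
      (φ.normed volume ⋆[ContinuousLinearMap.lsmul ℝ ℝ, volume] Ω.indicator fun y => DU y i) x := by
  have hUi : Integrable (Ω.indicator U) :=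
    (integrable_indicator_iff hΩ).2 (hU.memLp.integrable (by norm_num))
  set ρ := φ.normed volume
  have hρ : ContDiff ℝ ∞ ρ := φ.contDiff_normed
  have hρc : HasCompactSupport ρ := φ.hasCompactSupport_normed
  let L := ContinuousLinearMap.lsmul ℝ ℝ (E := ℂ)
  have hd := hρc.hasFDerivAt_convolution_right L.flip hUi.locallyIntegrable (hρ.of_le (by simp)) x
  rw [convolution_flip] at hd
  rw [hd.fderiv, convolution_precompR_apply L.flip hUi.locallyIntegrable (hρc.fderiv (𝕜 := ℝ))
    (hρ.continuous_fderiv (by simp)), ← convolution_flip (ContinuousLinearMap.lsmul ℝ ℝ),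
    convolution_def, convolution_def]
  -- The value at x of a mollification is the pairing with the reflected kernel centred at x. It is
  -- supported in the closed ball, hence in Ω, and the sign from the reflection cancels the one in
  -- the weak gradient identity.
  let η : EuclideanSpace ℝ (Fin d) → ℝ := fun t => ρ (x - t)
  have hη : ContDiff ℝ ∞ η := hρ.comp (contDiff_const.sub contDiff_id)
  have hηsub : tsupport η ⊆ Metric.closedBall x φ.rOut := by
    refine closure_minimal (fun t ht => ?_) Metric.isClosed_closedBall
    have : x - t ∈ Function.support ρ := ht
    rw [φ.support_normed_eq] at this
    rw [mem_closedBall_iff_norm, norm_sub_rev]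
    exact (mem_ball_zero_iff.1 this).le
  have hηc : HasCompactSupport η :=
    HasCompactSupport.of_support_subset_isCompact (isCompact_closedBall x φ.rOut)
      ((subset_tsupport _).trans hηsub)
  have hηd : ∀ t, fderiv ℝ η t (EuclideanSpace.single i 1) =
      - fderiv ℝ ρ (x - t) (EuclideanSpace.single i 1) := by
    intro t
    have h1 : HasFDerivAt η ((fderiv ℝ ρ (x - t)).comp (-ContinuousLinearMap.id ℝ _)) t :=
      ((hρ.differentiable (by simp)) (x - t)).hasFDerivAt.comp t ((hasFDerivAt_id t).const_sub x)
    rw [h1.fderiv]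
    simp
  have hw := hU.weak_grad η hη hηc (hηsub.trans hx) i
  simp_rw [hηd] at hw
  have hl : ∫ t, L.flip (Ω.indicator U t) (fderiv ℝ ρ (x - t) (EuclideanSpace.single i 1)) =
      ∫ t in Ω, U t * ((fderiv ℝ ρ (x - t) (EuclideanSpace.single i 1) : ℝ) : ℂ) := by
    rw [← integral_indicator hΩ]
    refine integral_congr_ae (Eventually.of_forall fun t => ?_)
    by_cases ht : t ∈ Ω
    · simp [L, ht, mul_comm]
    · simp [L, ht]
  have hr : ∫ t, L.flip (Ω.indicator (fun y => DU y i) t) (ρ (x - t)) =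
      ∫ t in Ω, DU t i * ((η t : ℝ) : ℂ) := by
    rw [← integral_indicator hΩ]
    refine integral_congr_ae (Eventually.of_forall fun t => ?_)
    by_cases ht : t ∈ Ω
    · simp [L, ht, mul_comm, η]
    · simp [L, ht]
  refine hl.trans (Eq.trans ?_ hr.symm)
  rw [← neg_eq_iff_eq_neg.2 hw, ← integral_neg]
  simp


/-- The gradient of `T ∘ u` at a point where `u` has value `z` and gradient `ζ`. -/
def chainGrad {d : ℕ} (T : ℂ → ℂ) (z : ℂ) (ζ : EuclideanSpace ℂ (Fin d)) :
    EuclideanSpace ℂ (Fin d) :=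
  WithLp.toLp 2 fun i => fderiv ℝ T z (ζ i)

theorem continuous_chainGrad {d : ℕ} {T : ℂ → ℂ} (hT : ContDiff ℝ 1 T) :
    Continuous fun p : ℂ × EuclideanSpace ℂ (Fin d) => chainGrad T p.1 p.2 := by
  have h1 : Continuous (fderiv ℝ T) := hT.continuous_fderiv (by simp)
  refine (PiLp.continuous_toLp 2 _).comp (continuous_pi fun i => ?_)
  exact (h1.comp continuous_fst).clm_apply (by fun_prop)

theorem norm_chainGrad_le {d : ℕ} {T : ℂ → ℂ} {L : ℝ≥0} (hTL : LipschitzWith L T) (z : ℂ)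
    (ζ : EuclideanSpace ℂ (Fin d)) : ‖chainGrad T z ζ‖ ≤ L * ‖ζ‖ := by
  have hL := norm_fderiv_le_of_lipschitz ℝ hTL (x₀ := z)
  rw [EuclideanSpace.norm_eq, EuclideanSpace.norm_eq, ← Real.sqrt_sq L.coe_nonneg,
    ← Real.sqrt_mul (sq_nonneg _), Finset.mul_sum]
  refine Real.sqrt_le_sqrt (Finset.sum_le_sum fun i _ => ?_)
  rw [← mul_pow]
  gcongr
  exact ((fderiv ℝ T z).le_opNorm _).trans (by gcongr)

theorem chainGrad_sub {d : ℕ} (T : ℂ → ℂ) (z : ℂ) (ζ ζ' : EuclideanSpace ℂ (Fin d)) :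
    chainGrad T z (ζ - ζ') = chainGrad T z ζ - chainGrad T z ζ' := by
  ext i
  simp [chainGrad]

theorem memLp_chainGrad {d : ℕ} {T : ℂ → ℂ} (hT : ContDiff ℝ 1 T) {L : ℝ≥0}
    (hTL : LipschitzWith L T) {μ : Measure (EuclideanSpace ℝ (Fin d))}
    {u : EuclideanSpace ℝ (Fin d) → ℂ}
    {Du : EuclideanSpace ℝ (Fin d) → EuclideanSpace ℂ (Fin d)}
    (hu : AEStronglyMeasurable u μ) (hDu : MemLp Du 2 μ) :
    MemLp (fun x => chainGrad T (u x) (Du x)) 2 μ := by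
  refine MemLp.of_le_mul hDu
    ((continuous_chainGrad hT).comp_aestronglyMeasurable (hu.prodMk hDu.1)) (c := L) ?_
  exact Eventually.of_forall fun x => norm_chainGrad_le hTL _ _

/-- The classical chain rule and integration by parts hold for mollifications of U, and one passes
to the limit. Continuity of U makes the mollifications converge at every point of Ω, so the
derivative of T at them converges pointwise too; their gradients converge in L¹ near the support of
the test function. -/
theorem isH1_comp_of_continuousOn {d : ℕ} {Ω : Set (EuclideanSpace ℝ (Fin d))}
    (hΩ : IsOpen Ω) (hbdd : Bornology.IsBounded Ω) {U : EuclideanSpace ℝ (Fin d) → ℂ}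
    {DU : EuclideanSpace ℝ (Fin d) → EuclideanSpace ℂ (Fin d)}
    (hUc : ContinuousOn U (closure Ω)) (hU : IsH1 Ω U DU) {T : ℂ → ℂ} (hT : ContDiff ℝ 1 T)
    {L : ℝ≥0} (hTL : LipschitzWith L T) (hT0 : T 0 = 0) :
    IsH1 Ω (fun x => T (U x)) (fun x => chainGrad T (U x) (DU x)) := by
  have hfin : IsFiniteMeasure (volume.restrict Ω) := ⟨by
    rw [Measure.restrict_apply_univ]; exact hbdd.measure_lt_top⟩
  refine ⟨hTL.comp_memLp hT0 hU.memLp, memLp_chainGrad hT hTL hU.memLp.1 hU.memLp_grad, ?_⟩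
  intro η hη hηc hηΩ i
  have hΩm := hΩ.measurableSet
  -- All mollifier radii are at most δ, so on the support of η mollifying sees only values from Ω
  -- and commutes with the weak gradient.
  obtain ⟨δ, hδ, hδΩ⟩ := hηc.exists_cthickening_subset_open hΩ hηΩ
  let φ : ℕ → ContDiffBump (0 : EuclideanSpace ℝ (Fin d)) := fun n =>
    ⟨δ / (2 * (n + 1)), δ / (n + 1), by positivity, by
      apply div_lt_div_of_pos_left hδ (by positivity); linarith⟩
  have hφδ : ∀ n, (φ n).rOut ≤ δ := fun n => by
    change δ / (n + 1) ≤ δ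
    exact div_le_self hδ.le (by linarith [Nat.cast_nonneg (α := ℝ) n])
  have hφ : Tendsto (fun n => (φ n).rOut) atTop (𝓝 0) := by
    change Tendsto (fun n : ℕ => δ / ((n : ℝ) + 1)) atTop (𝓝 0)
    have := (tendsto_one_div_add_atTop_nhds_zero_nat (𝕜 := ℝ)).const_mul δ
    simpa [div_eq_mul_inv] using this
  have hball : ∀ n, ∀ x ∈ tsupport η, Metric.closedBall x (φ n).rOut ⊆ Ω := fun n x hx =>
    (Metric.closedBall_subset_closedBall (hφδ n)).trans
      ((Metric.closedBall_subset_cthickening hx δ).trans hδΩ)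
  let ℓ := ContinuousLinearMap.lsmul ℝ ℝ (E := ℂ)
  let Ut := Ω.indicator U
  let Dt := Ω.indicator fun y => DU y i
  have hUi : Integrable Ut :=
    (integrable_indicator_iff hΩm).2 (hU.memLp.integrable (by norm_num))
  have hDi : Integrable Dt := by
    refine (integrable_indicator_iff hΩm).2 ?_
    have h1 := hU.memLp_grad.integrable (by norm_num)
    exact (EuclideanSpace.proj i : EuclideanSpace ℂ (Fin d) →L[ℂ] ℂ).integrable_comp h1
  obtain ⟨M, hM⟩ : ∃ M, ∀ x, ‖Ut x‖ ≤ M := by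
    have hcomp : IsCompact (closure Ω) :=
      Metric.isCompact_of_isClosed_isBounded isClosed_closure hbdd.closure
    obtain ⟨M, hM⟩ := hcomp.exists_bound_of_continuousOn hUc
    refine ⟨max M 0, fun x => ?_⟩
    by_cases hx : x ∈ Ω
    · simp only [Ut, indicator_of_mem hx]
      exact (hM x (subset_closure hx)).trans (le_max_left _ _)
    · simp [Ut, hx]
  let V : ℕ → EuclideanSpace ℝ (Fin d) → ℂ := fun n => (φ n).normed volume ⋆[ℓ, volume] Ut
  let D : ℕ → EuclideanSpace ℝ (Fin d) → ℂ := fun n => (φ n).normed volume ⋆[ℓ, volume] Dt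
  have hVsm : ∀ n, ContDiff ℝ ∞ (V n) := fun n =>
    (φ n).hasCompactSupport_normed.contDiff_convolution_left ℓ (φ n).contDiff_normed
      hUi.locallyIntegrable
  have hVM : ∀ n x, ‖V n x‖ ≤ M := by
    intro n x
    rw [← dist_zero_right]
    refine dist_convolution_le ((norm_nonneg _).trans (hM 0)) (φ n).support_normed_eq.subset
      (φ n).nonneg_normed (φ n).integral_normed hUi.aestronglyMeasurable fun y _ => ?_
    rw [dist_zero_right]; exact hM y
  have hVlim : ∀ x ∈ Ω, Tendsto (fun n => V n x) atTop (𝓝 (U x)) := by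
    intro x hx
    have hc : ContinuousAt Ut x := by
      have h1 : ContinuousAt U x := (hUc.mono subset_closure).continuousAt (hΩ.mem_nhds hx)
      refine h1.congr ?_
      filter_upwards [hΩ.mem_nhds hx] with y hy
      simp [Ut, hy]
    have h2 : Ut x = U x := by simp [Ut, hx]
    rw [← h2]
    exact ContDiffBump.convolution_tendsto_right (g := fun _ => Ut) (k := fun _ => x) hφ
      (Eventually.of_forall fun _ => hUi.aestronglyMeasurable) (hc.tendsto.comp tendsto_snd)
      tendsto_const_nhds
  have hVd : ∀ n, ∀ x ∈ tsupport η, fderiv ℝ (V n) x (EuclideanSpace.single i 1) = D n x :=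
    fun n x hx => fderiv_convolution_indicator hΩm hU (φ n) (hball n x hx) i
  let e : EuclideanSpace ℝ (Fin d) := EuclideanSpace.single i 1
  let ηc : EuclideanSpace ℝ (Fin d) → ℂ := fun x => (η x : ℂ)
  have hηcd : ∀ x, fderiv ℝ ηc x e = ((fderiv ℝ η x e : ℝ) : ℂ) := by
    intro x
    have h1 : HasFDerivAt ηc (Complex.ofRealCLM.comp (fderiv ℝ η x)) x :=
      Complex.ofRealCLM.hasFDerivAt.comp x ((hη.differentiable (by simp)) x).hasFDerivAt
    rw [h1.fderiv]; rfl
  have hηcs : ContDiff ℝ ∞ ηc := Complex.ofRealCLM.contDiff.comp hη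
  have hηcc : HasCompactSupport ηc := hηc.comp_left (g := fun t : ℝ => (t : ℂ)) (by simp)
  have hTVd : ∀ n x, fderiv ℝ (fun x => T (V n x)) x e = fderiv ℝ T (V n x) (fderiv ℝ (V n) x e) := by
    intro n x
    have h1 := ((hT.differentiable (by simp)) (V n x)).hasFDerivAt.comp x
      (((hVsm n).differentiable (by simp)) x).hasFDerivAt
    have h2 : fderiv ℝ (fun x => T (V n x)) x = _ := h1.fderiv
    rw [h2]; rfl
  have hTV : ∀ n, ContDiff ℝ 1 fun x => T (V n x) := fun n => hT.comp ((hVsm n).of_le (by simp))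
  have hcontTVd : ∀ n, Continuous fun x => fderiv ℝ (fun x => T (V n x)) x e := fun n =>
    ((hTV n).continuous_fderiv (by simp)).clm_apply continuous_const
  have hcontηd : Continuous fun x => fderiv ℝ ηc x e :=
    (hηcs.continuous_fderiv (by simp)).clm_apply continuous_const
  have hηdc : HasCompactSupport fun x => fderiv ℝ ηc x e := hηcc.fderiv_apply (𝕜 := ℝ) e
  have hbyparts : ∀ n, ∫ x, T (V n x) * fderiv ℝ ηc x e =
      - ∫ x, fderiv ℝ T (V n x) (D n x) * ηc x := by
    intro n
    rw [integral_mul_fderiv_eq_neg_fderiv_mul_of_integrable]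
    · congr 1
      refine integral_congr_ae (Eventually.of_forall fun x => ?_)
      by_cases hx : x ∈ tsupport η
      · simp only [hTVd]
        rw [hVd n x hx]
      · have : ηc x = 0 := by simp [ηc, image_eq_zero_of_notMem_tsupport hx]
        simp [this]
    · exact ((hcontTVd n).mul hηcs.continuous).integrable_of_hasCompactSupport hηcc.mul_left
    · exact ((hTV n).continuous.mul hcontηd).integrable_of_hasCompactSupport hηdc.mul_left
    · exact ((hTV n).continuous.mul hηcs.continuous).integrable_of_hasCompactSupport hηcc.mul_left
    · exact fun x _ => (hTV n).differentiable (by simp) x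
    · exact fun x _ => hηcs.differentiable (by simp) x
  have hTbd : ∀ z, ‖T z‖ ≤ L * ‖z‖ := fun z => by
    have := hTL.dist_le_mul z 0
    rwa [hT0, dist_zero_right, dist_zero_right] at this
  have hlimL : Tendsto (fun n => ∫ x, T (V n x) * fderiv ℝ ηc x e) atTop
      (𝓝 (∫ x in Ω, T (U x) * ((fderiv ℝ η x e : ℝ) : ℂ))) := by
    have h1 : ∫ x in Ω, T (U x) * ((fderiv ℝ η x e : ℝ) : ℂ) =
        ∫ x, Ω.indicator (fun x => T (U x) * fderiv ℝ ηc x e) x := by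
      rw [integral_indicator hΩm]
      simp_rw [hηcd]
    rw [h1]
    refine tendsto_integral_of_dominated_convergence (fun x => L * M * ‖fderiv ℝ ηc x e‖)
      (fun n => ((hTV n).continuous.mul hcontηd).aestronglyMeasurable) ?_ ?_ ?_
    · exact ((hcontηd.integrable_of_hasCompactSupport hηdc).norm).const_mul _
    · refine fun n => Eventually.of_forall fun x => ?_
      rw [norm_mul]
      gcongr
      exact (hTbd _).trans (by gcongr; exact hVM n x)
    · refine Eventually.of_forall fun x => ?_
      by_cases hx : x ∈ Ω
      · rw [indicator_of_mem hx]
        exact ((hT.continuous.tendsto _).comp (hVlim x hx)).mul_const _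
      · rw [indicator_of_notMem hx]
        have h2 : fderiv ℝ ηc x e = 0 := by
          rw [hηcd, fderiv_of_notMem_tsupport ℝ fun h => hx (hηΩ h)]; simp
        simp [h2]
  obtain ⟨Mη, hMη⟩ := hηcs.continuous.bounded_above_of_compact_support hηcc
  have hMη0 : 0 ≤ Mη := (norm_nonneg _).trans (hMη 0)
  have hfT : ∀ z w, ‖fderiv ℝ T z w‖ ≤ L * ‖w‖ := fun z w =>
    ((fderiv ℝ T z).le_opNorm w).trans (by gcongr; exact norm_fderiv_le_of_lipschitz ℝ hTL)
  have hfTc : Continuous (fderiv ℝ T) := hT.continuous_fderiv (by simp)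
  have hmeasT : ∀ n (f : EuclideanSpace ℝ (Fin d) → ℂ), AEStronglyMeasurable f volume →
      AEStronglyMeasurable (fun x => fderiv ℝ T (V n x) (f x) * ηc x) volume := by
    intro n f hf
    have h1 : Continuous fun p : ℂ × ℂ => fderiv ℝ T p.1 p.2 :=
      (hfTc.comp continuous_fst).clm_apply continuous_snd
    exact (h1.comp_aestronglyMeasurable
      ((hVsm n).continuous.aestronglyMeasurable.prodMk hf)).mul
        hηcs.continuous.aestronglyMeasurable
  have hintT : ∀ n (f : EuclideanSpace ℝ (Fin d) → ℂ), Integrable f →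
      Integrable (fun x => fderiv ℝ T (V n x) (f x) * ηc x) := by
    intro n f hf
    refine (hf.norm.const_mul (L * Mη)).mono' (hmeasT n f hf.1) (Eventually.of_forall fun x => ?_)
    rw [norm_mul]
    calc _ ≤ L * ‖f x‖ * Mη := by gcongr; exacts [hfT _ _, hMη x]
      _ = _ := by ring
  have hlimR : Tendsto (fun n => ∫ x, fderiv ℝ T (V n x) (Dt x) * ηc x) atTop
      (𝓝 (∫ x in Ω, chainGrad T (U x) (DU x) i * ((η x : ℝ) : ℂ))) := by
    have h1 : ∫ x in Ω, chainGrad T (U x) (DU x) i * ((η x : ℝ) : ℂ) =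
        ∫ x, Ω.indicator (fun x => chainGrad T (U x) (DU x) i * ((η x : ℝ) : ℂ)) x := by
      rw [integral_indicator hΩm]
    rw [h1]
    refine tendsto_integral_of_dominated_convergence (fun x => L * Mη * ‖Dt x‖)
      (fun n => hmeasT n _ hDi.1) (hDi.norm.const_mul _) ?_ ?_
    · refine fun n => Eventually.of_forall fun x => ?_
      rw [norm_mul]
      calc _ ≤ L * ‖Dt x‖ * Mη := by gcongr; exacts [hfT _ _, hMη x]
        _ = _ := by ring
    · refine Eventually.of_forall fun x => ?_
      by_cases hx : x ∈ Ω
      · have h2 : Dt x = DU x i := by simp [Dt, hx]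
        rw [indicator_of_mem hx, h2]
        have h3 : Tendsto (fun n => fderiv ℝ T (V n x)) atTop (𝓝 (fderiv ℝ T (U x))) :=
          (hfTc.tendsto _).comp (hVlim x hx)
        exact (((ContinuousLinearMap.apply ℝ ℂ (DU x i)).continuous.tendsto _).comp h3).mul_const _
      · have h2 : Dt x = 0 := by simp [Dt, hx]
        rw [indicator_of_notMem hx, h2]
        simp
  have hDni : ∀ n, Integrable (D n) := fun n =>
    Integrable.integrable_convolution ℓ (φ n).integrable_normed hDi
  -- The derivative of T is bounded by L, so replacing the mollified gradient by the true one costs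
  -- at most L Mη times their L¹ distance.
  have hlimE : Tendsto (fun n => ∫ x, fderiv ℝ T (V n x) (D n x - Dt x) * ηc x) atTop (𝓝 0) := by
    have h1 := (tendsto_integral_norm_convolution_sub hφ hDi).const_mul (L * Mη)
    rw [mul_zero] at h1
    refine squeeze_zero_norm (fun n => ?_) h1
    rw [← integral_const_mul]
    refine norm_integral_le_of_norm_le (((hDni n).sub hDi).norm.const_mul _)
      (Eventually.of_forall fun x => ?_)
    rw [norm_mul]
    calc _ ≤ L * ‖D n x - Dt x‖ * Mη := by gcongr; exacts [hfT _ _, hMη x]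
      _ = _ := by ring
  have hsplit : ∀ n, ∫ x, fderiv ℝ T (V n x) (D n x) * ηc x =
      (∫ x, fderiv ℝ T (V n x) (D n x - Dt x) * ηc x) +
        ∫ x, fderiv ℝ T (V n x) (Dt x) * ηc x := by
    intro n
    refine Eq.trans ?_ (integral_add (hintT n _ ((hDni n).sub hDi)) (hintT n _ hDi))
    refine integral_congr_ae (Eventually.of_forall fun x => ?_)
    simp only
    rw [map_sub]; ring
  have hlim2 : Tendsto (fun n => ∫ x, T (V n x) * fderiv ℝ ηc x e) atTop
      (𝓝 (- ∫ x in Ω, chainGrad T (U x) (DU x) i * ((η x : ℝ) : ℂ))) := by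
    simp_rw [hbyparts, hsplit]
    simpa using (hlimE.add hlimR).neg
  exact tendsto_nhds_unique hlimL hlim2

theorem tendsto_integral_mul_of_tendsto_eLpNorm {α : Type*} [MeasurableSpace α] {μ : Measure α}
    [IsFiniteMeasure μ] {f : ℕ → α → ℂ} {f₀ g : α → ℂ} (hf : ∀ n, MemLp (f n) 2 μ)
    (hf₀ : MemLp f₀ 2 μ) (hg : AEStronglyMeasurable g μ) {M : ℝ} (hM : ∀ x, ‖g x‖ ≤ M)
    (hlim : Tendsto (fun n => eLpNorm (f n - f₀) 2 μ) atTop (𝓝 0)) :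
    Tendsto (fun n => ∫ x, f n x * g x ∂μ) atTop (𝓝 (∫ x, f₀ x * g x ∂μ)) := by
  have hint : ∀ h : α → ℂ, MemLp h 2 μ → Integrable (fun x => h x * g x) μ := fun h hh =>
    (hh.integrable (by norm_num)).mul_bdd hg (Eventually.of_forall hM)
  refine tendsto_integral_of_L1 _ (hint _ hf₀).1
    (Eventually.of_forall fun n => hint _ (hf n)) ?_
  have h1 : Tendsto (fun n => ENNReal.ofReal M *
      (eLpNorm (f n - f₀) 2 μ * μ univ ^ (1 / (1 : ℝ≥0∞).toReal - 1 / (2 : ℝ≥0∞).toReal)))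
      atTop (𝓝 0) := by
    have h2 := ENNReal.Tendsto.mul_const hlim (b := μ univ ^
      (1 / (1 : ℝ≥0∞).toReal - 1 / (2 : ℝ≥0∞).toReal))
      (Or.inr (ENNReal.rpow_ne_top_of_nonneg (by norm_num) (measure_ne_top μ _)))
    have h3 := ENNReal.Tendsto.const_mul h2 (a := ENNReal.ofReal M) (Or.inr ENNReal.ofReal_ne_top)
    simpa using h3
  refine tendsto_of_tendsto_of_tendsto_of_le_of_le tendsto_const_nhds h1 (fun n => zero_le) ?_
  intro n
  have h4 := eLpNorm_le_eLpNorm_mul_rpow_measure_univ (μ := μ) (p := 1) (q := 2)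
    (f := f n - f₀) (by norm_num) ((hf n).sub hf₀).1
  refine le_trans ?_ (mul_le_mul_right h4 _)
  rw [eLpNorm_one_eq_lintegral_enorm, ← lintegral_const_mul' _ _ ENNReal.ofReal_ne_top]
  refine lintegral_mono fun x => ?_
  simp only [Pi.sub_apply]
  rw [← sub_mul, enorm_mul, mul_comm]
  gcongr
  rw [← ofReal_norm]
  exact ENNReal.ofReal_le_ofReal (hM x)

theorem tendsto_eLpNorm_two_of_dominated {α F G : Type*} [MeasurableSpace α] {μ : Measure α}
    [NormedAddCommGroup F] [NormedAddCommGroup G] {f : ℕ → α → F} {b : α → G}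
    (hf : ∀ n, AEStronglyMeasurable (f n) μ) (hb : MemLp b 2 μ) {C : ℝ≥0}
    (hfb : ∀ n x, ‖f n x‖ ≤ C * ‖b x‖) (hlim : ∀ᵐ x ∂μ, Tendsto (fun n => f n x) atTop (𝓝 0)) :
    Tendsto (fun n => eLpNorm (f n) 2 μ) atTop (𝓝 0) := by
  have hb2 : MemLp (fun x => (C : ℝ) * ‖b x‖) 2 μ := hb.norm.const_mul _
  have h1 : Tendsto (fun n => ∫⁻ x, ‖f n x‖ₑ ^ (2 : ℝ) ∂μ) atTop (𝓝 (∫⁻ _, 0 ∂μ)) := by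
    refine tendsto_lintegral_of_dominated_convergence'
      (fun x => ‖(C : ℝ) * ‖b x‖‖ₑ ^ (2 : ℝ)) (fun n => (hf n).enorm.pow_const _) ?_ ?_ ?_
    · refine fun n => Eventually.of_forall fun x => ?_
      refine ENNReal.rpow_le_rpow ?_ (by norm_num)
      rw [enorm_le_iff_norm_le]
      exact (hfb n x).trans (le_abs_self _)
    · have := lintegral_rpow_enorm_lt_top_of_eLpNorm_lt_top (by norm_num) (by norm_num) hb2.2
      simpa using this.ne
    · filter_upwards [hlim] with x hx
      have h2 := hx.enorm
      rw [enorm_zero] at h2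
      have h3 := (ENNReal.continuous_rpow_const (y := 2)).tendsto (0 : ℝ≥0∞)
      rw [ENNReal.zero_rpow_of_pos (by norm_num)] at h3
      exact h3.comp h2
  rw [lintegral_zero] at h1
  have h3 := (ENNReal.continuous_rpow_const (y := 1 / 2)).tendsto (0 : ℝ≥0∞)
  rw [ENNReal.zero_rpow_of_pos (by norm_num)] at h3
  refine (h3.comp h1).congr fun n => ?_
  rw [eLpNorm_eq_lintegral_rpow_enorm_toReal (by norm_num) (by norm_num)]
  simp

theorem isH1_of_tendsto {d : ℕ} {Ω : Set (EuclideanSpace ℝ (Fin d))}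
    [IsFiniteMeasure (volume.restrict Ω)] {U : ℕ → EuclideanSpace ℝ (Fin d) → ℂ}
    {DU : ℕ → EuclideanSpace ℝ (Fin d) → EuclideanSpace ℂ (Fin d)}
    {u : EuclideanSpace ℝ (Fin d) → ℂ}
    {Du : EuclideanSpace ℝ (Fin d) → EuclideanSpace ℂ (Fin d)}
    (hU : ∀ n, IsH1 Ω (U n) (DU n)) (hu : MemLp u 2 (volume.restrict Ω))
    (hDu : MemLp Du 2 (volume.restrict Ω))
    (hUu : Tendsto (fun n => eLpNorm (U n - u) 2 (volume.restrict Ω)) atTop (𝓝 0))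
    (hDUu : Tendsto (fun n => eLpNorm (DU n - Du) 2 (volume.restrict Ω)) atTop (𝓝 0)) :
    IsH1 Ω u Du := by
  refine ⟨hu, hDu, fun η hη hηc hηΩ i => ?_⟩
  have hcoord : ∀ {f : EuclideanSpace ℝ (Fin d) → EuclideanSpace ℂ (Fin d)},
      MemLp f 2 (volume.restrict Ω) → MemLp (fun x => f x i) 2 (volume.restrict Ω) := fun hf =>
    (EuclideanSpace.proj i : EuclideanSpace ℂ (Fin d) →L[ℂ] ℂ).comp_memLp' hf
  have hdc : Continuous fun x => fderiv ℝ η x (EuclideanSpace.single i 1) :=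
    (hη.continuous_fderiv (by simp)).clm_apply continuous_const
  obtain ⟨M₁, hM₁⟩ := hdc.bounded_above_of_compact_support
    (hηc.fderiv_apply (𝕜 := ℝ) (EuclideanSpace.single i 1))
  obtain ⟨M₂, hM₂⟩ := hη.continuous.bounded_above_of_compact_support hηc
  have h1 := tendsto_integral_mul_of_tendsto_eLpNorm (fun n => (hU n).memLp) hu
    (Complex.continuous_ofReal.comp hdc).aestronglyMeasurable (M := M₁)
    (fun x => by simpa using hM₁ x) hUu
  have h2 := tendsto_integral_mul_of_tendsto_eLpNorm (f := fun n x => DU n x i)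
    (f₀ := fun x => Du x i) (fun n => hcoord (hU n).memLp_grad) (hcoord hDu)
    (Complex.continuous_ofReal.comp hη.continuous).aestronglyMeasurable (M := M₂)
    (fun x => by simpa using hM₂ x) (by
      refine tendsto_of_tendsto_of_tendsto_of_le_of_le tendsto_const_nhds hDUu
        (fun n => zero_le) fun n => ?_
      refine eLpNorm_mono fun x => ?_
      exact PiLp.norm_apply_le (DU n x - Du x) i)
  have h3 := h2.neg
  simp only [Function.comp_apply] at h1 h3
  have h4 : ∀ n, _ := fun n => (hU n).weak_grad η hη hηc hηΩ i
  simp_rw [← h4] at h3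
  exact tendsto_nhds_unique h1 h3

/-- Composition of an `H¹` function with a `C¹` Lipschitz function, including traces. -/
theorem HasTrace.comp {d : ℕ} {Ω : Set (EuclideanSpace ℝ (Fin d))}
    (hΩ : IsOpen Ω) (hbdd : Bornology.IsBounded Ω) {u : EuclideanSpace ℝ (Fin d) → ℂ}
    {Du : EuclideanSpace ℝ (Fin d) → EuclideanSpace ℂ (Fin d)}
    {φ : EuclideanSpace ℝ (Fin d) → ℂ} (hu : HasTrace Ω u Du φ)
    {T : ℂ → ℂ} (hT : ContDiff ℝ 1 T)
    {L : ℝ≥0} (hTL : LipschitzWith L T) (hT0 : T 0 = 0) :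
    HasTrace Ω (fun x => T (u x)) (fun x => chainGrad T (u x) (Du x)) (fun x => T (φ x)) := by
  have hfin : IsFiniteMeasure (volume.restrict Ω) := ⟨by
    rw [Measure.restrict_apply_univ]; exact hbdd.measure_lt_top⟩
  obtain ⟨U, DU, hU, hUu, hDUu, hUφ⟩ := hu.exists_approx
  -- Lipschitz continuity handles convergence of T(U n) and its trace, but the gradients involve DT
  -- at U n, which is merely continuous in its base point; hence the passage to an a.e. convergent
  -- subsequence.
  obtain ⟨ns, hns, hae⟩ := (tendstoInMeasure_of_tendsto_eLpNorm (by norm_num)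
    (fun n => (hU n).2.memLp.1) hu.isH1.memLp.1 hUu).exists_seq_tendsto_ae
  have hsub := hns.tendsto_atTop
  have hTcomp : ∀ (μ : Measure (EuclideanSpace ℝ (Fin d))) (f : EuclideanSpace ℝ (Fin d) → ℂ),
      Tendsto (fun n => eLpNorm (U n - f) 2 μ) atTop (𝓝 0) →
      Tendsto (fun n => eLpNorm ((fun x => T (U (ns n) x)) - fun x => T (f x)) 2 μ)
        atTop (𝓝 0) := by
    intro μ f hf
    have h1 := ENNReal.Tendsto.const_mul (hf.comp hsub) (a := (L : ℝ≥0∞))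
      (Or.inr ENNReal.coe_ne_top)
    rw [mul_zero] at h1
    refine tendsto_of_tendsto_of_tendsto_of_le_of_le tendsto_const_nhds h1
      (fun n => zero_le) fun n => ?_
    refine eLpNorm_le_nnreal_smul_eLpNorm_of_ae_le_mul (Eventually.of_forall fun x => ?_) 2
    have := hTL.dist_le_mul (U (ns n) x) (f x)
    rwa [dist_eq_norm, dist_eq_norm] at this
  have hgrad : Tendsto (fun n => eLpNorm ((fun x => chainGrad T (U (ns n) x) (DU (ns n) x)) -
      fun x => chainGrad T (u x) (Du x)) 2 (volume.restrict Ω)) atTop (𝓝 0) := by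
    -- With the gradient frozen at Du, only the base point of DT varies, and dominated convergence
    -- applies. The other half of the splitting is linear in DU - Du and controlled by L.
    have h1 : Tendsto (fun n => eLpNorm ((fun x => chainGrad T (U (ns n) x) (Du x)) -
        fun x => chainGrad T (u x) (Du x)) 2 (volume.restrict Ω)) atTop (𝓝 0) := by
      refine tendsto_eLpNorm_two_of_dominated (C := L + L) (fun n => ?_) hu.isH1.memLp_grad
        (fun n x => ?_) ?_
      · exact ((memLp_chainGrad hT hTL (hU (ns n)).2.memLp.1 hu.isH1.memLp_grad).sub
          (memLp_chainGrad hT hTL hu.isH1.memLp.1 hu.isH1.memLp_grad)).1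
      · refine (norm_sub_le _ _).trans ?_
        push_cast
        rw [add_mul]
        exact add_le_add (norm_chainGrad_le hTL _ _) (norm_chainGrad_le hTL _ _)
      · filter_upwards [hae] with x hx
        have h2 : Continuous fun z => chainGrad T z (Du x) :=
          (continuous_chainGrad hT).comp (continuous_id.prodMk continuous_const)
        have h3 := ((h2.tendsto _).comp hx).sub_const (chainGrad T (u x) (Du x))
        rw [sub_self] at h3
        exact h3
    have h2 := ENNReal.Tendsto.const_mul (hDUu.comp hsub) (a := (L : ℝ≥0∞))
      (Or.inr ENNReal.coe_ne_top)
    rw [mul_zero] at h2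
    have h3 := h2.add h1
    rw [add_zero] at h3
    refine tendsto_of_tendsto_of_tendsto_of_le_of_le tendsto_const_nhds h3
      (fun n => zero_le) fun n => ?_
    have hm1 := (memLp_chainGrad hT hTL (hU (ns n)).2.memLp.1 (hU (ns n)).2.memLp_grad).1
    have hm2 := (memLp_chainGrad hT hTL (hU (ns n)).2.memLp.1 hu.isH1.memLp_grad).1
    have hm3 := (memLp_chainGrad hT hTL hu.isH1.memLp.1 hu.isH1.memLp_grad).1
    have h4 := eLpNorm_add_le (p := 2) (hm1.sub hm2) (hm2.sub hm3) (by norm_num)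
    rw [sub_add_sub_cancel] at h4
    refine h4.trans (add_le_add ?_ le_rfl)
    refine eLpNorm_le_nnreal_smul_eLpNorm_of_ae_le_mul (Eventually.of_forall fun x => ?_) 2
    simp only [Pi.sub_apply]
    rw [← chainGrad_sub]
    exact norm_chainGrad_le hTL _ _
  have hUn : ∀ n, ContinuousOn (fun x => T (U (ns n) x)) (closure Ω) ∧
      IsH1 Ω (fun x => T (U (ns n) x)) (fun x => chainGrad T (U (ns n) x) (DU (ns n) x)) :=
    fun n => ⟨hT.continuous.comp_continuousOn (hU (ns n)).1,
      isH1_comp_of_continuousOn hΩ hbdd (hU (ns n)).1 (hU (ns n)).2 hT hTL hT0⟩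
  exact ⟨isH1_of_tendsto (fun n => (hUn n).2) (hTL.comp_memLp hT0 hu.isH1.memLp)
    (memLp_chainGrad hT hTL hu.isH1.memLp.1 hu.isH1.memLp_grad) (hTcomp _ _ hUu) hgrad,
    hTL.comp_memLp hT0 hu.memLp_trace, _, _, hUn, hTcomp _ _ hUu, hgrad, hTcomp _ _ hUφ⟩

/-! ### Exponents and three-factor Hölder inequality. -/

theorem exists_subcritical_exponent {κ : ℝ} (hκ : 1 ≤ κ) {p : ℝ≥0∞} (hp : ENNReal.ofReal κ < p) :
    ∃ p₀ r : ℝ, 1 < p₀ ∧ ENNReal.ofReal p₀ ≤ p ∧ 2 ≤ r ∧ r * (κ - 1) < 2 * κ ∧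
      2 < r * (1 - 1 / p₀) := by
  obtain ⟨p₀, hp₀, h1, h2⟩ := ENNReal.lt_iff_exists_real_btwn.1 hp
  have hκp : κ < p₀ := (ENNReal.ofReal_lt_ofReal_iff_of_nonneg (by linarith)).1 h1
  have h3 : 0 < (κ + p₀) / 2 - 1 := by linarith
  have hp0 : 0 < p₀ := by linarith
  -- Here r = 2t/(t-1) with t the midpoint of κ and p₀. As t > κ, r is strictly below the critical
  -- value 2κ/(κ-1) (when κ > 1); as t < p₀, it satisfies r(1 - 1/p₀) > 2. The applications take κ =
  -- d/2 in Ω and κ = d-1 on Γ.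
  refine ⟨p₀, 2 * ((κ + p₀) / 2) / ((κ + p₀) / 2 - 1), by linarith, h2.le, ?_, ?_, ?_⟩
  · rw [le_div_iff₀ h3]; linarith
  · rw [div_mul_eq_mul_div, div_lt_iff₀ h3]; nlinarith
  · rw [div_mul_eq_mul_div, lt_div_iff₀ h3]
    have h4 : p₀ * (1 - 1 / p₀) = p₀ - 1 := by field_simp
    have h5 : p₀ * (2 * ((κ + p₀) / 2 - 1)) < p₀ * (2 * ((κ + p₀) / 2) * (1 - 1 / p₀)) := by
      calc p₀ * (2 * ((κ + p₀) / 2 - 1)) < 2 * ((κ + p₀) / 2) * (p₀ - 1) := by nlinarith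
        _ = 2 * ((κ + p₀) / 2) * (p₀ * (1 - 1 / p₀)) := by rw [h4]
        _ = _ := by ring
    exact lt_of_mul_lt_mul_left h5 hp0.le

theorem setLIntegral_mul_le_rpow_measure {α : Type*} [MeasurableSpace α] {μ : Measure α}
    {f w : α → ℂ} (hf : AEStronglyMeasurable f μ) (hw : AEStronglyMeasurable w μ) {p₀ r : ℝ}
    (hp₀ : 0 < p₀) (hr : 0 < r) (hpr : 1 / p₀ + 1 / r ≤ 1) (A : Set α) :
    ∫⁻ x in A, ‖f x‖ₑ * ‖w x‖ₑ ∂μ ≤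
      eLpNorm f (ENNReal.ofReal p₀) μ * eLpNorm w (ENNReal.ofReal r) μ *
        μ A ^ (1 - 1 / p₀ - 1 / r) := by
  have hsum : 0 < 1 / p₀ + 1 / r := by positivity
  let t : ℝ := 1 / (1 / p₀ + 1 / r)
  have ht0 : 0 < t := by positivity
  have ht1 : 1 ≤ t := by rw [le_div_iff₀ hsum]; linarith
  have htinv : 1 / t = 1 / p₀ + 1 / r := by simp [t]
  have htriple : ENNReal.HolderTriple (ENNReal.ofReal p₀) (ENNReal.ofReal r)
      (ENNReal.ofReal t) := by
    refine ⟨?_⟩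
    rw [← ENNReal.ofReal_inv_of_pos hp₀, ← ENNReal.ofReal_inv_of_pos hr,
      ← ENNReal.ofReal_inv_of_pos ht0, ← ENNReal.ofReal_add (by positivity) (by positivity)]
    simp only [one_div] at htinv
    rw [htinv]
  have h1 : ∫⁻ x in A, ‖f x‖ₑ * ‖w x‖ₑ ∂μ = eLpNorm (f • w) 1 (μ.restrict A) := by
    rw [eLpNorm_one_eq_lintegral_enorm]
    refine lintegral_congr fun x => ?_
    simp [enorm_mul]
  rw [h1]
  have h2 := eLpNorm_le_eLpNorm_mul_rpow_measure_univ (μ := μ.restrict A) (p := 1)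
    (q := ENNReal.ofReal t) (f := f • w) (by simpa using ENNReal.ofReal_le_ofReal ht1)
    (hf.restrict.smul hw.restrict)
  refine h2.trans ?_
  rw [Measure.restrict_apply_univ, ENNReal.toReal_ofReal ht0.le, ENNReal.toReal_one, htinv,
    show 1 / 1 - (1 / p₀ + 1 / r) = 1 - 1 / p₀ - 1 / r by ring]
  gcongr
  refine (eLpNorm_smul_le_mul_eLpNorm (p := ENNReal.ofReal p₀) (q := ENNReal.ofReal r)
    hw.restrict hf.restrict).trans ?_
  exact mul_le_mul' (eLpNorm_mono_measure _ Measure.restrict_le_self)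
    (eLpNorm_mono_measure _ Measure.restrict_le_self)

theorem memLp_surfaceMeasure_of_continuousOn {d : ℕ} {Ω : Set (EuclideanSpace ℝ (Fin d))}
    (hbdd : Bornology.IsBounded Ω) [IsFiniteMeasure (surfaceMeasure Ω)]
    {U : EuclideanSpace ℝ (Fin d) → ℂ} (hU : ContinuousOn U (closure Ω)) (p : ℝ≥0∞) :
    MemLp U p (surfaceMeasure Ω) := by
  have hcomp : IsCompact (closure Ω) :=
    Metric.isCompact_of_isClosed_isBounded isClosed_closure hbdd.closure
  obtain ⟨M, hM⟩ := hcomp.exists_bound_of_continuousOn hU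
  refine MemLp.of_bound (aestronglyMeasurable_surfaceMeasure hU) M ?_
  exact (ae_restrict_iff' isClosed_frontier.measurableSet).2
    (Eventually.of_forall fun x hx => hM x (frontier_subset_closure hx))

/-! ### The form as a bounded coercive operator on the Hilbert space of triples. -/

theorem FormCoercive.mono {d : ℕ} {Ω : Set (EuclideanSpace ℝ (Fin d))}
    {β : EuclideanSpace ℝ (Fin d) → ℂ} {ω₀ lam : ℝ} (h : FormCoercive Ω β ω₀) (hlam : ω₀ ≤ lam) :
    FormCoercive Ω β lam := by
  obtain ⟨α, hα, hco⟩ := h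
  refine ⟨α, hα, fun v Dv ψ hv => (hco v Dv ψ hv).trans ?_⟩
  have hnn : ∀ (μ : Measure (EuclideanSpace ℝ (Fin d))) (w : EuclideanSpace ℝ (Fin d) → ℂ),
      0 ≤ (∫ x, w x * conj (w x) ∂μ).re := by
    intro μ w
    have : (fun x => w x * conj (w x)) = fun x => ((‖w x‖ ^ 2 : ℝ) : ℂ) := by
      funext x
      rw [Complex.mul_conj, Complex.normSq_eq_norm_sq]
    rw [this, integral_complex_ofReal, Complex.ofReal_re]
    exact integral_nonneg fun x => by positivity
  have h1 := hnn (volume.restrict Ω) v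
  have h2 := hnn (surfaceMeasure Ω) ψ
  simp only [form, Complex.add_re, Complex.re_ofReal_mul]
  nlinarith [mul_le_mul_of_nonneg_right hlam (add_nonneg h1 h2)]

theorem IsH1.add {d : ℕ} {Ω : Set (EuclideanSpace ℝ (Fin d))}
    [IsFiniteMeasure (volume.restrict Ω)] {u v : EuclideanSpace ℝ (Fin d) → ℂ}
    {Du Dv : EuclideanSpace ℝ (Fin d) → EuclideanSpace ℂ (Fin d)}
    (hu : IsH1 Ω u Du) (hv : IsH1 Ω v Dv) : IsH1 Ω (u + v) (Du + Dv) := by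
  refine ⟨hu.memLp.add hv.memLp, hu.memLp_grad.add hv.memLp_grad, fun η hη hηc hηΩ i => ?_⟩
  have hdc : Continuous fun x => fderiv ℝ η x (EuclideanSpace.single i 1) :=
    (hη.continuous_fderiv (by simp)).clm_apply continuous_const
  obtain ⟨M₁, hM₁⟩ := hdc.bounded_above_of_compact_support
    (hηc.fderiv_apply (𝕜 := ℝ) (EuclideanSpace.single i 1))
  obtain ⟨M₂, hM₂⟩ := hη.continuous.bounded_above_of_compact_support hηc
  have h1 : ∀ {w : EuclideanSpace ℝ (Fin d) → ℂ}, MemLp w 2 (volume.restrict Ω) →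
      Integrable (fun x => w x * ((fderiv ℝ η x (EuclideanSpace.single i 1) : ℝ) : ℂ))
        (volume.restrict Ω) := fun hw =>
    (hw.integrable (by norm_num)).mul_bdd (c := M₁)
      (Complex.continuous_ofReal.comp hdc).aestronglyMeasurable
      (Eventually.of_forall fun x => by simpa using hM₁ x)
  have h2 : ∀ {f : EuclideanSpace ℝ (Fin d) → EuclideanSpace ℂ (Fin d)},
      MemLp f 2 (volume.restrict Ω) →
      Integrable (fun x => f x i * ((η x : ℝ) : ℂ)) (volume.restrict Ω) := fun hf =>
    (((EuclideanSpace.proj i : EuclideanSpace ℂ (Fin d) →L[ℂ] ℂ).comp_memLp' hf).integrable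
      (by norm_num)).mul_bdd (c := M₂)
      (Complex.continuous_ofReal.comp hη.continuous).aestronglyMeasurable
      (Eventually.of_forall fun x => by simpa using hM₂ x)
  simp only [Pi.add_apply, PiLp.add_apply, add_mul]
  rw [integral_add (h1 hu.memLp) (h1 hv.memLp), integral_add (h2 hu.memLp_grad) (h2 hv.memLp_grad),
    hu.weak_grad η hη hηc hηΩ i, hv.weak_grad η hη hηc hηΩ i]
  ring

theorem IsH1.const_smul {d : ℕ} {Ω : Set (EuclideanSpace ℝ (Fin d))}
    {u : EuclideanSpace ℝ (Fin d) → ℂ}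
    {Du : EuclideanSpace ℝ (Fin d) → EuclideanSpace ℂ (Fin d)}
    (hu : IsH1 Ω u Du) (c : ℂ) : IsH1 Ω (c • u) (c • Du) := by
  refine ⟨hu.memLp.const_smul c, hu.memLp_grad.const_smul c, fun η hη hηc hηΩ i => ?_⟩
  simp only [Pi.smul_apply, PiLp.smul_apply, smul_eq_mul, mul_assoc]
  rw [integral_const_mul, integral_const_mul, hu.weak_grad η hη hηc hηΩ i]
  ring

theorem isH1_zero {d : ℕ} (Ω : Set (EuclideanSpace ℝ (Fin d))) : IsH1 Ω 0 0 :=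
  ⟨MemLp.zero, MemLp.zero, fun η _ _ _ i => by simp⟩

/-- The Hilbert space `L²(Ω) × L²(Ω; ℂᵈ) × L²(Γ)`. -/
abbrev TraceSpace {d : ℕ} (Ω : Set (EuclideanSpace ℝ (Fin d))) : Type :=
  WithLp 2 (Lp ℂ 2 (volume.restrict Ω) ×
    WithLp 2 (Lp (EuclideanSpace ℂ (Fin d)) 2 (volume.restrict Ω) × Lp ℂ 2 (surfaceMeasure Ω)))

/-- The subspace of `L²(Ω) × L²(Ω; ℂᵈ) × L²(Γ)` of triples `(U, ∇U, U|Γ)` with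
`U ∈ C(closure Ω) ∩ H¹(Ω)`. -/
def continuousTriples {d : ℕ} (Ω : Set (EuclideanSpace ℝ (Fin d)))
    [IsFiniteMeasure (volume.restrict Ω)] : Submodule ℂ (TraceSpace Ω) where
  carrier := {P | ∃ U DU, ContinuousOn U (closure Ω) ∧ IsH1 Ω U DU ∧
    P.fst =ᵐ[volume.restrict Ω] U ∧ P.snd.fst =ᵐ[volume.restrict Ω] DU ∧
    P.snd.snd =ᵐ[surfaceMeasure Ω] U}
  zero_mem' := ⟨0, 0, continuousOn_const, isH1_zero Ω, Lp.coeFn_zero _ _ _, Lp.coeFn_zero _ _ _,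
    Lp.coeFn_zero _ _ _⟩
  add_mem' := by
    rintro P Q ⟨U, DU, hU, hU', h1, h2, h3⟩ ⟨V, DV, hV, hV', k1, k2, k3⟩
    exact ⟨U + V, DU + DV, hU.add hV, hU'.add hV', (Lp.coeFn_add _ _).trans (h1.add k1),
      (Lp.coeFn_add _ _).trans (h2.add k2), (Lp.coeFn_add _ _).trans (h3.add k3)⟩
  smul_mem' := by
    rintro c P ⟨U, DU, hU, hU', h1, h2, h3⟩
    exact ⟨c • U, c • DU, hU.const_smul c, hU'.const_smul c,
      (Lp.coeFn_smul _ _).trans (h1.const_smul c),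
      (Lp.coeFn_smul _ _).trans (h2.const_smul c), (Lp.coeFn_smul _ _).trans (h3.const_smul c)⟩

/-- The Hilbert space of triples `(u, ∇u, u_Γ)` with `u ∈ H¹(Ω)`. -/
def traceTriples {d : ℕ} (Ω : Set (EuclideanSpace ℝ (Fin d)))
    [IsFiniteMeasure (volume.restrict Ω)] : Submodule ℂ (TraceSpace Ω) :=
  (continuousTriples Ω).topologicalClosure

/-- The triple `(u, ∇u, u_Γ)` as an element of `L²(Ω) × L²(Ω; ℂᵈ) × L²(Γ)`. -/
def HasTrace.toTriple {d : ℕ} {Ω : Set (EuclideanSpace ℝ (Fin d))}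
    {u : EuclideanSpace ℝ (Fin d) → ℂ}
    {Du : EuclideanSpace ℝ (Fin d) → EuclideanSpace ℂ (Fin d)}
    {φ : EuclideanSpace ℝ (Fin d) → ℂ} (hu : HasTrace Ω u Du φ) : TraceSpace Ω :=
  WithLp.toLp 2 (hu.isH1.memLp.toLp u,
    WithLp.toLp 2 (hu.isH1.memLp_grad.toLp Du, hu.memLp_trace.toLp φ))

theorem HasTrace.toTriple_mem {d : ℕ} {Ω : Set (EuclideanSpace ℝ (Fin d))}
    (hbdd : Bornology.IsBounded Ω) [IsFiniteMeasure (volume.restrict Ω)]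
    [IsFiniteMeasure (surfaceMeasure Ω)] {u : EuclideanSpace ℝ (Fin d) → ℂ}
    {Du : EuclideanSpace ℝ (Fin d) → EuclideanSpace ℂ (Fin d)}
    {φ : EuclideanSpace ℝ (Fin d) → ℂ} (hu : HasTrace Ω u Du φ) :
    hu.toTriple ∈ traceTriples Ω := by
  obtain ⟨U, DU, hU, hUu, hDUu, hUφ⟩ := hu.exists_approx
  have hUσ : ∀ n, MemLp (U n) 2 (surfaceMeasure Ω) := fun n =>
    memLp_surfaceMeasure_of_continuousOn hbdd (hU n).1 2
  let P : ℕ → TraceSpace Ω := fun n => WithLp.toLp 2 ((hU n).2.memLp.toLp (U n),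
    WithLp.toLp 2 ((hU n).2.memLp_grad.toLp (DU n), (hUσ n).toLp (U n)))
  have h1 := (Lp.tendsto_Lp_iff_tendsto_eLpNorm'' U (fun n => (hU n).2.memLp) u hu.isH1.memLp).2 hUu
  have h2 := (Lp.tendsto_Lp_iff_tendsto_eLpNorm'' DU (fun n => (hU n).2.memLp_grad) Du
    hu.isH1.memLp_grad).2 hDUu
  have h3 := (Lp.tendsto_Lp_iff_tendsto_eLpNorm'' U hUσ φ hu.memLp_trace).2 hUφ
  have hP : Tendsto P atTop (𝓝 hu.toTriple) := by
    refine ((WithLp.prod_continuous_toLp 2 _ _).tendsto _).comp (h1.prodMk_nhds ?_)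
    exact ((WithLp.prod_continuous_toLp 2 _ _).tendsto _).comp (h2.prodMk_nhds h3)
  refine mem_closure_of_tendsto hP (Eventually.of_forall fun n => ?_)
  exact ⟨U n, DU n, (hU n).1, (hU n).2, (hU n).2.memLp.coeFn_toLp,
    (hU n).2.memLp_grad.coeFn_toLp, (hUσ n).coeFn_toLp⟩

/-- The definition of a trace by approximation is sequential closure in the product of L² spaces,
and weak gradients survive L² limits. With `HasTrace.toTriple_mem` this identifies functions having
a trace with a closed subspace, hence a Hilbert space. -/
theorem hasTrace_of_mem_traceTriples {d : ℕ} {Ω : Set (EuclideanSpace ℝ (Fin d))}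
    [IsFiniteMeasure (volume.restrict Ω)] {P : TraceSpace Ω} (hP : P ∈ traceTriples Ω) :
    HasTrace Ω P.fst P.snd.fst P.snd.snd := by
  obtain ⟨Q, hQ, hQP⟩ := mem_closure_iff_seq_limit.1 hP
  choose U DU hU using hQ
  have hfst : Tendsto (fun n => (Q n).fst) atTop (𝓝 P.fst) :=
    ((continuous_fst.comp (WithLp.prod_continuous_ofLp 2 _ _)).tendsto _).comp hQP
  have hsnd : Tendsto (fun n => (Q n).snd) atTop (𝓝 P.snd) :=
    ((continuous_snd.comp (WithLp.prod_continuous_ofLp 2 _ _)).tendsto _).comp hQP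
  have hsf : Tendsto (fun n => (Q n).snd.fst) atTop (𝓝 P.snd.fst) :=
    ((continuous_fst.comp (WithLp.prod_continuous_ofLp 2 _ _)).tendsto _).comp hsnd
  have hss : Tendsto (fun n => (Q n).snd.snd) atTop (𝓝 P.snd.snd) :=
    ((continuous_snd.comp (WithLp.prod_continuous_ofLp 2 _ _)).tendsto _).comp hsnd
  have h1 : Tendsto (fun n => eLpNorm (U n - (P.fst : EuclideanSpace ℝ (Fin d) → ℂ)) 2 (volume.restrict Ω)) atTop (𝓝 0) := by
    refine ((Lp.tendsto_Lp_iff_tendsto_eLpNorm' _ _).1 hfst).congr fun n => ?_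
    exact eLpNorm_congr_ae ((hU n).2.2.1.sub EventuallyEq.rfl)
  have h2 : Tendsto (fun n => eLpNorm (DU n -
      (P.snd.fst : EuclideanSpace ℝ (Fin d) → EuclideanSpace ℂ (Fin d))) 2 (volume.restrict Ω)) atTop (𝓝 0) := by
    refine ((Lp.tendsto_Lp_iff_tendsto_eLpNorm' _ _).1 hsf).congr fun n => ?_
    exact eLpNorm_congr_ae ((hU n).2.2.2.1.sub EventuallyEq.rfl)
  have h3 : Tendsto (fun n => eLpNorm (U n - (P.snd.snd : EuclideanSpace ℝ (Fin d) → ℂ)) 2 (surfaceMeasure Ω)) atTop (𝓝 0) := by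
    refine ((Lp.tendsto_Lp_iff_tendsto_eLpNorm' _ _).1 hss).congr fun n => ?_
    exact eLpNorm_congr_ae ((hU n).2.2.2.2.sub EventuallyEq.rfl)
  exact ⟨isH1_of_tendsto (fun n => (hU n).2.1) (Lp.memLp _) (Lp.memLp _) h1 h2, Lp.memLp _,
    U, DU, fun n => ⟨(hU n).1, (hU n).2.1⟩, h1, h2, h3⟩

theorem toReal_eLpNorm_two_sq {α F : Type*} [MeasurableSpace α] {μ : Measure α}
    [NormedAddCommGroup F] {v : α → F} (hv : MemLp v 2 μ) :
    (eLpNorm v 2 μ).toReal ^ 2 = ∫ x, ‖v x‖ ^ 2 ∂μ := by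
  rw [hv.eLpNorm_eq_integral_rpow_norm two_ne_zero ENNReal.ofNat_ne_top,
    ENNReal.toReal_ofReal (by positivity), ← Real.rpow_natCast, ← Real.rpow_mul (by positivity)]
  simp

/-- Multiplication by an `L^∞` function on `L²`. -/
def mulL2 {α : Type*} [MeasurableSpace α] {μ : Measure α} {β : α → ℂ} (hβ : MemLp β ⊤ μ) :
    Lp ℂ 2 μ →L[ℂ] Lp ℂ 2 μ :=
  (ContinuousLinearMap.mul ℂ ℂ).holderL μ ⊤ 2 2 (hβ.toLp β)

theorem coeFn_mulL2 {α : Type*} [MeasurableSpace α] {μ : Measure α} {β : α → ℂ}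
    (hβ : MemLp β ⊤ μ) (f : Lp ℂ 2 μ) : mulL2 hβ f =ᵐ[μ] fun x => β x * f x := by
  have h1 := (ContinuousLinearMap.mul ℂ ℂ).coeFn_holder (r := 2) (hβ.toLp β) f
  refine EventuallyEq.trans h1 ?_
  filter_upwards [hβ.coeFn_toLp] with x hx
  simp [hx]

/-- The bounded operator on `L²(Ω) × L²(Ω; ℂᵈ) × L²(Γ)` representing the form `𝔞_λ`. -/
def formOp {d : ℕ} {Ω : Set (EuclideanSpace ℝ (Fin d))} {β : EuclideanSpace ℝ (Fin d) → ℂ}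
    (hβ : MemLp β ⊤ (surfaceMeasure Ω)) (lam : ℝ) : TraceSpace Ω →L[ℂ] TraceSpace Ω :=
  (WithLp.prodContinuousLinearEquiv 2 ℂ _ _).symm.toContinuousLinearMap ∘L
    (((lam : ℂ) • ContinuousLinearMap.id ℂ _).prodMap
      ((WithLp.prodContinuousLinearEquiv 2 ℂ _ _).symm.toContinuousLinearMap ∘L
        ((ContinuousLinearMap.id ℂ _).prodMap (mulL2 hβ + (lam : ℂ) • ContinuousLinearMap.id ℂ _))
        ∘L (WithLp.prodContinuousLinearEquiv 2 ℂ _ _).toContinuousLinearMap)) ∘L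
    (WithLp.prodContinuousLinearEquiv 2 ℂ _ _).toContinuousLinearMap

theorem inner_Lp_eq_integral {α : Type*} [MeasurableSpace α] {μ : Measure α} (f g : Lp ℂ 2 μ) :
    inner ℂ f g = ∫ x, g x * conj (f x) ∂μ := by
  rw [L2.inner_def]
  refine integral_congr_ae (Eventually.of_forall fun x => ?_)
  simp

theorem inner_formOp {d : ℕ} {Ω : Set (EuclideanSpace ℝ (Fin d))}
    {β : EuclideanSpace ℝ (Fin d) → ℂ}
    (hβ : MemLp β ⊤ (surfaceMeasure Ω)) (lam : ℝ) (P Q : TraceSpace Ω) :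
    inner ℂ Q (formOp hβ lam P) =
      form Ω β lam P.fst P.snd.fst P.snd.snd Q.fst Q.snd.fst Q.snd.snd := by
  have h1 : inner ℂ Q (formOp hβ lam P) = (lam : ℂ) * inner ℂ Q.fst P.fst +
      (inner ℂ Q.snd.fst P.snd.fst + (inner ℂ Q.snd.snd (mulL2 hβ P.snd.snd) +
        (lam : ℂ) * inner ℂ Q.snd.snd P.snd.snd)) := by
    rw [← inner_smul_right, ← inner_smul_right, ← inner_add_right]
    rfl
  have h2 : inner ℂ Q.snd.fst P.snd.fst =
      ∫ x in Ω, ∑ i, P.snd.fst x i * conj (Q.snd.fst x i) := by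
    rw [L2.inner_def]
    refine integral_congr_ae (Eventually.of_forall fun x => ?_)
    simp [PiLp.inner_apply]
  have h3 : inner ℂ Q.snd.snd (mulL2 hβ P.snd.snd) =
      ∫ z, β z * P.snd.snd z * conj (Q.snd.snd z) ∂(surfaceMeasure Ω) := by
    rw [inner_Lp_eq_integral]
    refine integral_congr_ae ?_
    filter_upwards [coeFn_mulL2 hβ P.snd.snd] with x hx
    rw [hx]
  rw [h1, h2, h3, inner_Lp_eq_integral, inner_Lp_eq_integral, form]
  ring

theorem form_congr_ae {d : ℕ} {Ω : Set (EuclideanSpace ℝ (Fin d))}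
    {β : EuclideanSpace ℝ (Fin d) → ℂ} {lam : ℝ}
    {u u' v v' φ φ' ψ ψ' : EuclideanSpace ℝ (Fin d) → ℂ}
    {Du Du' Dv Dv' : EuclideanSpace ℝ (Fin d) → EuclideanSpace ℂ (Fin d)}
    (hu : u =ᵐ[volume.restrict Ω] u') (hDu : Du =ᵐ[volume.restrict Ω] Du')
    (hφ : φ =ᵐ[surfaceMeasure Ω] φ') (hv : v =ᵐ[volume.restrict Ω] v')
    (hDv : Dv =ᵐ[volume.restrict Ω] Dv') (hψ : ψ =ᵐ[surfaceMeasure Ω] ψ') :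
    form Ω β lam u Du φ v Dv ψ = form Ω β lam u' Du' φ' v' Dv' ψ' := by
  unfold form
  congr 1
  · congr 1
    · refine integral_congr_ae ?_
      filter_upwards [hDu, hDv] with x h1 h2
      rw [h1, h2]
    · refine integral_congr_ae ?_
      filter_upwards [hφ, hψ] with x h1 h2
      rw [h1, h2]
  · congr 2
    · refine integral_congr_ae ?_
      filter_upwards [hu, hv] with x h1 h2
      rw [h1, h2]
    · refine integral_congr_ae ?_
      filter_upwards [hφ, hψ] with x h1 h2
      rw [h1, h2]

theorem inner_toTriple_formOp {d : ℕ} {Ω : Set (EuclideanSpace ℝ (Fin d))}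
    {β : EuclideanSpace ℝ (Fin d) → ℂ} (hβ : MemLp β ⊤ (surfaceMeasure Ω)) (lam : ℝ)
    {u v φ ψ : EuclideanSpace ℝ (Fin d) → ℂ}
    {Du Dv : EuclideanSpace ℝ (Fin d) → EuclideanSpace ℂ (Fin d)}
    (hu : HasTrace Ω u Du φ) (hv : HasTrace Ω v Dv ψ) :
    inner ℂ hv.toTriple (formOp hβ lam hu.toTriple) = form Ω β lam u Du φ v Dv ψ := by
  rw [inner_formOp]
  exact form_congr_ae hu.isH1.memLp.coeFn_toLp hu.isH1.memLp_grad.coeFn_toLp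
    hu.memLp_trace.coeFn_toLp hv.isH1.memLp.coeFn_toLp hv.isH1.memLp_grad.coeFn_toLp
    hv.memLp_trace.coeFn_toLp

theorem norm_sq_traceSpace {d : ℕ} {Ω : Set (EuclideanSpace ℝ (Fin d))} (P : TraceSpace Ω) :
    ‖P‖ ^ 2 = ‖P.fst‖ ^ 2 + (‖P.snd.fst‖ ^ 2 + ‖P.snd.snd‖ ^ 2) := by
  rw [WithLp.prod_norm_sq_eq_of_L2, WithLp.prod_norm_sq_eq_of_L2]

/-- The hypothesis controls only the H¹ norm, whereas the norm of a triple includes its trace. The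
trace inequality with s = 2 bounds the trace part by 2C² times the rest, whence the constant α/(1 +
2C²). -/
theorem exists_coercive_formOp {d : ℕ} (hd : 2 ≤ d) {Ω : Set (EuclideanSpace ℝ (Fin d))}
    (hΩ : IsOpen Ω) (hbdd : Bornology.IsBounded Ω) (hlip : HasLipschitzBoundary Ω)
    [IsFiniteMeasure (volume.restrict Ω)]
    {β : EuclideanSpace ℝ (Fin d) → ℂ} (hβ : MemLp β ⊤ (surfaceMeasure Ω)) {lam : ℝ}
    (hco : FormCoercive Ω β lam) :
    ∃ c : ℝ≥0, 0 < c ∧ ∀ P ∈ traceTriples Ω, ‖P‖ ^ 2 * c ≤ (inner ℂ P (formOp hβ lam P)).re := by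
  obtain ⟨α, hα, hco⟩ := hco
  obtain ⟨C, hC⟩ := exists_eLpNorm_le_of_hasTrace hd hΩ hbdd hlip (r := 2) (s := 2) le_rfl
    (by linarith) le_rfl (by linarith)
  have hc : 0 < α / (1 + 2 * (C : ℝ) ^ 2) := by positivity
  refine ⟨⟨_, hc.le⟩, hc, fun P hP => ?_⟩
  have hT := hasTrace_of_mem_traceTriples hP
  have h1 := hco _ _ _ hT
  have h2 := (hC _ _ _ hT).2
  rw [inner_formOp]
  refine le_trans ?_ h1
  rw [← toReal_eLpNorm_two_sq hT.isH1.memLp, ← toReal_eLpNorm_two_sq hT.isH1.memLp_grad,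
    ← Lp.norm_def, ← Lp.norm_def, norm_sq_traceSpace]
  have h3 : ‖P.snd.snd‖ ≤ C * (‖P.fst‖ + ‖P.snd.fst‖) := by
    rw [Lp.norm_def, Lp.norm_def, Lp.norm_def]
    rw [ENNReal.ofReal_ofNat] at h2
    have h4 := ENNReal.toReal_mono (ENNReal.mul_ne_top ENNReal.coe_ne_top
      (ENNReal.add_ne_top.2 ⟨hT.isH1.memLp.2.ne, hT.isH1.memLp_grad.2.ne⟩)) h2
    rwa [ENNReal.toReal_mul, ENNReal.toReal_add hT.isH1.memLp.2.ne hT.isH1.memLp_grad.2.ne] at h4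
  have h5 : ‖P.snd.snd‖ ^ 2 ≤ 2 * (C : ℝ) ^ 2 * (‖P.fst‖ ^ 2 + ‖P.snd.fst‖ ^ 2) := by
    calc ‖P.snd.snd‖ ^ 2 ≤ (C * (‖P.fst‖ + ‖P.snd.fst‖)) ^ 2 := by gcongr
      _ = (C : ℝ) ^ 2 * (‖P.fst‖ + ‖P.snd.fst‖) ^ 2 := by ring
      _ ≤ (C : ℝ) ^ 2 * (2 * (‖P.fst‖ ^ 2 + ‖P.snd.fst‖ ^ 2)) := by
          gcongr; nlinarith [sq_nonneg (‖P.fst‖ - ‖P.snd.fst‖)]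
      _ = _ := by ring
  change _ * (α / (1 + 2 * (C : ℝ) ^ 2)) ≤ _
  rw [mul_div_assoc', div_le_iff₀ (by positivity)]
  nlinarith

theorem HasTrace.toTriple_coeFn {d : ℕ} {Ω : Set (EuclideanSpace ℝ (Fin d))} {P : TraceSpace Ω}
    (h : HasTrace Ω P.fst P.snd.fst P.snd.snd) : h.toTriple = P := by
  simp only [HasTrace.toTriple, Lp.toLp_coeFn]
  rfl

/-- The difference of the two triples is an admissible test function and is annihilated by the form,
so coercivity kills it. Gradient and trace are carried along in the triple, so those of the two
solutions need not be matched beforehand. -/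
theorem isWeakSolution_unique {d : ℕ} (hd : 2 ≤ d) {Ω : Set (EuclideanSpace ℝ (Fin d))}
    (hΩ : IsOpen Ω) (hbdd : Bornology.IsBounded Ω) (hlip : HasLipschitzBoundary Ω)
    {β : EuclideanSpace ℝ (Fin d) → ℂ} (hβ : MemLp β ⊤ (surfaceMeasure Ω)) {lam : ℝ}
    (hco : FormCoercive Ω β lam) {f g u₁ u₂ : EuclideanSpace ℝ (Fin d) → ℂ}
    (h₁ : IsWeakSolution Ω β lam f g u₁) (h₂ : IsWeakSolution Ω β lam f g u₂) :
    u₁ =ᵐ[volume.restrict Ω] u₂ := by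
  have hfin : IsFiniteMeasure (volume.restrict Ω) := ⟨by
    rw [Measure.restrict_apply_univ]; exact hbdd.measure_lt_top⟩
  have hfinσ := isFiniteMeasure_surfaceMeasure hd hΩ hbdd hlip
  obtain ⟨c, hc, hcoer⟩ := exists_coercive_formOp hd hΩ hbdd hlip hβ hco
  obtain ⟨Du₁, φ₁, hu₁, hs₁⟩ := h₁
  obtain ⟨Du₂, φ₂, hu₂, hs₂⟩ := h₂
  have hmem : hu₁.toTriple - hu₂.toTriple ∈ traceTriples Ω :=
    Submodule.sub_mem _ (hu₁.toTriple_mem hbdd) (hu₂.toTriple_mem hbdd)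
  have hv := hasTrace_of_mem_traceTriples hmem
  have h3 : inner ℂ hv.toTriple (formOp hβ lam (hu₁.toTriple - hu₂.toTriple)) = 0 := by
    rw [map_sub, inner_sub_right, inner_toTriple_formOp, inner_toTriple_formOp, hs₁ _ _ _ hv,
      hs₂ _ _ _ hv, sub_self]
  have h4 : hv.toTriple = hu₁.toTriple - hu₂.toTriple := hv.toTriple_coeFn
  rw [h4] at h3
  have h5 := hcoer _ hmem
  rw [h3, Complex.zero_re] at h5
  have h6 : ‖hu₁.toTriple - hu₂.toTriple‖ = 0 := by
    have hc' : (0 : ℝ) < c := hc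
    by_contra hne
    have : 0 < ‖hu₁.toTriple - hu₂.toTriple‖ := lt_of_le_of_ne (norm_nonneg _) (Ne.symm hne)
    have : 0 < ‖hu₁.toTriple - hu₂.toTriple‖ ^ 2 * c := by positivity
    linarith
  have h7 : hu₁.toTriple = hu₂.toTriple := sub_eq_zero.1 (norm_eq_zero.1 h6)
  have h8 : hu₁.isH1.memLp.toLp u₁ = hu₂.isH1.memLp.toLp u₂ := congrArg (fun P => P.fst) h7
  exact (MemLp.toLp_eq_toLp_iff _ _).1 h8

/-! ### Lax–Milgram and existence for data in L^p(Ω) and L^q(Γ). -/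

/-- Complex Lax-Milgram on a closed subspace. -/
theorem exists_inner_eq_of_coercive {H : Type*} [NormedAddCommGroup H] [InnerProductSpace ℂ H]
    [CompleteSpace H] (V : Submodule ℂ H) (hV : IsClosed (V : Set H)) (A : H →L[ℂ] H) {c : ℝ≥0}
    (hc : 0 < c) (hA : ∀ P ∈ V, ‖P‖ ^ 2 * c ≤ (inner ℂ P (A P)).re) (F : V →L[ℂ] ℂ) :
    ∃ P ∈ V, ∀ Q : V, inner ℂ (Q : H) (A P) = conj (F Q) := by
  have : CompleteSpace V := hV.completeSpace_coe
  -- Compressing A to V by orthogonal projection does not change inner products with elements of V;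
  -- the compression is invertible by coercivity, and Riesz representation supplies the vector to
  -- invert on.
  let AV : V →L[ℂ] V := V.orthogonalProjectionOnto ∘L A ∘L V.subtypeL
  have hAV : ∀ P Q : V, inner ℂ (AV P) Q = inner ℂ (A P) (Q : H) := fun P Q =>
    Submodule.inner_orthogonalProjectionOnto_eq_of_mem_right Q (A P)
  have hunit : IsUnit AV := by
    refine ContinuousLinearMap.isUnit_of_forall_le_norm_inner_map AV hc fun P => ?_
    rw [hAV]
    refine (hA P P.2).trans ?_
    rw [← inner_conj_symm, Complex.conj_re]
    exact Complex.re_le_norm _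
  obtain ⟨B, hB⟩ := hunit.exists_right_inv
  let w : V := (InnerProductSpace.toDual ℂ V).symm F
  refine ⟨B w, (B w).2, fun Q => ?_⟩
  rw [← inner_conj_symm, ← hAV]
  have h1 : AV (B w) = w := congrArg (fun T : V →L[ℂ] V => T w) hB
  rw [h1, InnerProductSpace.toDual_symm_apply]

/-- Hölder leaves the exponent a = 1 - 1/p₀ - 1/r on μ(A), and the choice of r gives ra = r(1 -
1/p₀) - 1 > 1. This strict inequality is what makes the level-set recursion superlinear. -/
theorem exists_setLIntegral_mul_le {α : Type*} [MeasurableSpace α] {μ : Measure α}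
    [IsFiniteMeasure μ] {κ : ℝ} (hκ : 1 ≤ κ) {p : ℝ≥0∞} (hp : ENNReal.ofReal κ < p) :
    ∃ (r a : ℝ) (K : ℝ≥0), 2 ≤ r ∧ r * (κ - 1) < 2 * κ ∧ 1 < r * a ∧
      ∀ f w : α → ℂ, AEStronglyMeasurable f μ → AEStronglyMeasurable w μ → ∀ A : Set α,
        ∫⁻ x in A, ‖f x‖ₑ * ‖w x‖ₑ ∂μ ≤
          K * eLpNorm f p μ * eLpNorm w (ENNReal.ofReal r) μ * μ A ^ a := by
  obtain ⟨p₀, r, hp₀, hp₀p, hr, hrκ, hrp⟩ := exists_subcritical_exponent hκ hp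
  have hr0 : 0 < r := by linarith
  have hra : r * (1 - 1 / p₀ - 1 / r) = r * (1 - 1 / p₀) - 1 := by field_simp
  have ha : 1 / p₀ + 1 / r ≤ 1 := by
    by_contra hlt
    have : r * (1 - 1 / p₀ - 1 / r) < 0 := mul_neg_of_pos_of_neg hr0 (by linarith)
    linarith
  have hexp : 0 ≤ 1 / (ENNReal.ofReal p₀).toReal - 1 / p.toReal := by
    rcases eq_or_ne p ⊤ with rfl | hpt
    · simp
    · rw [sub_nonneg]
      refine one_div_le_one_div_of_le ?_ (ENNReal.toReal_mono hpt hp₀p)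
      rw [ENNReal.toReal_ofReal] <;> linarith
  have hK : μ univ ^ (1 / (ENNReal.ofReal p₀).toReal - 1 / p.toReal) ≠ ⊤ :=
    ENNReal.rpow_ne_top_of_nonneg hexp (measure_ne_top _ _)
  refine ⟨r, 1 - 1 / p₀ - 1 / r,
    (μ univ ^ (1 / (ENNReal.ofReal p₀).toReal - 1 / p.toReal)).toNNReal, hr, hrκ, by rw [hra]; linarith, fun f w hf hw A =>
    (setLIntegral_mul_le_rpow_measure hf hw (by linarith) hr0 ha A).trans ?_⟩
  rw [ENNReal.coe_toNNReal hK, mul_comm (μ univ ^ _)]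
  gcongr
  exact eLpNorm_le_eLpNorm_mul_rpow_measure_univ hp₀p hf

/-- The Hölder and Sobolev inequalities in `Ω` and on `Γ`, with exponents adapted to data in
`L^p(Ω)` and `L^q(Γ)`. -/
theorem exists_holder_sobolev {d : ℕ} (hd : 2 ≤ d) {Ω : Set (EuclideanSpace ℝ (Fin d))}
    (hΩ : IsOpen Ω) (hbdd : Bornology.IsBounded Ω) (hlip : HasLipschitzBoundary Ω)
    [IsFiniteMeasure (volume.restrict Ω)] [IsFiniteMeasure (surfaceMeasure Ω)]
    {p q : ℝ≥0∞} (hp : (d : ℝ≥0∞) / 2 < p) (hq : (d : ℝ≥0∞) - 1 < q) :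
    ∃ (r a s b : ℝ) (K : ℝ≥0), 2 ≤ r ∧ 1 < r * a ∧ 2 ≤ s ∧ 1 < s * b ∧
      ∀ w Dw ψ, HasTrace Ω w Dw ψ →
        eLpNorm w (ENNReal.ofReal r) (volume.restrict Ω) ≤
          K * (eLpNorm w 2 (volume.restrict Ω) + eLpNorm Dw 2 (volume.restrict Ω)) ∧
        eLpNorm ψ (ENNReal.ofReal s) (surfaceMeasure Ω) ≤
          K * (eLpNorm w 2 (volume.restrict Ω) + eLpNorm Dw 2 (volume.restrict Ω)) ∧
        (∀ f : EuclideanSpace ℝ (Fin d) → ℂ, AEStronglyMeasurable f (volume.restrict Ω) → ∀ A,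
          ∫⁻ x in A, ‖f x‖ₑ * ‖w x‖ₑ ∂(volume.restrict Ω) ≤
            K * eLpNorm f p (volume.restrict Ω) *
              (eLpNorm w 2 (volume.restrict Ω) + eLpNorm Dw 2 (volume.restrict Ω)) *
                volume.restrict Ω A ^ a) ∧
        (∀ g : EuclideanSpace ℝ (Fin d) → ℂ, AEStronglyMeasurable g (surfaceMeasure Ω) → ∀ A,
          ∫⁻ x in A, ‖g x‖ₑ * ‖ψ x‖ₑ ∂(surfaceMeasure Ω) ≤
            K * eLpNorm g q (surfaceMeasure Ω) *
              (eLpNorm w 2 (volume.restrict Ω) + eLpNorm Dw 2 (volume.restrict Ω)) *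
                surfaceMeasure Ω A ^ b) := by
  have hd' : (2 : ℝ) ≤ d := by exact_mod_cast hd
  have hp' : ENNReal.ofReal ((d : ℝ) / 2) < p := by
    rwa [ENNReal.ofReal_div_of_pos two_pos, ENNReal.ofReal_natCast, ENNReal.ofReal_ofNat]
  have hq' : ENNReal.ofReal ((d : ℝ) - 1) < q := by
    rwa [ENNReal.ofReal_sub _ zero_le_one, ENNReal.ofReal_natCast, ENNReal.ofReal_one]
  obtain ⟨r, a, K₁, hr, hrd, hra, h₁⟩ :=
    exists_setLIntegral_mul_le (μ := volume.restrict Ω) (by linarith) hp'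
  obtain ⟨s, b, K₂, hs, hsd, hsb, h₂⟩ :=
    exists_setLIntegral_mul_le (μ := surfaceMeasure Ω) (by linarith) hq'
  obtain ⟨C, hC⟩ := exists_eLpNorm_le_of_hasTrace hd hΩ hbdd hlip hr (by linarith) hs (by linarith)
  refine ⟨r, a, s, b, max C (max (K₁ * C) (K₂ * C)), hr, hra, hs, hsb, fun w Dw ψ hw => ?_⟩
  obtain ⟨h3, h4⟩ := hC w Dw ψ hw
  have hle1 : (C : ℝ≥0∞) ≤ (max C (max (K₁ * C) (K₂ * C)) : ℝ≥0) :=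
    ENNReal.coe_le_coe.2 (le_max_left _ _)
  have hle2 : (K₁ : ℝ≥0∞) * C ≤ (max C (max (K₁ * C) (K₂ * C)) : ℝ≥0) := by
    rw [← ENNReal.coe_mul]
    exact ENNReal.coe_le_coe.2 ((le_max_left _ _).trans (le_max_right _ _))
  have hle3 : (K₂ : ℝ≥0∞) * C ≤ (max C (max (K₁ * C) (K₂ * C)) : ℝ≥0) := by
    rw [← ENNReal.coe_mul]
    exact ENNReal.coe_le_coe.2 ((le_max_right _ _).trans (le_max_right _ _))
  refine ⟨h3.trans (by gcongr), h4.trans (by gcongr), fun f hf A => ?_, fun g hg A => ?_⟩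
  · refine (h₁ f w hf hw.isH1.memLp.1 A).trans ?_
    gcongr ?_ * _
    calc _ ≤ K₁ * eLpNorm f p (volume.restrict Ω) *
          (C * (eLpNorm w 2 (volume.restrict Ω) + eLpNorm Dw 2 (volume.restrict Ω))) := by gcongr
      _ = K₁ * C * eLpNorm f p (volume.restrict Ω) *
          (eLpNorm w 2 (volume.restrict Ω) + eLpNorm Dw 2 (volume.restrict Ω)) := by ring
      _ ≤ _ := by gcongr
  · refine (h₂ g ψ hg hw.memLp_trace.1 A).trans ?_
    gcongr ?_ * _
    calc _ ≤ K₂ * eLpNorm g q (surfaceMeasure Ω) *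
          (C * (eLpNorm w 2 (volume.restrict Ω) + eLpNorm Dw 2 (volume.restrict Ω))) := by gcongr
      _ = K₂ * C * eLpNorm g q (surfaceMeasure Ω) *
          (eLpNorm w 2 (volume.restrict Ω) + eLpNorm Dw 2 (volume.restrict Ω)) := by ring
      _ ≤ _ := by gcongr

theorem integrable_mul_of_lintegral_lt_top {α : Type*} [MeasurableSpace α] {μ : Measure α}
    {f w : α → ℂ} (hf : AEStronglyMeasurable f μ) (hw : AEStronglyMeasurable w μ)
    (h : ∫⁻ x, ‖f x‖ₑ * ‖w x‖ₑ ∂μ < ⊤) : Integrable (fun x => f x * w x) μ :=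
  ⟨hf.mul hw, by simpa only [HasFiniteIntegral, enorm_mul] using h⟩

theorem norm_integral_mul_le {α : Type*} [MeasurableSpace α] {μ : Measure α}
    {f w : α → ℂ} {B : ℝ≥0∞} (hB : B ≠ ⊤) (h : ∫⁻ x, ‖f x‖ₑ * ‖w x‖ₑ ∂μ ≤ B) :
    ‖∫ x, f x * w x ∂μ‖ ≤ B.toReal := by
  rw [← toReal_enorm]
  refine ENNReal.toReal_mono hB ((enorm_integral_le_lintegral_enorm _).trans ?_)
  simpa only [enorm_mul] using h

theorem integral_mul_coeFn_add {α : Type*} [MeasurableSpace α] {μ : Measure α} {f : α → ℂ}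
    {P Q : Lp ℂ 2 μ} (hP : Integrable (fun x => f x * P x) μ)
    (hQ : Integrable (fun x => f x * Q x) μ) :
    ∫ x, f x * (P + Q : Lp ℂ 2 μ) x ∂μ = (∫ x, f x * P x ∂μ) + ∫ x, f x * Q x ∂μ := by
  rw [← integral_add hP hQ]
  refine integral_congr_ae ?_
  filter_upwards [Lp.coeFn_add P Q] with x hx
  rw [hx, Pi.add_apply, mul_add]

theorem integral_mul_coeFn_smul {α : Type*} [MeasurableSpace α] {μ : Measure α} (f : α → ℂ)
    (m : ℂ) (P : Lp ℂ 2 μ) :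
    ∫ x, f x * (m • P : Lp ℂ 2 μ) x ∂μ = m * ∫ x, f x * P x ∂μ := by
  rw [← integral_const_mul]
  refine integral_congr_ae ?_
  filter_upwards [Lp.coeFn_smul m P] with x hx
  rw [hx, Pi.smul_apply, smul_eq_mul, mul_left_comm]

/-- Continuity cannot in general come from Cauchy–Schwarz, since f and g need not be square
integrable; it uses the Hölder–Sobolev bounds with A the whole space. -/
theorem exists_functional_traceTriples {d : ℕ} (hd : 2 ≤ d) {Ω : Set (EuclideanSpace ℝ (Fin d))}
    (hΩ : IsOpen Ω) (hbdd : Bornology.IsBounded Ω) (hlip : HasLipschitzBoundary Ω)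
    [IsFiniteMeasure (volume.restrict Ω)] [IsFiniteMeasure (surfaceMeasure Ω)]
    {p q : ℝ≥0∞} (hp : (d : ℝ≥0∞) / 2 < p)
    (hq : (d : ℝ≥0∞) - 1 < q) {f g : EuclideanSpace ℝ (Fin d) → ℂ}
    (hf : MemLp f p (volume.restrict Ω)) (hg : MemLp g q (surfaceMeasure Ω)) :
    ∃ F : traceTriples Ω →L[ℂ] ℂ, ∀ P : traceTriples Ω,
      F P = (∫ x in Ω, f x * (P : TraceSpace Ω).fst x) +
        ∫ x, g x * (P : TraceSpace Ω).snd.snd x ∂(surfaceMeasure Ω) := by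
  obtain ⟨r, a, s, b, K, hr, hra, hs, hsb, hK⟩ := exists_holder_sobolev hd hΩ hbdd hlip hp hq
  have ha : 0 ≤ a := by by_contra h; nlinarith
  have hb : 0 ≤ b := by by_contra h; nlinarith
  let B₁ : ℝ≥0∞ := K * eLpNorm f p (volume.restrict Ω) * volume.restrict Ω univ ^ a
  let B₂ : ℝ≥0∞ := K * eLpNorm g q (surfaceMeasure Ω) * surfaceMeasure Ω univ ^ b
  have hB₁ : B₁ ≠ ⊤ := ENNReal.mul_ne_top (ENNReal.mul_ne_top ENNReal.coe_ne_top hf.2.ne)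
    (ENNReal.rpow_ne_top_of_nonneg ha (measure_ne_top _ _))
  have hB₂ : B₂ ≠ ⊤ := ENNReal.mul_ne_top (ENNReal.mul_ne_top ENNReal.coe_ne_top hg.2.ne)
    (ENNReal.rpow_ne_top_of_nonneg hb (measure_ne_top _ _))
  have hN : ∀ P : TraceSpace Ω, eLpNorm P.fst 2 (volume.restrict Ω) +
      eLpNorm P.snd.fst 2 (volume.restrict Ω) ≤ ENNReal.ofReal (2 * ‖P‖) := by
    intro P
    have h1 := norm_sq_traceSpace P
    rw [← Lp.enorm_def, ← Lp.enorm_def, ← ofReal_norm, ← ofReal_norm,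
      ← ENNReal.ofReal_add (norm_nonneg _) (norm_nonneg _)]
    refine ENNReal.ofReal_le_ofReal ?_
    have h2 : ‖P.fst‖ ≤ ‖P‖ := by
      refine le_of_sq_le_sq ?_ (norm_nonneg _); nlinarith [sq_nonneg ‖P.snd.fst‖, sq_nonneg ‖P.snd.snd‖]
    have h3 : ‖P.snd.fst‖ ≤ ‖P‖ := by
      refine le_of_sq_le_sq ?_ (norm_nonneg _); nlinarith [sq_nonneg ‖P.fst‖, sq_nonneg ‖P.snd.snd‖]
    linarith
  have h1 : ∀ P : traceTriples Ω, ∫⁻ x, ‖f x‖ₑ * ‖(P : TraceSpace Ω).fst x‖ₑ ∂(volume.restrict Ω) ≤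
      B₁ * ENNReal.ofReal (2 * ‖P‖) := by
    intro P
    have h2 := (hK _ _ _ (hasTrace_of_mem_traceTriples P.2)).2.2.1 f hf.1 univ
    rw [Measure.restrict_univ] at h2
    refine h2.trans ?_
    calc _ ≤ K * eLpNorm f p (volume.restrict Ω) * ENNReal.ofReal (2 * ‖P‖) *
          volume.restrict Ω univ ^ a := by gcongr; exact hN P
      _ = _ := by ring
  have h2 : ∀ P : traceTriples Ω,
      ∫⁻ x, ‖g x‖ₑ * ‖(P : TraceSpace Ω).snd.snd x‖ₑ ∂(surfaceMeasure Ω) ≤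
      B₂ * ENNReal.ofReal (2 * ‖P‖) := by
    intro P
    have h2 := (hK _ _ _ (hasTrace_of_mem_traceTriples P.2)).2.2.2 g hg.1 univ
    rw [Measure.restrict_univ] at h2
    refine h2.trans ?_
    calc _ ≤ K * eLpNorm g q (surfaceMeasure Ω) * ENNReal.ofReal (2 * ‖P‖) *
          surfaceMeasure Ω univ ^ b := by gcongr; exact hN P
      _ = _ := by ring
  have hC₁ : ∀ P : traceTriples Ω, B₁ * ENNReal.ofReal (2 * ‖P‖) ≠ ⊤ := fun P =>
    ENNReal.mul_ne_top hB₁ ENNReal.ofReal_ne_top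
  have hC₂ : ∀ P : traceTriples Ω, B₂ * ENNReal.ofReal (2 * ‖P‖) ≠ ⊤ := fun P =>
    ENNReal.mul_ne_top hB₂ ENNReal.ofReal_ne_top
  have i1 : ∀ P : traceTriples Ω, Integrable (fun x => f x * (P : TraceSpace Ω).fst x)
      (volume.restrict Ω) := fun P => integrable_mul_of_lintegral_lt_top hf.1
    (Lp.aestronglyMeasurable _) ((h1 P).trans_lt (hC₁ P).lt_top)
  have i2 : ∀ P : traceTriples Ω, Integrable (fun x => g x * (P : TraceSpace Ω).snd.snd x)
      (surfaceMeasure Ω) := fun P => integrable_mul_of_lintegral_lt_top hg.1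
    (Lp.aestronglyMeasurable _) ((h2 P).trans_lt (hC₂ P).lt_top)
  let G : traceTriples Ω → ℂ := fun P => (∫ x in Ω, f x * (P : TraceSpace Ω).fst x) +
    ∫ x, g x * (P : TraceSpace Ω).snd.snd x ∂(surfaceMeasure Ω)
  have hadd : ∀ P Q, G (P + Q) = G P + G Q := by
    intro P Q
    have e1 := integral_mul_coeFn_add (i1 P) (i1 Q)
    have e2 := integral_mul_coeFn_add (i2 P) (i2 Q)
    exact (congrArg₂ (· + ·) e1 e2).trans (add_add_add_comm _ _ _ _)
  have hsmul : ∀ (m : ℂ) P, G (m • P) = m • G P := by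
    intro m P
    have e1 := integral_mul_coeFn_smul f m (P : TraceSpace Ω).fst
    have e2 := integral_mul_coeFn_smul g m (P : TraceSpace Ω).snd.snd
    exact (congrArg₂ (· + ·) e1 e2).trans (mul_add _ _ _).symm
  let F₀ : traceTriples Ω →ₗ[ℂ] ℂ := IsLinearMap.mk' G ⟨hadd, hsmul⟩
  refine ⟨F₀.mkContinuous (2 * B₁.toReal + 2 * B₂.toReal) fun P => ?_, fun P => rfl⟩
  have e1 := norm_integral_mul_le (hC₁ P) (h1 P)
  have e2 := norm_integral_mul_le (hC₂ P) (h2 P)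
  rw [ENNReal.toReal_mul, ENNReal.toReal_ofReal (by positivity)] at e1 e2
  refine (norm_add_le _ _).trans ((add_le_add e1 e2).trans (le_of_eq ?_))
  ring

theorem exists_isWeakSolution {d : ℕ} (hd : 2 ≤ d) {Ω : Set (EuclideanSpace ℝ (Fin d))}
    (hΩ : IsOpen Ω) (hbdd : Bornology.IsBounded Ω) (hlip : HasLipschitzBoundary Ω)
    {β : EuclideanSpace ℝ (Fin d) → ℂ} (hβ : MemLp β ⊤ (surfaceMeasure Ω)) {lam : ℝ}
    (hco : FormCoercive Ω β lam) {p q : ℝ≥0∞} (hp : (d : ℝ≥0∞) / 2 < p)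
    (hq : (d : ℝ≥0∞) - 1 < q) {f g : EuclideanSpace ℝ (Fin d) → ℂ}
    (hf : MemLp f p (volume.restrict Ω)) (hg : MemLp g q (surfaceMeasure Ω)) :
    ∃ u, IsWeakSolution Ω β lam f g u := by
  have hfin : IsFiniteMeasure (volume.restrict Ω) := ⟨by
    rw [Measure.restrict_apply_univ]; exact hbdd.measure_lt_top⟩
  have hfinσ := isFiniteMeasure_surfaceMeasure hd hΩ hbdd hlip
  obtain ⟨c, hc, hcoer⟩ := exists_coercive_formOp hd hΩ hbdd hlip hβ hco
  -- The right side of the weak equation is antilinear in the test function, while F is linear. So F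
  -- is built from the conjugated data and conjugated back by Lax–Milgram.
  obtain ⟨F, hF⟩ := exists_functional_traceTriples hd hΩ hbdd hlip hp hq hf.star hg.star
  obtain ⟨P, hP, hPF⟩ := exists_inner_eq_of_coercive (traceTriples Ω)
    (Submodule.isClosed_topologicalClosure _) (formOp hβ lam) hc hcoer F
  have hT := hasTrace_of_mem_traceTriples hP
  refine ⟨_, _, _, hT, fun v Dv ψ hv => ?_⟩
  have e1 := hPF ⟨hv.toTriple, hv.toTriple_mem hbdd⟩
  have e2 := inner_toTriple_formOp hβ lam hT hv
  rw [hT.toTriple_coeFn] at e2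
  rw [← e2]
  refine e1.trans ?_
  rw [hF, map_add, ← integral_conj, ← integral_conj]
  congr 1
  · refine integral_congr_ae ?_
    filter_upwards [hv.isH1.memLp.coeFn_toLp] with x hx
    rw [map_mul, Pi.star_apply, RCLike.star_def, Complex.conj_conj]
    exact congrArg (fun z => f x * conj z) hx
  · refine integral_congr_ae ?_
    filter_upwards [hv.memLp_trace.coeFn_toLp] with x hx
    rw [map_mul, Pi.star_apply, RCLike.star_def, Complex.conj_conj]
    exact congrArg (fun z => g x * conj z) hx

/-! ### C¹ truncations. -/

theorem exists_smooth_ramp {k h : ℝ} (hkh : k < h) :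
    ∃ φ : ℝ → ℝ, ContDiff ℝ 1 φ ∧ (∀ t ≤ k, φ t = 0) ∧ Monotone φ ∧ Monotone (fun t => t - φ t) ∧
      ∀ t, t - h ≤ φ t := by
  -- The ramp is the primitive of a smooth step from 0 at k to 1 at h, a C¹ substitute for (t - k)⁺.
  -- The bounds 0 ≤ θ ≤ 1 give both monotonicity claims, and slope 1 beyond h gives φ(t) ≥ t - h.
  let θ : ℝ → ℝ := fun s => Real.smoothTransition ((s - k) / (h - k))
  have hkh' : 0 < h - k := by linarith
  have hθ : Continuous θ := Real.smoothTransition.continuous.comp (by fun_prop)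
  have hθ0 : ∀ s ≤ k, θ s = 0 := fun s hs => Real.smoothTransition.zero_of_nonpos
    (div_nonpos_of_nonpos_of_nonneg (by linarith) hkh'.le)
  have hθ1 : ∀ s, h ≤ s → θ s = 1 := fun s hs => Real.smoothTransition.one_of_one_le
    ((one_le_div hkh').2 (by linarith))
  let φ : ℝ → ℝ := fun t => ∫ s in k..t, θ s
  have hφ : ∀ t, HasDerivAt φ (θ t) t := fun t => hθ.integral_hasStrictDerivAt k t |>.hasDerivAt
  have hφd : deriv φ = θ := funext fun t => (hφ t).deriv
  have hφ0 : ∀ t ≤ k, φ t = 0 := by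
    intro t ht
    have : ∫ s in k..t, θ s = ∫ s in k..t, (0 : ℝ) := by
      refine intervalIntegral.integral_congr fun s hs => ?_
      rw [uIcc_of_ge ht] at hs
      exact hθ0 s hs.2
    simpa [φ] using this
  have hmono : Monotone φ := monotone_of_deriv_nonneg (fun t => (hφ t).differentiableAt)
    fun t => by rw [hφd]; exact Real.smoothTransition.nonneg _
  refine ⟨φ, ?_, hφ0, hmono, ?_, fun t => ?_⟩
  · rw [contDiff_one_iff_deriv]
    exact ⟨fun t => (hφ t).differentiableAt, by rwa [hφd]⟩
  · refine monotone_of_deriv_nonneg (fun t => ((hasDerivAt_id t).sub (hφ t)).differentiableAt)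
      fun t => ?_
    refine le_of_le_of_eq ?_ ((hasDerivAt_id t).sub (hφ t)).deriv.symm
    rw [sub_nonneg]
    exact Real.smoothTransition.le_one _
  · rcases le_total t h with hth | hth
    · have : 0 ≤ φ t := by
        rcases le_total t k with htk | htk
        · rw [hφ0 t htk]
        · rw [← hφ0 k le_rfl]; exact hmono htk
      linarith
    · have h1 : φ t = φ h + ∫ s in h..t, θ s :=
        (intervalIntegral.integral_add_adjacent_intervals (hθ.intervalIntegrable _ _)
          (hθ.intervalIntegrable _ _)).symm
      have h2 : ∫ s in h..t, θ s = ∫ s in h..t, (1 : ℝ) := by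
        refine intervalIntegral.integral_congr fun s hs => ?_
        rw [uIcc_of_le hth] at hs
        exact hθ1 s hs.1
      have h3 : 0 ≤ φ h := by rw [← hφ0 k le_rfl]; exact hmono hkh.le
      rw [h1, h2, intervalIntegral.integral_const, smul_eq_mul, mul_one]
      linarith

/-- A smooth version of the radial truncation `z ↦ (|z| - k)⁺ z / |z|`. -/
theorem exists_truncation {k h : ℝ} (hk : 0 < k) (hkh : k < h) :
    ∃ T : ℂ → ℂ, ContDiff ℝ 1 T ∧ LipschitzWith 1 T ∧ (∀ z, ‖z‖ ≤ k → T z = 0) ∧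
      (∀ z, ‖z‖ - h ≤ ‖T z‖) ∧ (∀ z, ∃ ρ : ℝ, 0 ≤ ρ ∧ ρ ≤ 1 ∧ T z = ρ * z) ∧
      ∀ z ζ, ‖fderiv ℝ T z ζ‖ ^ 2 ≤ inner ℝ (fderiv ℝ T z ζ) ζ := by
  obtain ⟨φ, hφ, hφ0, hmono, hmono', hφh⟩ := exists_smooth_ramp hkh
  have hφnn : ∀ t, 0 ≤ t → 0 ≤ φ t := fun t ht => by
    rw [← hφ0 0 hk.le]; exact hmono ht
  have hφle : ∀ t, 0 ≤ t → φ t ≤ t := fun t ht => by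
    have := hmono' ht
    simp only [hφ0 0 hk.le] at this
    linarith
  let T : ℂ → ℂ := fun z => (φ ‖z‖ / ‖z‖) • z
  have hT0 : ∀ z, ‖z‖ ≤ k → T z = 0 := fun z hz => by simp [T, hφ0 _ hz]
  have hTn : ∀ z, ‖T z‖ = φ ‖z‖ := by
    intro z
    rcases eq_or_ne z 0 with rfl | hz
    · simp [T, hφ0 0 hk.le]
    · have hz' : 0 < ‖z‖ := norm_pos_iff.2 hz
      rw [norm_smul, Real.norm_of_nonneg (div_nonneg (hφnn _ hz'.le) hz'.le),
        div_mul_cancel₀ _ hz'.ne']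
  have hρ : ∀ t, 0 ≤ t → 0 ≤ φ t / t ∧ φ t / t ≤ 1 := fun t ht =>
    ⟨div_nonneg (hφnn t ht) ht, div_le_one_of_le₀ (hφle t ht) ht⟩
  have hTC : ContDiff ℝ 1 T := by
    rw [contDiff_iff_contDiffAt]
    intro z
    rcases eq_or_ne z 0 with rfl | hz
    -- Since k > 0, T vanishes near the origin and the singularity of z/|z| is never met.
    · have : T =ᶠ[𝓝 0] fun _ => 0 := by
        filter_upwards [Metric.ball_mem_nhds (0 : ℂ) hk] with z hz
        exact hT0 z (by simpa using (Metric.mem_ball.1 hz).le)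
      exact contDiffAt_const.congr_of_eventuallyEq this
    · have hn : ContDiffAt ℝ 1 (fun z : ℂ => ‖z‖) z := contDiffAt_norm ℝ hz
      exact ((hφ.contDiffAt.comp z hn).div hn (norm_ne_zero_iff.2 hz)).smul contDiffAt_id
  -- Firm nonexpansiveness of T. It yields both the Lipschitz constant 1 and, by differentiation,
  -- the gradient inequality.
  have hTi : ∀ z y, ‖T z - T y‖ ^ 2 ≤ inner ℝ (T z - T y) (z - y) := by
    intro z y
    obtain ⟨hσ0, hσ1⟩ := hρ ‖z‖ (norm_nonneg z)
    obtain ⟨hτ0, hτ1⟩ := hρ ‖y‖ (norm_nonneg y)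
    have hσ : φ ‖z‖ / ‖z‖ * ‖z‖ = φ ‖z‖ := by
      have := hTn z
      rwa [norm_smul, Real.norm_of_nonneg hσ0] at this
    have hτ : φ ‖y‖ / ‖y‖ * ‖y‖ = φ ‖y‖ := by
      have := hTn y
      rwa [norm_smul, Real.norm_of_nonneg hτ0] at this
    have hm : 0 ≤ (φ ‖z‖ - φ ‖y‖) * ((‖z‖ - φ ‖z‖) - (‖y‖ - φ ‖y‖)) := by
      rcases le_total ‖z‖ ‖y‖ with hzy | hzy
      · exact mul_nonneg_of_nonpos_of_nonpos (sub_nonpos.2 (hmono hzy)) (sub_nonpos.2 (hmono' hzy))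
      · exact mul_nonneg (sub_nonneg.2 (hmono hzy)) (sub_nonneg.2 (hmono' hzy))
    change ‖(φ ‖z‖ / ‖z‖) • z - (φ ‖y‖ / ‖y‖) • y‖ ^ 2 ≤
      inner ℝ ((φ ‖z‖ / ‖z‖) • z - (φ ‖y‖ / ‖y‖) • y) (z - y)
    rw [← hσ, ← hτ] at hm
    generalize φ ‖z‖ / ‖z‖ = σ at *
    generalize φ ‖y‖ / ‖y‖ = τ at *
    have hc : inner ℝ z y ≤ ‖z‖ * ‖y‖ := real_inner_le_norm z y
    rw [← real_inner_self_eq_norm_sq]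
    simp only [inner_sub_left, inner_sub_right, real_inner_smul_left, real_inner_smul_right,
      real_inner_self_eq_norm_sq, real_inner_comm z y, norm_smul, Real.norm_of_nonneg hσ0,
      Real.norm_of_nonneg hτ0]
    -- The difference of the two sides is ⟪Tz - Ty, (z - Tz) - (y - Ty)⟫. Its cross term carries
    -- minus this nonnegative coefficient, so Cauchy–Schwarz bounds it below by the radial
    -- expression `hm`, a product of two increments of equal sign.
    have h1 : 0 ≤ σ * (1 - τ) + τ * (1 - σ) := by
      have := mul_nonneg hσ0 (sub_nonneg.2 hτ1)
      have := mul_nonneg hτ0 (sub_nonneg.2 hσ1)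
      linarith
    have h2 := mul_le_mul_of_nonneg_left hc h1
    nlinarith
  have hTL : LipschitzWith 1 T := by
    refine LipschitzWith.of_dist_le_mul fun z y => ?_
    rw [NNReal.coe_one, one_mul, dist_eq_norm, dist_eq_norm]
    have h1 := (hTi z y).trans (real_inner_le_norm _ _)
    rcases (norm_nonneg (T z - T y)).eq_or_lt with h2 | h2
    · rw [← h2]; exact norm_nonneg _
    · rw [sq] at h1
      exact le_of_mul_le_mul_left h1 h2
  refine ⟨T, hTC, hTL, hT0, fun z => by rw [hTn]; exact hφh _, fun z =>
    ⟨_, (hρ _ (norm_nonneg z)).1, (hρ _ (norm_nonneg z)).2, Complex.real_smul⟩, fun z ζ => ?_⟩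
  have hd : HasFDerivAt T (fderiv ℝ T z) z := (hTC.differentiable one_ne_zero z).hasFDerivAt
  -- The derivative is the limit of the difference quotients with step 1/(n+1), to which `hTi`
  -- applies.
  have hlim := hd.lim ζ (c := fun n : ℕ => (n : ℝ) + 1) (l := atTop) ?_
  swap
  · have h1 : Tendsto (fun n : ℕ => (n : ℝ) + 1) atTop atTop :=
      tendsto_natCast_atTop_atTop.atTop_add tendsto_const_nhds
    exact tendsto_norm_atTop_atTop.comp h1
  refine le_of_tendsto_of_tendsto' (hlim.norm.pow 2) (hlim.inner tendsto_const_nhds) fun n => ?_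
  have hn : (0 : ℝ) < n + 1 := by positivity
  have h1 := hTi (z + ((n : ℝ) + 1)⁻¹ • ζ) z
  rw [add_sub_cancel_left, real_inner_smul_right] at h1
  rw [norm_smul, Real.norm_of_nonneg hn.le, real_inner_smul_left, mul_pow]
  calc _ ≤ ((n : ℝ) + 1) ^ 2 * (((n : ℝ) + 1)⁻¹ *
        inner ℝ (T (z + ((n : ℝ) + 1)⁻¹ • ζ) - T z) ζ) := by gcongr
    _ = _ := by field_simp

/-! ### Energy inequalities for the solution and its truncations. -/

theorem re_integral_mono_ae {α : Type*} [MeasurableSpace α] {μ : Measure α} {F G : α → ℂ}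
    (hF : Integrable F μ) (hG : Integrable G μ) (h : ∀ᵐ x ∂μ, (F x).re ≤ (G x).re) :
    (∫ x, F x ∂μ).re ≤ (∫ x, G x ∂μ).re := by
  have h1 : (∫ x, F x ∂μ).re = ∫ x, (F x).re ∂μ := (integral_re hF).symm
  have h2 : (∫ x, G x ∂μ).re = ∫ x, (G x).re ∂μ := (integral_re hG).symm
  rw [h1, h2]
  exact integral_mono_ae hF.re hG.re h

theorem integrable_mul_conj {α : Type*} [MeasurableSpace α] {μ : Measure α} {F G : α → ℂ}
    (hF : MemLp F 2 μ) (hG : MemLp G 2 μ) : Integrable (fun x => F x * conj (G x)) μ :=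
  hF.integrable_mul hG.star

theorem integrable_sum_mul_conj {α : Type*} [MeasurableSpace α] {μ : Measure α} {d : ℕ}
    {F G : α → EuclideanSpace ℂ (Fin d)} (hF : MemLp F 2 μ) (hG : MemLp G 2 μ) :
    Integrable (fun x => ∑ i, F x i * conj (G x i)) μ :=
  integrable_finsetSum _ fun i _ => integrable_mul_conj
    ((EuclideanSpace.proj i : EuclideanSpace ℂ (Fin d) →L[ℂ] ℂ).comp_memLp' hF)
    ((EuclideanSpace.proj i : EuclideanSpace ℂ (Fin d) →L[ℂ] ℂ).comp_memLp' hG)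

theorem ofReal_mul_add_sq_le {α E F : Type*} [MeasurableSpace α] {μ : Measure α}
    [NormedAddCommGroup E] [NormedAddCommGroup F] {v : α → E} {w : α → F}
    (hv : MemLp v 2 μ) (hw : MemLp w 2 μ) {a : ℝ} (ha : 0 ≤ a) :
    ENNReal.ofReal (a / 2) * (eLpNorm v 2 μ + eLpNorm w 2 μ) ^ 2 ≤
      ENNReal.ofReal (a * ((∫ x, ‖v x‖ ^ 2 ∂μ) + ∫ x, ‖w x‖ ^ 2 ∂μ)) := by
  rw [← toReal_eLpNorm_two_sq hv, ← toReal_eLpNorm_two_sq hw,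
    ← ENNReal.ofReal_toReal hv.2.ne, ← ENNReal.ofReal_toReal hw.2.ne,
    ← ENNReal.ofReal_add (by positivity) (by positivity), ← ENNReal.ofReal_pow (by positivity),
    ← ENNReal.ofReal_mul (by positivity), ENNReal.toReal_ofReal (by positivity),
    ENNReal.toReal_ofReal (by positivity)]
  refine ENNReal.ofReal_le_ofReal ?_
  nlinarith [mul_nonneg ha (sq_nonneg ((eLpNorm v 2 μ).toReal - (eLpNorm w 2 μ).toReal))]

theorem ofReal_re_integral_mul_conj_le {α : Type*} [MeasurableSpace α] {μ : Measure α}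
    (f w : α → ℂ) :
    ENNReal.ofReal (∫ x, f x * conj (w x) ∂μ).re ≤ ∫⁻ x, ‖f x‖ₑ * ‖w x‖ₑ ∂μ := by
  calc ENNReal.ofReal (∫ x, f x * conj (w x) ∂μ).re
      ≤ ENNReal.ofReal ‖∫ x, f x * conj (w x) ∂μ‖ := ENNReal.ofReal_le_ofReal (Complex.re_le_norm _)
    _ = ‖∫ x, f x * conj (w x) ∂μ‖ₑ := ofReal_norm _
    _ ≤ ∫⁻ x, ‖f x * conj (w x)‖ₑ ∂μ := enorm_integral_le_lintegral_enorm _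
    _ = _ := by
      refine lintegral_congr fun x => ?_
      rw [enorm_mul, RCLike.enorm_conj]

/-- The energy inequality obtained by testing with `u`. -/
theorem energy_le {d : ℕ} {Ω : Set (EuclideanSpace ℝ (Fin d))}
    {β : EuclideanSpace ℝ (Fin d) → ℂ} {lam α : ℝ} (hα : 0 ≤ α)
    (hco : ∀ v Dv ψ, HasTrace Ω v Dv ψ →
      α * ((∫ x in Ω, ‖v x‖ ^ 2) + ∫ x in Ω, ‖Dv x‖ ^ 2) ≤ (form Ω β lam v Dv ψ v Dv ψ).re)
    {f g u φ : EuclideanSpace ℝ (Fin d) → ℂ}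
    {Du : EuclideanSpace ℝ (Fin d) → EuclideanSpace ℂ (Fin d)} (hu : HasTrace Ω u Du φ)
    (hsol : form Ω β lam u Du φ u Du φ =
      (∫ x in Ω, f x * conj (u x)) + ∫ z, g z * conj (φ z) ∂(surfaceMeasure Ω)) :
    ENNReal.ofReal (α / 2) *
        (eLpNorm u 2 (volume.restrict Ω) + eLpNorm Du 2 (volume.restrict Ω)) ^ 2 ≤
      (∫⁻ x in Ω, ‖f x‖ₑ * ‖u x‖ₑ) + ∫⁻ x, ‖g x‖ₑ * ‖φ x‖ₑ ∂(surfaceMeasure Ω) := by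
  refine (ofReal_mul_add_sq_le hu.isH1.memLp hu.isH1.memLp_grad hα).trans ?_
  refine (ENNReal.ofReal_le_ofReal (hco u Du φ hu)).trans ?_
  rw [hsol, Complex.add_re]
  exact ENNReal.ofReal_add_le.trans (add_le_add (ofReal_re_integral_mul_conj_le _ _)
    (ofReal_re_integral_mul_conj_le _ _))

/-- The energy inequality obtained by testing with a truncation of `u`. -/
theorem truncated_energy_le {d : ℕ} {Ω : Set (EuclideanSpace ℝ (Fin d))}
    (hΩ : IsOpen Ω) (hbdd : Bornology.IsBounded Ω) [IsFiniteMeasure (surfaceMeasure Ω)]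
    {β : EuclideanSpace ℝ (Fin d) → ℂ} (hβ : AEStronglyMeasurable β (surfaceMeasure Ω))
    {b : ℝ} (hb : ∀ᵐ z ∂(surfaceMeasure Ω), ‖β z‖ ≤ b) {lam α : ℝ} (hlam : 0 ≤ lam) (hα : 0 ≤ α)
    (hco : ∀ v Dv ψ, HasTrace Ω v Dv ψ →
      α * ((∫ x in Ω, ‖v x‖ ^ 2) + ∫ x in Ω, ‖Dv x‖ ^ 2) ≤ (form Ω β lam v Dv ψ v Dv ψ).re)
    {f g u φ : EuclideanSpace ℝ (Fin d) → ℂ}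
    {Du : EuclideanSpace ℝ (Fin d) → EuclideanSpace ℂ (Fin d)} (hu : HasTrace Ω u Du φ)
    (hsol : ∀ v Dv ψ, HasTrace Ω v Dv ψ → form Ω β lam u Du φ v Dv ψ =
      (∫ x in Ω, f x * conj (v x)) + ∫ z, g z * conj (ψ z) ∂(surfaceMeasure Ω))
    {T : ℂ → ℂ} {h : ℝ} (hT : ContDiff ℝ 1 T) (hTL : LipschitzWith 1 T) (hT0 : T 0 = 0)
    (hTh : ∀ z, ‖z‖ - h ≤ ‖T z‖) (hTρ : ∀ z, ∃ ρ : ℝ, 0 ≤ ρ ∧ ρ ≤ 1 ∧ T z = ρ * z)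
    (hT' : ∀ z ζ, ‖fderiv ℝ T z ζ‖ ^ 2 ≤ inner ℝ (fderiv ℝ T z ζ) ζ) :
    ENNReal.ofReal (α / 2) * (eLpNorm (fun x => T (u x)) 2 (volume.restrict Ω) +
        eLpNorm (fun x => chainGrad T (u x) (Du x)) 2 (volume.restrict Ω)) ^ 2 ≤
      (∫⁻ x in Ω, ‖f x‖ₑ * ‖T (u x)‖ₑ) + (∫⁻ x, ‖g x‖ₑ * ‖T (φ x)‖ₑ ∂(surfaceMeasure Ω)) +
        ENNReal.ofReal (b * h) * ∫⁻ x, ‖T (φ x)‖ₑ ∂(surfaceMeasure Ω) := by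
  have hv := hu.comp hΩ hbdd hT hTL hT0
  have hψ := hv.memLp_trace
  have hψ1 : Integrable (fun x => T (φ x)) (surfaceMeasure Ω) := hψ.integrable (by norm_num)
  have hρre : ∀ z, (T z * conj (T z)).re ≤ (z * conj (T z)).re := by
    intro z
    obtain ⟨ρ, hρ0, hρ1, hρ⟩ := hTρ z
    have e1 : T z * conj (T z) = ((ρ ^ 2 * ‖z‖ ^ 2 : ℝ) : ℂ) := by
      rw [Complex.mul_conj, Complex.normSq_eq_norm_sq, hρ, norm_mul, mul_pow]
      simp
    have e2 : z * conj (T z) = ((ρ * ‖z‖ ^ 2 : ℝ) : ℂ) := by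
      rw [hρ, map_mul, Complex.conj_ofReal, mul_left_comm, Complex.mul_conj,
        Complex.normSq_eq_norm_sq]
      simp
    rw [e1, e2, Complex.ofReal_re, Complex.ofReal_re]
    have : ρ ^ 2 ≤ ρ := by nlinarith
    gcongr
  -- No sign of β is available, so the truncation is compared with z by its size: T z = ρz with 0 ≤
  -- ρ ≤ 1 and |z| - h ≤ |T z| give |T z - z| ≤ h.
  have hβre : ∀ β₀ z : ℂ, ‖β₀‖ ≤ b →
      (β₀ * T z * conj (T z)).re - b * h * ‖T z‖ ≤ (β₀ * z * conj (T z)).re := by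
    intro β₀ z hβ₀
    have e1 : (β₀ * T z * conj (T z)).re - (β₀ * z * conj (T z)).re =
        (β₀ * (T z - z) * conj (T z)).re := by rw [← Complex.sub_re]; ring_nf
    have e2 : ‖T z - z‖ ≤ h := by
      obtain ⟨ρ, hρ0, hρ1, hρ⟩ := hTρ z
      have h1 := hTh z
      rw [hρ, norm_mul, Complex.norm_real, Real.norm_of_nonneg hρ0] at h1
      have e3 : T z - z = (((ρ - 1 : ℝ)) : ℂ) * z := by rw [hρ]; push_cast; ring
      rw [e3, norm_mul, Complex.norm_real, Real.norm_of_nonpos (by linarith)]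
      linarith
    have e4 : (β₀ * (T z - z) * conj (T z)).re ≤ b * h * ‖T z‖ := by
      refine (Complex.re_le_norm _).trans ?_
      rw [norm_mul, norm_mul, RCLike.norm_conj]
      have : 0 ≤ b := (norm_nonneg _).trans hβ₀
      gcongr
    linarith
  have hbdd : ∀ w : EuclideanSpace ℝ (Fin d) → ℂ, MemLp w 2 (surfaceMeasure Ω) →
      Integrable (fun z => β z * w z * conj (T (φ z))) (surfaceMeasure Ω) := by
    intro w hw
    simp only [mul_assoc]
    exact (integrable_mul_conj hw hψ).bdd_mul hβ hb
  -- The gradient inequality for T, applied to each partial derivative of u.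
  have i1 : (∫ x in Ω, ∑ i, chainGrad T (u x) (Du x) i * conj (chainGrad T (u x) (Du x) i)).re ≤
      (∫ x in Ω, ∑ i, Du x i * conj (chainGrad T (u x) (Du x) i)).re := by
    refine re_integral_mono_ae (integrable_sum_mul_conj hv.isH1.memLp_grad hv.isH1.memLp_grad)
      (integrable_sum_mul_conj hu.isH1.memLp_grad hv.isH1.memLp_grad)
      (Eventually.of_forall fun x => ?_)
    rw [Complex.re_sum, Complex.re_sum]
    refine Finset.sum_le_sum fun i _ => ?_
    have e1 := hT' (u x) (Du x i)
    rw [Complex.inner] at e1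
    rw [Complex.mul_conj, Complex.normSq_eq_norm_sq, Complex.ofReal_re]
    exact e1
  have i2 : (∫ z, β z * T (φ z) * conj (T (φ z)) ∂(surfaceMeasure Ω)).re -
      b * h * (∫ z, ‖T (φ z)‖ ∂(surfaceMeasure Ω)) ≤
      (∫ z, β z * φ z * conj (T (φ z)) ∂(surfaceMeasure Ω)).re := by
    have e1 : b * h * (∫ z, ‖T (φ z)‖ ∂(surfaceMeasure Ω)) =
        (∫ z, ((b * h * ‖T (φ z)‖ : ℝ) : ℂ) ∂(surfaceMeasure Ω)).re := by
      rw [integral_complex_ofReal, Complex.ofReal_re, integral_const_mul]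
    have hint : Integrable (fun z => ((b * h * ‖T (φ z)‖ : ℝ) : ℂ)) (surfaceMeasure Ω) :=
      (hψ1.norm.const_mul _).ofReal
    rw [e1, ← Complex.sub_re, ← integral_sub (hbdd _ hψ) hint]
    refine re_integral_mono_ae ((hbdd _ hψ).sub hint) (hbdd _ hu.memLp_trace) ?_
    filter_upwards [hb] with z hz
    rw [Complex.sub_re, Complex.ofReal_re]
    exact hβre _ _ hz
  have i3 : (∫ x in Ω, T (u x) * conj (T (u x))).re ≤ (∫ x in Ω, u x * conj (T (u x))).re :=
    re_integral_mono_ae (integrable_mul_conj hv.isH1.memLp hv.isH1.memLp)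
      (integrable_mul_conj hu.isH1.memLp hv.isH1.memLp) (Eventually.of_forall fun x => hρre _)
  have i4 : (∫ z, T (φ z) * conj (T (φ z)) ∂(surfaceMeasure Ω)).re ≤
      (∫ z, φ z * conj (T (φ z)) ∂(surfaceMeasure Ω)).re :=
    re_integral_mono_ae (integrable_mul_conj hψ hψ)
      (integrable_mul_conj hu.memLp_trace hψ) (Eventually.of_forall fun x => hρre _)
  have h1 := hco _ _ _ hv
  have h2 := congrArg Complex.re (hsol _ _ _ hv)
  -- The gradient and zero-order parts of the form only grow when the first argument T(u) is
  -- replaced by u (here `hlam` is needed); the β part loses at most the error term.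
  have h3 : (form Ω β lam (fun x => T (u x)) (fun x => chainGrad T (u x) (Du x))
      (fun x => T (φ x)) (fun x => T (u x)) (fun x => chainGrad T (u x) (Du x))
      (fun x => T (φ x))).re - b * h * (∫ z, ‖T (φ z)‖ ∂(surfaceMeasure Ω)) ≤
      (form Ω β lam u Du φ (fun x => T (u x)) (fun x => chainGrad T (u x) (Du x))
      (fun x => T (φ x))).re := by
    simp only [form, Complex.add_re, Complex.re_ofReal_mul]
    have := mul_le_mul_of_nonneg_left (add_le_add i3 i4) hlam
    linarith
  refine (ofReal_mul_add_sq_le hv.isH1.memLp hv.isH1.memLp_grad hα).trans ?_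
  rw [Complex.add_re] at h2
  have h4 := h1.trans (sub_le_iff_le_add.1 h3)
  rw [h2] at h4
  refine (ENNReal.ofReal_le_ofReal h4).trans (ENNReal.ofReal_add_le.trans (add_le_add
    (ENNReal.ofReal_add_le.trans (add_le_add (ofReal_re_integral_mul_conj_le _ _)
    (ofReal_re_integral_mul_conj_le _ _))) ?_))
  rw [ENNReal.ofReal_mul' (integral_nonneg fun _ => norm_nonneg _),
    ofReal_integral_norm_eq_lintegral_enorm hψ1]

/-! ### Level-set decay and De Giorgi iteration. -/

theorem lintegral_le_setLIntegral {α : Type*} [MeasurableSpace α] {μ : Measure α} {F : α → ℝ≥0∞}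
    {A : Set α} (h : ∀ x ∉ A, F x = 0) : ∫⁻ x, F x ∂μ ≤ ∫⁻ x in A, F x ∂μ := by
  have : A.indicator F = F := indicator_eq_self.2 fun x hx => by
    by_contra hxA
    exact hx (h x hxA)
  calc ∫⁻ x, F x ∂μ = ∫⁻ x, A.indicator F x ∂μ := by rw [this]
    _ ≤ _ := lintegral_indicator_le _ _

/-- Chebyshev's inequality, in the form that bounds the level-set quantity by Sobolev norms. -/
theorem ofReal_mul_measure_rpow_le_eLpNorm {α : Type*} [MeasurableSpace α] {μ : Measure α}
    {w : α → ℂ} (hw : AEStronglyMeasurable w μ) {r : ℝ} (hr : 0 < r) {c : ℝ} {A : Set α}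
    (hA : ∀ x ∈ A, c ≤ ‖w x‖) :
    ENNReal.ofReal c * μ A ^ (1 / r) ≤ eLpNorm w (ENNReal.ofReal r) μ := by
  have h1 := pow_mul_meas_ge_le_eLpNorm μ (p := ENNReal.ofReal r) (by simpa using hr)
    ENNReal.ofReal_ne_top hw (ENNReal.ofReal c ^ r)
  rw [ENNReal.toReal_ofReal hr.le] at h1
  refine le_trans ?_ h1
  rw [ENNReal.mul_rpow_of_nonneg _ _ (by positivity), ← ENNReal.rpow_mul, mul_one_div_cancel hr.ne',
    ENNReal.rpow_one]
  gcongr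
  intro x hx
  rw [mem_ofPred_eq, ENNReal.rpow_le_rpow_iff hr, ← ofReal_norm]
  exact ENNReal.ofReal_le_ofReal (hA x hx)

theorem mul_le_of_mul_sq_le {c X N : ℝ≥0∞} (hN : N ≠ ⊤) (h : c * N ^ 2 ≤ X * N) : c * N ≤ X := by
  rcases eq_or_ne N 0 with rfl | hN0
  · simp
  · rw [sq, ← mul_assoc] at h
    exact (ENNReal.mul_le_mul_iff_left hN0 hN).1 h

/-- The decay estimate for the measures of the superlevel sets of a weak solution, which drives the
De Giorgi iteration. -/
theorem exists_level_set_estimate {d : ℕ} (hd : 2 ≤ d) {Ω : Set (EuclideanSpace ℝ (Fin d))}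
    (hΩ : IsOpen Ω) (hbdd : Bornology.IsBounded Ω) (hlip : HasLipschitzBoundary Ω)
    {β : EuclideanSpace ℝ (Fin d) → ℂ} (hβ : MemLp β ⊤ (surfaceMeasure Ω)) {lam : ℝ}
    (hlam : 0 ≤ lam) (hco : FormCoercive Ω β lam) {p q : ℝ≥0∞} (hp : (d : ℝ≥0∞) / 2 < p)
    (hq : (d : ℝ≥0∞) - 1 < q) :
    ∃ C γ : ℝ, 0 < C ∧ 1 < γ ∧ ∀ f g u : EuclideanSpace ℝ (Fin d) → ℂ,
      MemLp f p (volume.restrict Ω) → MemLp g q (surfaceMeasure Ω) →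
      IsWeakSolution Ω β lam f g u →
      ∃ y : ℝ → ℝ, (∀ k, 0 ≤ y k) ∧ Antitone y ∧
        (∀ k, y k = 0 → ∀ᵐ x ∂(volume.restrict Ω), ‖u x‖ ≤ k) ∧
        (∀ k, 0 < k → k * y k ≤
          C * (eLpNorm f p (volume.restrict Ω) + eLpNorm g q (surfaceMeasure Ω)).toReal) ∧
        ∀ k h, 0 < k → k < h → y k ≤ 1 → (h - k) * y h ≤
          C * ((eLpNorm f p (volume.restrict Ω) + eLpNorm g q (surfaceMeasure Ω)).toReal + h) *
            y k ^ γ := by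
  have hfin : IsFiniteMeasure (volume.restrict Ω) := ⟨by
    rw [Measure.restrict_apply_univ]; exact hbdd.measure_lt_top⟩
  have hfinσ := isFiniteMeasure_surfaceMeasure hd hΩ hbdd hlip
  obtain ⟨r, a, s, b, K, hr, hra, hs, hsb, hK⟩ := exists_holder_sobolev hd hΩ hbdd hlip hp hq
  obtain ⟨α, hα, hcoα⟩ := hco
  have hr0 : 0 < r := by linarith
  have hs0 : 0 < s := by linarith
  have ha : 0 ≤ a := by by_contra h; nlinarith
  have hb : 0 ≤ b := by by_contra h; nlinarith
  -- The error term from β is estimated like a boundary datum, with the constant 1 in the role of g.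
  have hS : MemLp (fun _ => (1 : ℂ)) q (surfaceMeasure Ω) := memLp_const 1
  let B : ℝ := (eLpNorm β ⊤ (surfaceMeasure Ω)).toReal
  let S : ℝ := (eLpNorm (fun _ => (1 : ℂ)) q (surfaceMeasure Ω)).toReal
  let V : ℝ≥0∞ := volume.restrict Ω univ ^ a + surfaceMeasure Ω univ ^ b
  have hV : V ≠ ⊤ := ENNReal.add_ne_top.2 ⟨ENNReal.rpow_ne_top_of_nonneg ha (measure_ne_top _ _),
    ENNReal.rpow_ne_top_of_nonneg hb (measure_ne_top _ _)⟩
  have hBβ : ∀ᵐ z ∂(surfaceMeasure Ω), ‖β z‖ ≤ B := by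
    filter_upwards [enorm_ae_le_eLpNormEssSup β (surfaceMeasure Ω)] with z hz
    rw [← eLpNorm_exponent_top] at hz
    rw [← toReal_enorm]
    exact ENNReal.toReal_mono hβ.2.ne hz
  have hB0 : 0 ≤ B := ENNReal.toReal_nonneg
  have hS0 : 0 ≤ S := ENNReal.toReal_nonneg
  -- The two summands serve the decay estimate and the starting estimate respectively; the final 1
  -- ensures positivity.
  let C : ℝ := (16 * (K : ℝ) ^ 2 * (1 + B * S) + 4 * (K : ℝ) ^ 2 * V.toReal) / α + 1
  have hC1 : 16 * (K : ℝ) ^ 2 * (1 + B * S) ≤ α * C := by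
    have : α * C = 16 * (K : ℝ) ^ 2 * (1 + B * S) + 4 * (K : ℝ) ^ 2 * V.toReal + α := by
      simp only [C]; field_simp
    rw [this]
    have : 0 ≤ 4 * (K : ℝ) ^ 2 * V.toReal := by positivity
    linarith
  have hC2 : 4 * (K : ℝ) ^ 2 * V.toReal ≤ α * C := by
    have : α * C = 16 * (K : ℝ) ^ 2 * (1 + B * S) + 4 * (K : ℝ) ^ 2 * V.toReal + α := by
      simp only [C]; field_simp
    rw [this]
    have : 0 ≤ 16 * (K : ℝ) ^ 2 * (1 + B * S) := by positivity
    linarith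
  refine ⟨C, min (r * a) (s * b), by positivity, lt_min hra hsb, fun f g u hf hg hw => ?_⟩
  obtain ⟨Du, φ, hu, hsol⟩ := hw
  set m := eLpNorm f p (volume.restrict Ω) + eLpNorm g q (surfaceMeasure Ω) with hm
  have hmt : m ≠ ⊤ := ENNReal.add_ne_top.2 ⟨hf.2.ne, hg.2.ne⟩
  have hfm : eLpNorm f p (volume.restrict Ω) ≤ m := le_self_add
  have hgm : eLpNorm g q (surfaceMeasure Ω) ≤ m := le_add_self
  -- Interior and boundary level sets must be treated together because the energy couples them. The
  -- powers 1/r and 1/s are those in Chebyshev's inequality, so both summands are controlled by the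
  -- same H¹ norm.
  let Y : ℝ → ℝ≥0∞ := fun k => volume.restrict Ω {x | k < ‖u x‖} ^ (1 / r) +
    surfaceMeasure Ω {x | k < ‖φ x‖} ^ (1 / s)
  have hYt : ∀ k, Y k ≠ ⊤ := fun k => ENNReal.add_ne_top.2
    ⟨ENNReal.rpow_ne_top_of_nonneg (by positivity) (measure_ne_top _ _),
      ENNReal.rpow_ne_top_of_nonneg (by positivity) (measure_ne_top _ _)⟩
  have hYanti : Antitone Y := by
    intro k h hkh
    refine add_le_add (ENNReal.rpow_le_rpow (measure_mono fun x hx => lt_of_le_of_lt hkh hx)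
      (by positivity)) (ENNReal.rpow_le_rpow (measure_mono fun x hx => lt_of_le_of_lt hkh hx)
      (by positivity))
  refine ⟨fun k => (Y k).toReal, fun k => ENNReal.toReal_nonneg, fun k h hkh =>
    ENNReal.toReal_mono (hYt k) (hYanti hkh), fun k hk => ?_, fun k hk => ?_,
    fun k h hk hkh hy => ?_⟩
  · have h1 : Y k = 0 := (ENNReal.toReal_eq_zero_iff _).1 hk |>.resolve_right (hYt k)
    have h2 := (add_eq_zero.1 h1).1
    rw [ENNReal.rpow_eq_zero_iff_of_pos (by positivity)] at h2
    rw [ae_iff]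
    simpa only [not_le] using h2
  · set N := eLpNorm u 2 (volume.restrict Ω) + eLpNorm Du 2 (volume.restrict Ω) with hN
    have hNt : N ≠ ⊤ := ENNReal.add_ne_top.2 ⟨hu.isH1.memLp.2.ne, hu.isH1.memLp_grad.2.ne⟩
    obtain ⟨k1, k2, k3, k4⟩ := hK u Du φ hu
    have h1 := energy_le hα.le hcoα hu (hsol u Du φ hu)
    have h3 := k3 f hf.1 univ
    have h4 := k4 g hg.1 univ
    rw [Measure.restrict_univ] at h3 h4
    -- The energy is quadratic in N and the data term linear, so one factor N cancels.
    have h5 : ENNReal.ofReal (α / 2) * N ≤ K * m * V := by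
      refine mul_le_of_mul_sq_le hNt (h1.trans ((add_le_add h3 h4).trans ?_))
      calc _ ≤ K * m * N * volume.restrict Ω univ ^ a + K * m * N * surfaceMeasure Ω univ ^ b := by
            gcongr
        _ = _ := by simp only [V]; ring
    have h6 : ENNReal.ofReal k * Y k ≤ 2 * K * N := by
      calc ENNReal.ofReal k * Y k = ENNReal.ofReal k * volume.restrict Ω {x | k < ‖u x‖} ^ (1 / r) +
          ENNReal.ofReal k * surfaceMeasure Ω {x | k < ‖φ x‖} ^ (1 / s) := mul_add _ _ _
        _ ≤ K * N + K * N := by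
          refine add_le_add (le_trans ?_ k1) (le_trans ?_ k2)
          · exact ofReal_mul_measure_rpow_le_eLpNorm hu.isH1.memLp.1 hr0 fun x hx => le_of_lt hx
          · exact ofReal_mul_measure_rpow_le_eLpNorm hu.memLp_trace.1 hs0 fun x hx => le_of_lt hx
        _ = _ := by ring
    have h7 := ENNReal.toReal_mono (by finiteness) h5
    have h8 := ENNReal.toReal_mono (by finiteness) h6
    simp only [ENNReal.toReal_mul, ENNReal.toReal_ofReal hk.le, ENNReal.coe_toReal,
      ENNReal.toReal_ofReal (half_pos hα).le, ENNReal.toReal_ofNat] at h7 h8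
    have h9 : α * (k * (Y k).toReal) ≤ α * (C * m.toReal) := by
      calc α * (k * (Y k).toReal) ≤ α * (2 * K * N.toReal) := by gcongr
        _ = 4 * K * (α / 2 * N.toReal) := by ring
        _ ≤ 4 * K * (K * m.toReal * V.toReal) := by gcongr
        _ = 4 * (K : ℝ) ^ 2 * V.toReal * m.toReal := by ring
        _ ≤ α * C * m.toReal := by gcongr
        _ = _ := by ring
    exact le_of_mul_le_mul_left h9 hα
  · set γ := min (r * a) (s * b) with hγ
    have hγ0 : 0 < γ := lt_trans one_pos (lt_min hra hsb)
    -- Truncating between k and the midpoint of k and h leaves |T z| ≥ (h - k)/2 wherever |z| > h.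
    obtain ⟨T, hT, hTL, hTk, hTh, hTρ, hT'⟩ := exists_truncation hk
      (show k < (k + h) / 2 by linarith)
    have hT0 : T 0 = 0 := hTk 0 (by simpa using hk.le)
    have h1 := truncated_energy_le hΩ hbdd hβ.1 hBβ hlam hα.le hcoα hu hsol hT hTL hT0 hTh hTρ hT'
    have hv := hu.comp hΩ hbdd hT hTL hT0
    set N := eLpNorm (fun x => T (u x)) 2 (volume.restrict Ω) +
      eLpNorm (fun x => chainGrad T (u x) (Du x)) 2 (volume.restrict Ω) with hN
    have hNt : N ≠ ⊤ := ENNReal.add_ne_top.2 ⟨hv.isH1.memLp.2.ne, hv.isH1.memLp_grad.2.ne⟩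
    obtain ⟨k1, k2, k3, k4⟩ := hK _ _ _ hv
    have hY1 : Y k ≤ 1 := by
      rw [← ENNReal.ofReal_toReal (hYt k)]
      exact ENNReal.ofReal_le_one.2 hy
    -- The measure to the power a is its 1/r power raised to ra > 1. As Y ≤ 1, the exponent may be
    -- lowered to the common value γ.
    have hA : volume.restrict Ω {x | k < ‖u x‖} ^ a ≤ Y k ^ γ := by
      calc volume.restrict Ω {x | k < ‖u x‖} ^ a
          = (volume.restrict Ω {x | k < ‖u x‖} ^ (1 / r)) ^ (r * a) := by
            rw [← ENNReal.rpow_mul]; congr 1; field_simp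
        _ ≤ Y k ^ (r * a) := ENNReal.rpow_le_rpow le_self_add (by positivity)
        _ ≤ _ := ENNReal.rpow_le_rpow_of_exponent_ge hY1 (min_le_left _ _)
    have hB : surfaceMeasure Ω {x | k < ‖φ x‖} ^ b ≤ Y k ^ γ := by
      calc surfaceMeasure Ω {x | k < ‖φ x‖} ^ b
          = (surfaceMeasure Ω {x | k < ‖φ x‖} ^ (1 / s)) ^ (s * b) := by
            rw [← ENNReal.rpow_mul]; congr 1; field_simp
        _ ≤ Y k ^ (s * b) := ENNReal.rpow_le_rpow le_add_self (by positivity)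
        _ ≤ _ := ENNReal.rpow_le_rpow_of_exponent_ge hY1 (min_le_right _ _)
    have h3 : ∫⁻ x in Ω, ‖f x‖ₑ * ‖T (u x)‖ₑ ≤ K * m * N * Y k ^ γ := by
      refine (lintegral_le_setLIntegral (A := {x | k < ‖u x‖}) fun x hx => ?_).trans
        ((k3 f hf.1 _).trans (by gcongr))
      rw [hTk _ (not_lt.1 hx)]; simp
    have h4 : ∫⁻ x, ‖g x‖ₑ * ‖T (φ x)‖ₑ ∂(surfaceMeasure Ω) ≤ K * m * N * Y k ^ γ := by
      refine (lintegral_le_setLIntegral (A := {x | k < ‖φ x‖}) fun x hx => ?_).trans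
        ((k4 g hg.1 _).trans (by gcongr))
      rw [hTk _ (not_lt.1 hx)]; simp
    have h5 : ∫⁻ x, ‖T (φ x)‖ₑ ∂(surfaceMeasure Ω) ≤
        K * eLpNorm (fun _ => (1 : ℂ)) q (surfaceMeasure Ω) * N * Y k ^ γ := by
      refine (lintegral_le_setLIntegral (A := {x | k < ‖φ x‖}) fun x hx => ?_).trans ?_
      · rw [hTk _ (not_lt.1 hx)]; simp
      · have := k4 _ hS.1 {x | k < ‖φ x‖}
        simp only [enorm_one, one_mul] at this
        exact this.trans (by gcongr)
    have h6 : ENNReal.ofReal (α / 2) * N ≤ K * (2 * m + ENNReal.ofReal (B * ((k + h) / 2)) *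
        eLpNorm (fun _ => (1 : ℂ)) q (surfaceMeasure Ω)) * Y k ^ γ := by
      refine mul_le_of_mul_sq_le hNt (h1.trans ((add_le_add (add_le_add h3 h4)
        (mul_le_mul_right h5 _)).trans (le_of_eq ?_)))
      ring
    have h7 : ENNReal.ofReal ((h - k) / 2) * Y h ≤ 2 * K * N := by
      calc ENNReal.ofReal ((h - k) / 2) * Y h =
          ENNReal.ofReal ((h - k) / 2) * volume.restrict Ω {x | h < ‖u x‖} ^ (1 / r) +
          ENNReal.ofReal ((h - k) / 2) * surfaceMeasure Ω {x | h < ‖φ x‖} ^ (1 / s) := mul_add _ _ _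
        _ ≤ K * N + K * N := by
          refine add_le_add (le_trans ?_ k1) (le_trans ?_ k2)
          · refine ofReal_mul_measure_rpow_le_eLpNorm hv.isH1.memLp.1 hr0 fun x hx => ?_
            have h8 := hTh (u x)
            have h9 : h < ‖u x‖ := hx
            linarith
          · refine ofReal_mul_measure_rpow_le_eLpNorm hv.memLp_trace.1 hs0 fun x hx => ?_
            have h8 := hTh (φ x)
            have h9 : h < ‖φ x‖ := hx
            linarith
        _ = _ := by ring
    have hSt := hS.2.ne
    have hYγ : Y k ^ γ ≠ ⊤ := ENNReal.rpow_ne_top_of_nonneg hγ0.le (hYt k)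
    have h8 := ENNReal.toReal_mono (ENNReal.mul_ne_top (by finiteness) hYγ) h6
    have h9 := ENNReal.toReal_mono (by finiteness) h7
    have hX : (2 * m + ENNReal.ofReal (B * ((k + h) / 2)) *
        eLpNorm (fun _ => (1 : ℂ)) q (surfaceMeasure Ω)).toReal =
        2 * m.toReal + B * ((k + h) / 2) * S := by
      have : 0 ≤ B * ((k + h) / 2) := mul_nonneg hB0 (by linarith)
      rw [ENNReal.toReal_add (ENNReal.mul_ne_top ENNReal.ofNat_ne_top hmt)
        (ENNReal.mul_ne_top ENNReal.ofReal_ne_top hSt), ENNReal.toReal_mul, ENNReal.toReal_mul,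
        ENNReal.toReal_ofReal this, ENNReal.toReal_ofNat]
    rw [ENNReal.toReal_mul, ENNReal.toReal_mul, ENNReal.toReal_mul, hX,
      ENNReal.toReal_ofReal (half_pos hα).le, ENNReal.coe_toReal, ← ENNReal.toReal_rpow] at h8
    rw [ENNReal.toReal_mul, ENNReal.toReal_mul, ENNReal.toReal_mul,
      ENNReal.toReal_ofReal (by linarith), ENNReal.toReal_ofNat, ENNReal.coe_toReal] at h9
    have hy0 : 0 ≤ (Y k).toReal ^ γ := by positivity
    have hm0 : 0 ≤ m.toReal := ENNReal.toReal_nonneg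
    have h10 : 2 * m.toReal + B * ((k + h) / 2) * S ≤ 2 * (1 + B * S) * (m.toReal + h) := by
      have e1 : B * S * ((k + h) / 2) ≤ B * S * h := by gcongr; linarith
      have e2 : 0 ≤ B * S * m.toReal := by positivity
      have e3 : 0 ≤ B * S * h := mul_nonneg (by positivity) (by linarith)
      linarith
    have h11 : α * ((h - k) * (Y h).toReal) ≤
        α * (C * (m.toReal + h) * (Y k).toReal ^ γ) := by
      calc α * ((h - k) * (Y h).toReal) = 2 * α * ((h - k) / 2 * (Y h).toReal) := by ring
        _ ≤ 2 * α * (2 * K * N.toReal) := by gcongr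
        _ = 8 * K * (α / 2 * N.toReal) := by ring
        _ ≤ 8 * K * (K * (2 * m.toReal + B * ((k + h) / 2) * S) * (Y k).toReal ^ γ) := by gcongr
        _ ≤ 8 * K * (K * (2 * (1 + B * S) * (m.toReal + h)) * (Y k).toReal ^ γ) := by gcongr
        _ = 16 * (K : ℝ) ^ 2 * (1 + B * S) * (m.toReal + h) * (Y k).toReal ^ γ := by ring
        _ ≤ α * C * (m.toReal + h) * (Y k).toReal ^ γ := by
          have : 0 ≤ m.toReal + h := by linarith
          gcongr
        _ = _ := by ring
    exact le_of_mul_le_mul_left h11 hα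

/-- De Giorgi iteration. -/
theorem exists_deGiorgi_bound {C γ : ℝ} (hC : 0 < C) (hγ : 1 < γ) :
    ∃ N : ℝ, 0 < N ∧ ∀ (m : ℝ) (y : ℝ → ℝ), (∀ k, 0 ≤ y k) → Antitone y →
      (∀ k, 0 < k → k * y k ≤ C * m) →
      (∀ k h, 0 < k → k < h → y k ≤ 1 → (h - k) * y h ≤ C * (m + h) * y k ^ γ) →
      ∀ M, 0 < M → m ≤ M → y (N * M) = 0 := by
  have hγ1 : 0 < γ - 1 := by linarith
  -- Geometric decay at rate θ gains a factor θ^(γ-1) = 1/2 per step, exactly compensating the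
  -- halving of the gaps between levels.
  let θ : ℝ := (1 / 2) ^ (1 / (γ - 1))
  have hθ0 : 0 < θ := by positivity
  have hθ1 : θ < 1 := Real.rpow_lt_one (by norm_num) (by norm_num) (by positivity)
  have hθγ : θ ^ (γ - 1) = 1 / 2 := by
    rw [← Real.rpow_mul (by norm_num), one_div_mul_cancel hγ1.ne', Real.rpow_one]
  -- The bound ε ≤ 1 keeps y ≤ 1 along the iteration; the other entry gives 6Cε^(γ-1) ≤ θ, which
  -- closes the induction. The 6 combines m + k(n+1) ≤ 3N₀M with the factor 1/2 in the gap.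
  let ε : ℝ := min 1 ((θ / (6 * C)) ^ (1 / (γ - 1)))
  have hε0 : 0 < ε := lt_min one_pos (by positivity)
  have hε1 : ε ≤ 1 := min_le_left _ _
  have hεγ : 6 * C * ε ^ (γ - 1) ≤ θ := by
    have h1 : ε ^ (γ - 1) ≤ θ / (6 * C) := by
      calc ε ^ (γ - 1) ≤ ((θ / (6 * C)) ^ (1 / (γ - 1))) ^ (γ - 1) :=
            Real.rpow_le_rpow hε0.le (min_le_right _ _) hγ1.le
        _ = θ / (6 * C) := by
            rw [← Real.rpow_mul (by positivity), one_div_mul_cancel hγ1.ne', Real.rpow_one]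
    rw [le_div_iff₀ (by positivity)] at h1
    linarith
  -- The entry C/ε makes the starting estimate give y ≤ ε at level N₀M; the entry 1 gives M ≤ N₀M.
  let N₀ : ℝ := max 1 (C / ε)
  have hN₀ : 0 < N₀ := lt_of_lt_of_le one_pos (le_max_left _ _)
  refine ⟨2 * N₀, by positivity, fun m y hy0 hanti hstart hstep M hM hmM => ?_⟩
  -- The levels increase from N₀M to the limit 2N₀M. By antitonicity, y at the limit level is below
  -- every y(k n), hence zero.
  let k : ℕ → ℝ := fun n => N₀ * M * (2 - (1 / 2) ^ n)
  have hNM : 0 < N₀ * M := by positivity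
  have hpow : ∀ n : ℕ, (0 : ℝ) < (1 / 2) ^ n ∧ ((1 : ℝ) / 2) ^ n ≤ 1 := fun n =>
    ⟨by positivity, pow_le_one₀ (by norm_num) (by norm_num)⟩
  have hk0 : ∀ n, 0 < k n := fun n => mul_pos hNM (by linarith [(hpow n).2])
  have hk2 : ∀ n, k n ≤ 2 * N₀ * M := fun n => by
    have := mul_pos hNM (hpow n).1
    simp only [k]; linarith
  have hdiff : ∀ n, k (n + 1) - k n = N₀ * M * (1 / 2) ^ n / 2 := fun n => by
    simp only [k, pow_succ]; ring
  have hMN : M ≤ N₀ * M := le_mul_of_one_le_left hM.le (le_max_left _ _)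
  have hdecay : ∀ n, y (k n) ≤ ε * θ ^ n := by
    intro n
    induction n with
    | zero =>
      have h1 := hstart (N₀ * M) hNM
      have h2 : C ≤ N₀ * ε := by
        have := le_max_right 1 (C / ε)
        rwa [div_le_iff₀ hε0] at this
      have h3 : N₀ * M * y (N₀ * M) ≤ N₀ * M * ε := by
        calc N₀ * M * y (N₀ * M) ≤ C * m := h1
          _ ≤ C * M := by gcongr
          _ ≤ N₀ * ε * M := by gcongr
          _ = _ := by ring
      have h4 : k 0 = N₀ * M := by simp only [k, pow_zero]; ring
      rw [h4, pow_zero, mul_one]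
      exact le_of_mul_le_mul_left h3 hNM
    | succ n ih =>
      have hθn : 0 < θ ^ n := by positivity
      have hθn1 : θ ^ n ≤ 1 := pow_le_one₀ hθ0.le hθ1.le
      have h1 : y (k n) ≤ 1 := ih.trans (mul_le_one₀ hε1 hθn.le hθn1)
      have hpos : 0 < N₀ * M * (1 / 2) ^ n / 2 := by positivity
      have h2 := hstep (k n) (k (n + 1)) (hk0 n) (by linarith [hdiff n]) h1
      rw [hdiff] at h2
      have h3 : m + k (n + 1) ≤ 3 * (N₀ * M) := by linarith [hk2 (n + 1)]
      have h4 : y (k n) ^ γ ≤ ε * θ ^ n * (ε ^ (γ - 1) * (1 / 2) ^ n) := by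
        calc y (k n) ^ γ ≤ (ε * θ ^ n) ^ γ := Real.rpow_le_rpow (hy0 _) ih (by linarith)
          _ = (ε * θ ^ n) ^ (1 + (γ - 1)) := by ring_nf
          _ = ε * θ ^ n * (ε ^ (γ - 1) * (θ ^ (γ - 1)) ^ n) := by
            rw [Real.rpow_add (by positivity), Real.rpow_one, Real.mul_rpow hε0.le hθn.le,
              ← Real.rpow_natCast θ n, ← Real.rpow_mul hθ0.le, mul_comm (n : ℝ),
              Real.rpow_mul hθ0.le, Real.rpow_natCast, Real.rpow_natCast]
          _ = _ := by rw [hθγ]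
      have h5 : N₀ * M * (1 / 2) ^ n / 2 * y (k (n + 1)) ≤
          N₀ * M * (1 / 2) ^ n / 2 * (ε * θ ^ (n + 1)) := by
        calc _ ≤ C * (m + k (n + 1)) * y (k n) ^ γ := h2
          _ ≤ C * (3 * (N₀ * M)) * (ε * θ ^ n * (ε ^ (γ - 1) * (1 / 2) ^ n)) := by
            have := Real.rpow_nonneg (hy0 (k n)) γ
            gcongr
          _ = N₀ * M * (1 / 2) ^ n / 2 * (ε * θ ^ n * (6 * C * ε ^ (γ - 1))) := by ring
          _ ≤ N₀ * M * (1 / 2) ^ n / 2 * (ε * θ ^ n * θ) := by gcongr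
          _ = _ := by rw [pow_succ]; ring
      exact le_of_mul_le_mul_left h5 hpos
  have hlim : Tendsto (fun n : ℕ => ε * θ ^ n) atTop (𝓝 0) := by
    simpa using (tendsto_pow_atTop_nhds_zero_of_lt_one hθ0.le hθ1).const_mul ε
  exact le_antisymm (ge_of_tendsto' hlim fun n => (hanti (hk2 n)).trans (hdecay n)) (hy0 _)

theorem exists_eLpNorm_top_le {d : ℕ} (hd : 2 ≤ d) {Ω : Set (EuclideanSpace ℝ (Fin d))}
    (hΩ : IsOpen Ω) (hbdd : Bornology.IsBounded Ω) (hlip : HasLipschitzBoundary Ω)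
    {β : EuclideanSpace ℝ (Fin d) → ℂ} (hβ : MemLp β ⊤ (surfaceMeasure Ω)) {lam : ℝ}
    (hlam : 0 ≤ lam) (hco : FormCoercive Ω β lam) {p q : ℝ≥0∞} (hp : (d : ℝ≥0∞) / 2 < p)
    (hq : (d : ℝ≥0∞) - 1 < q) :
    ∃ c : ℝ, 0 < c ∧ ∀ f g u : EuclideanSpace ℝ (Fin d) → ℂ,
      MemLp f p (volume.restrict Ω) → MemLp g q (surfaceMeasure Ω) →
      IsWeakSolution Ω β lam f g u → MemLp u ⊤ (volume.restrict Ω) ∧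
        eLpNorm u ⊤ (volume.restrict Ω) ≤ ENNReal.ofReal c *
          (eLpNorm f p (volume.restrict Ω) + eLpNorm g q (surfaceMeasure Ω)) := by
  obtain ⟨C, γ, hC, hγ, hlevel⟩ := exists_level_set_estimate hd hΩ hbdd hlip hβ hlam hco hp hq
  obtain ⟨N, hN, hiter⟩ := exists_deGiorgi_bound hC hγ
  refine ⟨N, hN, fun f g u hf hg hw => ?_⟩
  obtain ⟨y, hy0, hanti, hyu, hstart, hstep⟩ := hlevel f g u hf hg hw
  set m := eLpNorm f p (volume.restrict Ω) + eLpNorm g q (surfaceMeasure Ω) with hm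
  have hmt : m ≠ ⊤ := ENNReal.add_ne_top.2 ⟨hf.2.ne, hg.2.ne⟩
  have hM : ∀ M : ℝ, 0 < M → m.toReal ≤ M →
      eLpNorm u ⊤ (volume.restrict Ω) ≤ ENNReal.ofReal (N * M) := by
    intro M hM hmM
    rw [eLpNorm_exponent_top]
    refine essSup_le_of_ae_le _ ?_
    filter_upwards [hyu _ (hiter m.toReal y hy0 hanti hstart hstep M hM hmM)] with x hx
    rw [← ofReal_norm]
    exact ENNReal.ofReal_le_ofReal hx
  -- The iteration needs a positive M, but the data may vanish; hence M is taken as the norm of the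
  -- data plus ε, and ε tends to 0.
  have hle : eLpNorm u ⊤ (volume.restrict Ω) ≤ ENNReal.ofReal N * m := by
    have hlim : Tendsto (fun ε : ℝ => ENNReal.ofReal (N * (m.toReal + ε))) (𝓝[>] 0)
        (𝓝 (ENNReal.ofReal (N * (m.toReal + 0)))) := by
      have : Continuous fun ε : ℝ => ENNReal.ofReal (N * (m.toReal + ε)) :=
        ENNReal.continuous_ofReal.comp (by fun_prop)
      exact (this.tendsto 0).mono_left nhdsWithin_le_nhds
    rw [add_zero, ENNReal.ofReal_mul hN.le, ENNReal.ofReal_toReal hmt] at hlim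
    refine ge_of_tendsto hlim ?_
    filter_upwards [self_mem_nhdsWithin] with ε hε
    have hε : 0 < ε := hε
    exact hM _ (add_pos_of_nonneg_of_pos ENNReal.toReal_nonneg hε) (by linarith)
  obtain ⟨Du, φ, hu, -⟩ := hw
  exact ⟨⟨hu.isH1.memLp.1, hle.trans_lt (ENNReal.mul_lt_top ENNReal.ofReal_lt_top hmt.lt_top)⟩, hle⟩

end RobinProblem

end

theorem proposition4p3 {d : ℕ} (hd : 2 ≤ d)
    (Ω : Set (EuclideanSpace ℝ (Fin d))) (hΩ_open : IsOpen Ω) (hΩ_bdd : Bornology.IsBounded Ω)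
    (hΩ_lip : RobinProblem.HasLipschitzBoundary Ω)
    (β : EuclideanSpace ℝ (Fin d) → ℂ) (hβ : MemLp β ∞ (RobinProblem.surfaceMeasure Ω))
    (ω₀ : ℝ) (hω₀ : 0 ≤ ω₀) (hcoer : RobinProblem.FormCoercive Ω β ω₀)
    (p q : ℝ≥0∞) (hp : (d : ℝ≥0∞) / 2 < p) (hq : (d : ℝ≥0∞) - 1 < q)
    (lam : ℝ) (hlam : ω₀ ≤ lam) :
    (∀ f g : EuclideanSpace ℝ (Fin d) → ℂ,
      MemLp f p (volume.restrict Ω) → MemLp g q (RobinProblem.surfaceMeasure Ω) →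
        (∃ u, RobinProblem.IsWeakSolution Ω β lam f g u) ∧
        ∀ u₁ u₂, RobinProblem.IsWeakSolution Ω β lam f g u₁ →
          RobinProblem.IsWeakSolution Ω β lam f g u₂ → u₁ =ᵐ[volume.restrict Ω] u₂) ∧
    ∃ c : ℝ, 0 < c ∧ ∀ f g u : EuclideanSpace ℝ (Fin d) → ℂ,
      MemLp f p (volume.restrict Ω) → MemLp g q (RobinProblem.surfaceMeasure Ω) →
        RobinProblem.IsWeakSolution Ω β lam f g u →
          MemLp u ∞ (volume.restrict Ω) ∧
          eLpNorm u ∞ (volume.restrict Ω) ≤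
            ENNReal.ofReal c * (eLpNorm f p (volume.restrict Ω) +
              eLpNorm g q (RobinProblem.surfaceMeasure Ω)) := by
  have hco := hcoer.mono hlam
  exact ⟨fun f g hf hg =>
    ⟨RobinProblem.exists_isWeakSolution hd hΩ_open hΩ_bdd hΩ_lip hβ hco hp hq hf hg,
      fun u₁ u₂ h₁ h₂ =>
        RobinProblem.isWeakSolution_unique hd hΩ_open hΩ_bdd hΩ_lip hβ hco h₁ h₂⟩,
    RobinProblem.exists_eLpNorm_top_le hd hΩ_open hΩ_bdd hΩ_lip hβ (hω₀.trans hlam) hco hp hq⟩
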